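/- Let $k$ be a commutative ring. Let $\operatorname{Ch}$ be the category of unbounded chain complexes of $k$-modules (differentials of degree $-1$), with the usual tensor product $d(x\otimes y)=d(x)\otimes y+(-1)^{|x|}x\otimes d(y)$ and symmetry $x\otimes y\mapsto(-1)^{|x||y|}y\otimes x$. Let $\operatorname{bCh}$ be the category of bicomplexes of $k$-modules in the right half-plane: families of $k$-modules $X_{p,q}$, $p\ge 0$, $q\in\mathbb Z$, with differentials $d_h\colon X_{p,q}\to X_{p-1,q}$ and $d_v\colon X_{p,q}\to X_{p,q-1}$ such that $d_h^2=0$, $d_v^2=0$ and $d_vd_h+d_hd_v=0$; morphisms are families of $k$-linear maps commuting with $d_h$ and $d_v$. It is symmetric monoidal with $$(X\otimes Y)_{p,q}=\bigoplus_{m+s=p,\;n+t=q}X_{m,n}\otimes_k Y_{s,t},$$ $$d_h(x\otimes y)=d_h(x)\otimes y+(-1)^{|x|}x\otimes d_h(y),\qquad d_v(x\otimes y)=d_v(x)\otimes y+(-1)^{|x|}x\otimes d_v(y),$$ with unit $k$ in bidegree $(0,0)$ and symmetry $x\otimes y\mapsto(-1)^{|x||y|}y\otimes x$, where $|x|=p+q$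 for $x\in X_{p,q}$ is the total degree. Let $\operatorname{Tot}(X)$ be the chain complex with $\operatorname{Tot}_n(X)=\bigoplus_{p+q=n}X_{p,q}$ and differential $d_h+d_v$. Then $\operatorname{Ch}$ has a model structure whose weak equivalences are the quasi-isomorphisms and whose fibrations are the degreewise surjections (the projective model structure), and $\operatorname{bCh}$ has a model structure, denoted $\operatorname{bCh}_{\operatorname{Tot}}$, whose weak equivalences are the morphisms $f$ such that $\operatorname{Tot}(f)$ is a quasi-isomorphism and whose fibrations are the pointwise surjective morphisms $f$ such that the induced map $H^v_{p,*}(f)$ on vertical homology is an isomorphism for all $p>0$ (the total model structure). Both are monoidal model categories, i.e. they satisfy the pushout-product axiom and the unit axiom (if $Q\to\mathbb 1$ is a weak equivalence to the tensor unit $\mathbb 1$ with $Q$ cofibrant, then $Q\otimes X\to \mathbb 1\otimes X$ and $X\otimes Q\to X\otimes\mathbb 1$ are weak equivalences for all cofibrant $X$). Let $i\colon\operatorname{Ch}\to\operatorname{bCh}$ be the inclusion of chain complexes as bicomplexes concentrated in horizontal degree $0$. Then $i$ is the left adjoint of a strong symmetric monoidal Quillen equivalence $$i\colon\operatorname{Ch}\rightleftarrows\operatorname{bCh}_{\operatorname{Tot}}$$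 with right adjoint $X\mapsto X_{0,*}$, the adjunct of a morphism $f\colon iK\to X$ being $f_{0,*}\colon K\to X_{0,*}$. Explicitly: $i$ preserves cofibrations and trivial cofibrations; for $K$ cofibrant in $\operatorname{Ch}$ and $X$ fibrant in $\operatorname{bCh}_{\operatorname{Tot}}$, a morphism $iK\to X$ is a weak equivalence if and only if its adjunct $K\to X_{0,*}$ is; $i$ admits the structure of a strong symmetric monoidal functor; and $i$ sends every weak equivalence $Q\to\mathbb 1$ with $Q$ cofibrant to a weak equivalence. -/

import Mathlib

open CategoryTheory Limits MonoidalCategory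
universe u
set_option linter.all false

namespace KoszulSign

/-- For signs `u = (-1)^m` and `v = (-1)^n` this is `(-1)^(m * n)`. -/
def koszul (u v : ℤˣ) : ℤˣ := if u = 1 then 1 else v

lemma koszul_negOnePow (m n : ℤ) :
    koszul m.negOnePow n.negOnePow = (m * n).negOnePow := by
  unfold koszul
  split_ifs with h
  · rw [Int.negOnePow_eq_one_iff] at h
    exact ((Int.negOnePow_eq_one_iff _).2 (h.mul_right n)).symm
  · rw [Int.negOnePow_eq_one_iff, Int.not_even_iff_odd] at h
    obtain ⟨r, rfl⟩ := h
    rw [show (2 * r + 1) * n = 2 * (r * n) + n by ring, Int.negOnePow_add,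
      Int.negOnePow_two_mul, one_mul]

lemma koszul_mul_left : ∀ u v w : ℤˣ, koszul (u * v) w = koszul u w * koszul v w := by decide
lemma koszul_mul_right : ∀ u v w : ℤˣ, koszul u (v * w) = koszul u v * koszul u w := by decide
lemma koszul_comm : ∀ u v : ℤˣ, koszul u v = koszul v u := by decide
lemma koszul_mul_self : ∀ u v : ℤˣ, koszul u v * koszul v u = 1 := by decide
lemma koszul_neg_left : ∀ u v : ℤˣ, koszul (-u) v = koszul u v * v := by decide
lemma koszul_neg_right : ∀ u v : ℤˣ, u * koszul u (-v) = koszul u v := by decide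

end KoszulSign

open KoszulSign

namespace GradedKoszul

variable {k : Type u} [CommRing k] {I : Type} [AddCommMonoid I] [DecidableEq I]
  (ε : Multiplicative I →* ℤˣ)

local notation X " ⊠ " Y => GradedObject.Monoidal.tensorObj X Y

/-- The symmetry `x ⊗ y ↦ (-1)^(|x| |y|) y ⊗ x` on graded modules, where `ε i = (-1)^|i|`. -/
noncomputable def braidingHom (X Y : GradedObject I (ModuleCat.{u} k)) : (X ⊠ Y) ⟶ (Y ⊠ X) :=
  fun j => GradedObject.Monoidal.tensorObjDesc (fun a b h =>
    koszul (ε (.ofAdd a)) (ε (.ofAdd b)) •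
      ((β_ (X a) (Y b)).hom ≫
        GradedObject.Monoidal.ιTensorObj Y X b a j (by rw [add_comm, h])))

@[simp]
lemma ι_braidingHom (X Y : GradedObject I (ModuleCat.{u} k)) (a b j : I) (h : a + b = j) :
    GradedObject.Monoidal.ιTensorObj X Y a b j h ≫ braidingHom ε X Y j =
      koszul (ε (.ofAdd a)) (ε (.ofAdd b)) •
      ((β_ (X a) (Y b)).hom ≫
        GradedObject.Monoidal.ιTensorObj Y X b a j (by rw [add_comm, h])) := by
  simp [braidingHom]

@[simp]
lemma ι_braidingHom_assoc (X Y : GradedObject I (ModuleCat.{u} k)) (a b j : I) (h : a + b = j)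
    {M : ModuleCat.{u} k} (g : (Y ⊠ X) j ⟶ M) :
    GradedObject.Monoidal.ιTensorObj X Y a b j h ≫ braidingHom ε X Y j ≫ g =
      koszul (ε (.ofAdd a)) (ε (.ofAdd b)) •
      ((β_ (X a) (Y b)).hom ≫
        GradedObject.Monoidal.ιTensorObj Y X b a j (by rw [add_comm, h]) ≫ g) := by
  rw [← Category.assoc, ι_braidingHom, Linear.units_smul_comp, Category.assoc]

lemma ι_braidingHom' (X Y : GradedObject I (ModuleCat.{u} k)) (a b j : I) (h : a + b = j) :
    GradedObject.Monoidal.ιTensorObj X Y a b j h ≫ braidingHom ε X Y j =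
      koszul (ε (.ofAdd a)) (ε (.ofAdd b)) •
      (GradedObject.Monoidal.ιTensorObj X Y a b j h ≫
        (GradedObject.Monoidal.braiding X Y).hom j) := by
  rw [ι_braidingHom]
  simp [GradedObject.Monoidal.braiding]

lemma braidingHom_symm (X Y : GradedObject I (ModuleCat.{u} k)) :
    braidingHom ε X Y ≫ braidingHom ε Y X = 𝟙 _ := by
  funext j
  apply GradedObject.Monoidal.tensorObj_ext
  intro a b h
  simp [smul_smul, koszul_mul_self, Linear.units_smul_comp, Linear.comp_units_smul]

lemma whiskerRight_units_smul (u : ℤˣ) {A B : ModuleCat.{u} k} (f : A ⟶ B) (C : ModuleCat.{u} k) :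
    (u • f) ▷ C = u • (f ▷ C) := by
  rcases Int.units_eq_one_or u with rfl | rfl
  · simp
  · simp only [Units.neg_smul, one_smul]
    exact (tensorRight C).map_neg

lemma whiskerLeft_units_smul (u : ℤˣ) {A B : ModuleCat.{u} k} (f : A ⟶ B) (C : ModuleCat.{u} k) :
    C ◁ (u • f) = u • (C ◁ f) := by
  rcases Int.units_eq_one_or u with rfl | rfl
  · simp
  · simp only [Units.neg_smul, one_smul]
    exact (tensorLeft C).map_neg

lemma naturality_right (X : GradedObject I (ModuleCat.{u} k))
    {Y Z : GradedObject I (ModuleCat.{u} k)} (f : Y ⟶ Z) :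
    GradedObject.Monoidal.whiskerLeft X f ≫ braidingHom ε X Z =
      braidingHom ε X Y ≫ GradedObject.Monoidal.whiskerRight f X := by
  funext j
  apply GradedObject.Monoidal.tensorObj_ext
  intro a b h
  simp [Linear.units_smul_comp, Linear.comp_units_smul]

lemma naturality_left {X Y : GradedObject I (ModuleCat.{u} k)} (f : X ⟶ Y)
    (Z : GradedObject I (ModuleCat.{u} k)) :
    GradedObject.Monoidal.whiskerRight f Z ≫ braidingHom ε Y Z =
      braidingHom ε X Z ≫ GradedObject.Monoidal.whiskerLeft Z f := by
  funext j
  apply GradedObject.Monoidal.tensorObj_ext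
  intro a b h
  simp [Linear.units_smul_comp, Linear.comp_units_smul]

open GradedObject.Monoidal in
lemma hexagon_forward (X Y Z : GradedObject I (ModuleCat.{u} k)) :
    (GradedObject.Monoidal.associator X Y Z).hom ≫ braidingHom ε X (Y ⊠ Z) ≫
        (GradedObject.Monoidal.associator Y Z X).hom =
      GradedObject.Monoidal.whiskerRight (braidingHom ε X Y) Z ≫
        (GradedObject.Monoidal.associator Y X Z).hom ≫
        GradedObject.Monoidal.whiskerLeft Y (braidingHom ε X Z) := by
  have H := GradedObject.Monoidal.hexagon_forward X Y Z
  funext j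
  apply GradedObject.Monoidal.tensorObj₃'_ext
  intro a b c h
  have Hj := congr_arg (fun f => ιTensorObj₃' X Y Z a b c j h ≫ f j) H
  dsimp at Hj ⊢
  have e1 : ιTensorObj₃' X Y Z a b c j h ≫ (GradedObject.Monoidal.associator X Y Z).hom j ≫
      braidingHom ε X (Y ⊠ Z) j =
      (koszul (ε (.ofAdd a)) (ε (.ofAdd b)) * koszul (ε (.ofAdd a)) (ε (.ofAdd c))) •
      ιTensorObj₃' X Y Z a b c j h ≫ (GradedObject.Monoidal.associator X Y Z).hom j ≫
      (GradedObject.Monoidal.braiding X (Y ⊠ Z)).hom j := by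
    rw [ιTensorObj₃'_associator_hom_assoc, ιTensorObj₃'_associator_hom_assoc,
      ιTensorObj₃_eq X Y Z a b c j h _ rfl, Category.assoc, Category.assoc, ι_braidingHom',
      Linear.comp_units_smul, Linear.comp_units_smul, ofAdd_add, map_mul, koszul_mul_right]
  have e2 : ∀ j, ∀ h, ιTensorObj₃' X Y Z a b c j h ≫
      GradedObject.Monoidal.whiskerRight (braidingHom ε X Y) Z j =
      koszul (ε (.ofAdd a)) (ε (.ofAdd b)) • ιTensorObj₃' X Y Z a b c j h ≫
      GradedObject.Monoidal.whiskerRight (GradedObject.Monoidal.braiding X Y).hom Z j := by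
    intro j h
    rw [ιTensorObj₃'_eq X Y Z a b c j h _ rfl, Category.assoc, Category.assoc]
    simp only [GradedObject.Monoidal.whiskerRight, ι_tensorHom]
    simp only [GradedObject.categoryOfGradedObjects_id, MonoidalCategory.tensorHom_id]
    rw [← comp_whiskerRight_assoc, ← comp_whiskerRight_assoc, ι_braidingHom',
      whiskerRight_units_smul, Linear.units_smul_comp]
  have e3 : ∀ h, ιTensorObj₃ Y X Z b a c j h ≫
      GradedObject.Monoidal.whiskerLeft Y (braidingHom ε X Z) j =
      koszul (ε (.ofAdd a)) (ε (.ofAdd c)) • ιTensorObj₃ Y X Z b a c j h ≫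
      GradedObject.Monoidal.whiskerLeft Y (GradedObject.Monoidal.braiding X Z).hom j := by
    intro h
    rw [ιTensorObj₃_eq Y X Z b a c j h _ rfl, Category.assoc, Category.assoc]
    simp only [GradedObject.Monoidal.whiskerLeft, ι_tensorHom]
    simp only [GradedObject.categoryOfGradedObjects_id, MonoidalCategory.id_tensorHom]
    rw [← MonoidalCategory.whiskerLeft_comp_assoc, ← MonoidalCategory.whiskerLeft_comp_assoc,
      ι_braidingHom', whiskerLeft_units_smul, Linear.units_smul_comp]
  have e4 : ∀ h', ιTensorObj₃' X Y Z a b c j h ≫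
      GradedObject.Monoidal.whiskerRight (GradedObject.Monoidal.braiding X Y).hom Z j =
      (β_ (X a) (Y b)).hom ▷ Z c ≫ ιTensorObj₃' Y X Z b a c j h' := by
    intro h'
    rw [ιTensorObj₃'_eq X Y Z a b c j h _ rfl, Category.assoc,
      ιTensorObj₃'_eq Y X Z b a c j h' (a + b) (add_comm _ _)]
    simp only [GradedObject.Monoidal.whiskerRight, ι_tensorHom]
    simp only [GradedObject.categoryOfGradedObjects_id, MonoidalCategory.tensorHom_id]
    rw [← comp_whiskerRight_assoc, ← comp_whiskerRight_assoc]
    simp [GradedObject.Monoidal.braiding]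
  have hb : b + a + c = j := by rw [add_comm b a, h]
  have lhs := reassoc_of% e1
  rw [lhs, Linear.units_smul_comp]
  simp only [Category.assoc]
  rw [Hj]
  have e2' := reassoc_of% (e2 j h)
  rw [e2', Linear.units_smul_comp]
  simp only [Category.assoc]
  have e4' := reassoc_of% (e4 hb)
  rw [e4', e4', ιTensorObj₃'_associator_hom_assoc, ιTensorObj₃'_associator_hom_assoc, e3 hb]
  simp only [Linear.comp_units_smul, smul_smul]

lemma hexagon_reverse (X Y Z : GradedObject I (ModuleCat.{u} k)) :
    (GradedObject.Monoidal.associator X Y Z).inv ≫ braidingHom ε (X ⊠ Y) Z ≫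
        (GradedObject.Monoidal.associator Z X Y).inv =
      GradedObject.Monoidal.whiskerLeft X (braidingHom ε Y Z) ≫
        (GradedObject.Monoidal.associator X Z Y).inv ≫
        GradedObject.Monoidal.whiskerRight (braidingHom ε X Z) Y := by
  have H := hexagon_forward ε Z X Y
  have w1 : GradedObject.Monoidal.whiskerLeft X (braidingHom ε Z Y) ≫
      GradedObject.Monoidal.whiskerLeft X (braidingHom ε Y Z) = 𝟙 _ :=
    (MonoidalCategory.whiskerLeft_comp X (braidingHom ε Z Y) (braidingHom ε Y Z)).symm.trans
      ((congr_arg (fun f => X ◁ f) (braidingHom_symm ε Z Y)).trans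
        (MonoidalCategory.whiskerLeft_id X _))
  have w2 : GradedObject.Monoidal.whiskerRight (braidingHom ε Z X) Y ≫
      GradedObject.Monoidal.whiskerRight (braidingHom ε X Z) Y = 𝟙 _ :=
    (MonoidalCategory.comp_whiskerRight (braidingHom ε Z X) (braidingHom ε X Z) Y).symm.trans
      ((congr_arg (fun f => f ▷ Y) (braidingHom_symm ε Z X)).trans
        (MonoidalCategory.id_whiskerRight _ Y))
  have hA : ((GradedObject.Monoidal.associator X Y Z).inv ≫ braidingHom ε (X ⊠ Y) Z ≫
      (GradedObject.Monoidal.associator Z X Y).inv) ≫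
      ((GradedObject.Monoidal.associator Z X Y).hom ≫ braidingHom ε Z (X ⊠ Y) ≫
        (GradedObject.Monoidal.associator X Y Z).hom) = 𝟙 _ := by
    simp only [Category.assoc, Iso.inv_hom_id_assoc]
    rw [reassoc_of% (braidingHom_symm ε (X ⊠ Y) Z), Iso.inv_hom_id]
  have hB : (GradedObject.Monoidal.whiskerRight (braidingHom ε Z X) Y ≫
        (GradedObject.Monoidal.associator X Z Y).hom ≫
        GradedObject.Monoidal.whiskerLeft X (braidingHom ε Z Y)) ≫
      (GradedObject.Monoidal.whiskerLeft X (braidingHom ε Y Z) ≫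
        (GradedObject.Monoidal.associator X Z Y).inv ≫
        GradedObject.Monoidal.whiskerRight (braidingHom ε X Z) Y) = 𝟙 _ := by
    simp only [Category.assoc]
    rw [reassoc_of% w1, Iso.hom_inv_id_assoc, w2]
  rw [← Category.comp_id ((GradedObject.Monoidal.associator X Y Z).inv ≫ _), ← hB, ← H,
    ← Category.assoc, hA, Category.id_comp]

end GradedKoszul

namespace HomologicalComplex
open GradedKoszul

variable {k : Type u} [CommRing k] {I : Type} [AddCommMonoid I] [DecidableEq I]
  (c : ComplexShape I) [c.TensorSigns]

noncomputable instance koszulMonoidalCategory :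
    MonoidalCategory (HomologicalComplex (ModuleCat.{u} k) c) :=
  HomologicalComplex.monoidalCategory _ _

variable {c}

lemma associator_hom_f (X Y Z : HomologicalComplex (ModuleCat.{u} k) c) (j : I) :
    (associator X Y Z).hom.f j = (GradedObject.Monoidal.associator X.X Y.X Z.X).hom j := rfl

lemma associator_inv_f (X Y Z : HomologicalComplex (ModuleCat.{u} k) c) (j : I) :
    (associator X Y Z).inv.f j = (GradedObject.Monoidal.associator X.X Y.X Z.X).inv j := rfl

open scoped ZeroObject in
/-- The graded module `k` concentrated in degree `0`. -/
noncomputable def gradedUnit (k : Type u) [CommRing k] (I : Type) [AddCommMonoid I]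
    [DecidableEq I] : GradedObject I (ModuleCat.{u} k) :=
  fun i => if i = 0 then 𝟙_ (ModuleCat.{u} k) else 0

lemma isZero_gradedUnit (i : I) (hi : i ≠ 0) : IsZero (gradedUnit k I i) := by
  unfold gradedUnit
  rw [if_neg hi]
  exact Limits.isZero_zero _

variable (k I) in
/-- The identification with the unit of the tensor product of graded objects. -/
noncomputable def gradedUnitIso :
    (GradedObject.single₀ I).obj (𝟙_ (ModuleCat.{u} k)) ≅ gradedUnit k I :=
  GradedObject.isoMk _ _ (fun i =>
    if hi : i = 0 then
      (GradedObject.singleObjApplyIsoOfEq (0 : I) (𝟙_ (ModuleCat.{u} k)) i hi).trans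
        (eqToIso (if_pos hi)).symm
    else
      { hom := 0
        inv := 0
        hom_inv_id := (GradedObject.isInitialSingleObjApply 0
          (𝟙_ (ModuleCat.{u} k)) i hi).hom_ext _ _
        inv_hom_id := (isZero_gradedUnit i hi).eq_of_src _ _ })

/-- The left unit constraint for graded modules. -/
noncomputable def gradedLeftUnitor (X : GradedObject I (ModuleCat.{u} k)) :
    GradedObject.Monoidal.tensorObj (gradedUnit k I) X ≅ X :=
  GradedObject.Monoidal.tensorIso (gradedUnitIso k I).symm (Iso.refl _) ≪≫
    GradedObject.Monoidal.leftUnitor X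

/-- The right unit constraint for graded modules. -/
noncomputable def gradedRightUnitor (X : GradedObject I (ModuleCat.{u} k)) :
    GradedObject.Monoidal.tensorObj X (gradedUnit k I) ≅ X :=
  GradedObject.Monoidal.tensorIso (Iso.refl _) (gradedUnitIso k I).symm ≪≫
    GradedObject.Monoidal.rightUnitor X

lemma gradedLeftUnitor_comm (X : HomologicalComplex (ModuleCat.{u} k) c) (i j : I) :
    (gradedLeftUnitor X.X).hom i ≫ X.d i j =
      (tensorObj (tensorUnit (ModuleCat.{u} k) c) X).d i j ≫ (gradedLeftUnitor X.X).hom j :=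
  (leftUnitor X).hom.comm i j

lemma gradedRightUnitor_comm (X : HomologicalComplex (ModuleCat.{u} k) c) (i j : I) :
    (gradedRightUnitor X.X).hom i ≫ X.d i j =
      (tensorObj X (tensorUnit (ModuleCat.{u} k) c)).d i j ≫ (gradedRightUnitor X.X).hom j :=
  (rightUnitor X).hom.comm i j

lemma leftUnitor_f (X : HomologicalComplex (ModuleCat.{u} k) c) :
    (λ_ X).hom.f = (gradedLeftUnitor X.X).hom := rfl

lemma rightUnitor_f (X : HomologicalComplex (ModuleCat.{u} k) c) :
    (ρ_ X).hom.f = (gradedRightUnitor X.X).hom := rfl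

lemma triangle_f (X Y : HomologicalComplex (ModuleCat.{u} k) c) (j : I) :
    (GradedObject.Monoidal.associator X.X (gradedUnit k I) Y.X).hom j ≫
      GradedObject.Monoidal.whiskerLeft X.X (gradedLeftUnitor Y.X).hom j =
    GradedObject.Monoidal.whiskerRight (gradedRightUnitor X.X).hom Y.X j :=
  congr_hom (MonoidalCategory.triangle X Y) j

lemma tensorHom_comm {X X' Y Y' : HomologicalComplex (ModuleCat.{u} k) c}
    (f : X ⟶ X') (g : Y ⟶ Y') (i j : I) :
    GradedObject.Monoidal.tensorHom f.f g.f i ≫ (tensorObj X' Y').d i j =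
      (tensorObj X Y).d i j ≫ GradedObject.Monoidal.tensorHom f.f g.f j :=
  (tensorHom f g).comm i j

lemma ι_tensor_d (X Y : HomologicalComplex (ModuleCat.{u} k) c) (a b i j : I) (h : a + b = i) :
    ιTensorObj X Y a b i h ≫ (tensorObj X Y).d i j =
      X.d a (c.next a) ▷ Y.X b ≫
        ιMapBifunctorOrZero X Y (curriedTensor (ModuleCat.{u} k)) c (c.next a) b j +
      c.ε a • (X.X a ◁ Y.d b (c.next b) ≫
        ιMapBifunctorOrZero X Y (curriedTensor (ModuleCat.{u} k)) c a (c.next b) j) := by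
  rw [mapBifunctor.d_eq, Preadditive.comp_add, mapBifunctor.ι_D₁, mapBifunctor.ι_D₂]
  congr 1
  · by_cases h1 : c.Rel a (c.next a)
    · rw [mapBifunctor.d₁_eq' _ _ _ _ h1]
      simp
    · rw [mapBifunctor.d₁_eq_zero _ _ _ _ _ _ _ h1, X.shape _ _ h1]
      simp


/-- The components of the symmetry of the tensor product of complexes. -/
noncomputable def braidingX (X Y : HomologicalComplex (ModuleCat.{u} k) c) (j : I) :
    (tensorObj X Y).X j ⟶ (tensorObj Y X).X j :=
  braidingHom (ComplexShape.TensorSigns.ε' c) X.X Y.X j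

lemma ι_braidingX (X Y : HomologicalComplex (ModuleCat.{u} k) c) (a b j : I) (h : a + b = j) :
    ιTensorObj X Y a b j h ≫ braidingX X Y j =
      koszul (c.ε a) (c.ε b) • ((β_ (X.X a) (Y.X b)).hom ≫
        ιTensorObj Y X b a j ((add_comm b a).trans h)) :=
  ι_braidingHom _ X.X Y.X a b j h

lemma ιOrZero_braidingX (X Y : HomologicalComplex (ModuleCat.{u} k) c) (a b j : I) :
    ιMapBifunctorOrZero X Y (curriedTensor (ModuleCat.{u} k)) c a b j ≫ braidingX X Y j =
      koszul (c.ε a) (c.ε b) • ((β_ (X.X a) (Y.X b)).hom ≫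
        ιMapBifunctorOrZero Y X (curriedTensor (ModuleCat.{u} k)) c b a j) := by
  by_cases h : a + b = j
  · rw [ιMapBifunctorOrZero_eq _ _ _ _ _ _ _ h,
      ιMapBifunctorOrZero_eq _ _ _ _ _ _ _ (show _ = _ from (add_comm b a).trans h)]
    exact ι_braidingX X Y a b j h
  · rw [ιMapBifunctorOrZero_eq_zero _ _ _ _ _ _ _ h,
      ιMapBifunctorOrZero_eq_zero _ _ _ _ _ _ _ (show ¬ _ = _ from
        fun h' => h ((add_comm a b).trans h')), zero_comp, comp_zero, smul_zero]

lemma braiding_comm (X Y : HomologicalComplex (ModuleCat.{u} k) c) (i j : I) (hij : c.Rel i j) :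
    braidingX X Y i ≫ (tensorObj Y X).d i j = (tensorObj X Y).d i j ≫ braidingX X Y j := by
  apply mapBifunctor.hom_ext
  intro a b h
  rw [reassoc_of% (ι_braidingX X Y a b i h), reassoc_of% (ι_tensor_d X Y a b i j h),
    Linear.units_smul_comp, Category.assoc, ι_tensor_d Y X b a i j ((add_comm b a).trans h),
    Preadditive.add_comp, Linear.units_smul_comp, Category.assoc, Category.assoc,
    ιOrZero_braidingX, ιOrZero_braidingX]
  simp only [Preadditive.comp_add, Linear.comp_units_smul, smul_add, smul_smul]
  rw [add_comm]
  congr 1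
  · by_cases h1 : c.Rel a (c.next a)
    · rw [c.ε_succ h1, koszul_neg_left, BraidedCategory.braiding_naturality_left_assoc]
    · simp [X.shape _ _ h1]
  · by_cases h1 : c.Rel b (c.next b)
    · rw [c.ε_succ h1, koszul_neg_right, BraidedCategory.braiding_naturality_right_assoc]
    · simp [Y.shape _ _ h1]

/-- The symmetry `x ⊗ y ↦ (-1)^(|x| |y|) y ⊗ x` for complexes. -/
noncomputable def koszulBraiding (X Y : HomologicalComplex (ModuleCat.{u} k) c) : X ⊗ Y ≅ Y ⊗ X where
  hom := { f := braidingX X Y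
           comm' := braiding_comm X Y }
  inv := { f := braidingX Y X
           comm' := braiding_comm Y X }
  hom_inv_id := by ext j : 1; exact congr_fun (braidingHom_symm _ X.X Y.X) j
  inv_hom_id := by ext j : 1; exact congr_fun (braidingHom_symm _ Y.X X.X) j

noncomputable instance koszulSymmetricCategory :
    SymmetricCategory (HomologicalComplex (ModuleCat.{u} k) c) where
  braiding := koszulBraiding
  braiding_naturality_right X Y Z f := by
    ext j : 1; exact congr_fun (naturality_right _ X.X (Y := Y.X) (Z := Z.X) f.f) j
  braiding_naturality_left {X Y} f Z := by
    ext j : 1; exact congr_fun (naturality_left _ (X := X.X) (Y := Y.X) f.f Z.X) j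
  hexagon_forward X Y Z := by
    ext j : 1; exact congr_fun (hexagon_forward _ X.X Y.X Z.X) j
  hexagon_reverse X Y Z := by
    ext j : 1; exact congr_fun (hexagon_reverse _ X.X Y.X Z.X) j
  symmetry X Y := (koszulBraiding X Y).hom_inv_id

end HomologicalComplex

instance : (ComplexShape.down ℤ).TensorSigns where
  ε' := MonoidHom.mk' Int.negOnePow Int.negOnePow_add
  rel_add p q r (hpq : q + 1 = p) := by change q + r + 1 = p + r; lia
  add_rel p q r (hpq : q + 1 = p) := by change r + q + 1 = r + p; lia
  ε'_succ := by
    rintro _ q rfl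
    change q.negOnePow = - (q + 1).negOnePow
    rw [Int.negOnePow_succ, neg_neg]

/-- The category `Ch` of unbounded chain complexes of `k`-modules (differentials have degree `-1`). -/
abbrev Ch (k : Type u) [CommRing k] := ChainComplex (ModuleCat.{u} k) ℤ

/-- The sign `(-1)^(p + q)` attached to the bidegree `(p, q)`. -/
def totalSign : Multiplicative (ℕ × ℤ) →* ℤˣ :=
  MonoidHom.mk' (fun i => ((i.toAdd.1 : ℤ) + i.toAdd.2).negOnePow) (by
    rintro a b
    simp only [toAdd_mul, Prod.fst_add, Prod.snd_add, Nat.cast_add, ← Int.negOnePow_add]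
    congr 1
    ring)

/-- The shape of the horizontal differentials, from bidegree `(p + 1, q)` to `(p, q)`. -/
def horizontalShape : ComplexShape (ℕ × ℤ) where
  Rel i j := j.1 + 1 = i.1 ∧ j.2 = i.2
  next_eq := by
    rintro ⟨a, b⟩ ⟨c, d⟩ ⟨e, f⟩ ⟨h1, h2⟩ ⟨h3, h4⟩
    ext
    · simp_all; lia
    · simp_all
  prev_eq := by
    rintro ⟨a, b⟩ ⟨c, d⟩ ⟨e, f⟩ ⟨h1, h2⟩ ⟨h3, h4⟩
    ext <;> simp_all

/-- The shape of the vertical differentials, from bidegree `(p, q + 1)` to `(p, q)`. -/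
def verticalShape : ComplexShape (ℕ × ℤ) where
  Rel i j := j.1 = i.1 ∧ j.2 + 1 = i.2
  next_eq := by
    rintro ⟨a, b⟩ ⟨c, d⟩ ⟨e, f⟩ ⟨h1, h2⟩ ⟨h3, h4⟩
    ext
    · simp_all
    · simp_all; lia
  prev_eq := by
    rintro ⟨a, b⟩ ⟨c, d⟩ ⟨e, f⟩ ⟨h1, h2⟩ ⟨h3, h4⟩
    ext <;> simp_all

instance : horizontalShape.TensorSigns where
  ε' := totalSign
  rel_add p q r hpq := by simp only [horizontalShape, Prod.fst_add, Prod.snd_add] at *; lia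
  add_rel p q r hpq := by simp only [horizontalShape, Prod.fst_add, Prod.snd_add] at *; lia
  ε'_succ := by
    rintro ⟨_, b⟩ ⟨q, b⟩ ⟨rfl, rfl⟩
    change ((q : ℤ) + b).negOnePow = - (((q + 1 : ℕ) : ℤ) + b).negOnePow
    rw [show (((q + 1 : ℕ) : ℤ) + b) = (q + b : ℤ) + 1 by push_cast; ring, Int.negOnePow_succ,
      neg_neg]

instance : verticalShape.TensorSigns where
  ε' := totalSign
  rel_add p q r hpq := by simp only [verticalShape, Prod.fst_add, Prod.snd_add] at *; lia
  add_rel p q r hpq := by simp only [verticalShape, Prod.fst_add, Prod.snd_add] at *; lia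
  ε'_succ := by
    rintro ⟨p, _⟩ ⟨p, b⟩ ⟨rfl, rfl⟩
    change ((p : ℤ) + b).negOnePow = - ((p : ℤ) + (b + 1)).negOnePow
    rw [show (p : ℤ) + (b + 1) = (p + b : ℤ) + 1 by ring, Int.negOnePow_succ, neg_neg]

/-- Bicomplexes of `k`-modules concentrated in the right half plane: a module `X (p, q)` for
every `p ≥ 0` and `q ∈ ℤ`, with anticommuting horizontal differentials of bidegree `(-1, 0)`
and vertical differentials of bidegree `(0, -1)`. As for Mathlib's homological complexes, the
differentials are given between any two bidegrees and vanish unless the bidegrees are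
adjacent. -/
structure BCh (k : Type u) [CommRing k] where
  X : ℕ × ℤ → ModuleCat.{u} k
  dh : ∀ i j, X i ⟶ X j
  dv : ∀ i j, X i ⟶ X j
  dh_shape : ∀ i j, ¬ horizontalShape.Rel i j → dh i j = 0
  dv_shape : ∀ i j, ¬ verticalShape.Rel i j → dv i j = 0
  dh_comp_dh : ∀ p q, dh (p + 2, q) (p + 1, q) ≫ dh (p + 1, q) (p, q) = 0
  dv_comp_dv : ∀ p q, dv (p, q + 2) (p, q + 1) ≫ dv (p, q + 1) (p, q) = 0
  anticomm : ∀ p q, dh (p + 1, q + 1) (p, q + 1) ≫ dv (p, q + 1) (p, q) +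
    dv (p + 1, q + 1) (p + 1, q) ≫ dh (p + 1, q) (p, q) = 0

namespace BCh

variable {k : Type u} [CommRing k]

/-- Morphisms of bicomplexes. -/
@[ext]
structure Hom (X Y : BCh k) where
  f : ∀ i, X.X i ⟶ Y.X i
  comm_h : ∀ i j, f i ≫ Y.dh i j = X.dh i j ≫ f j
  comm_v : ∀ i j, f i ≫ Y.dv i j = X.dv i j ≫ f j

@[simps]
instance : Category (BCh k) where
  Hom := Hom
  id X := { f := fun _ => 𝟙 _, comm_h := by simp, comm_v := by simp }
  comp φ ψ :=
    { f := fun i => φ.f i ≫ ψ.f i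
      comm_h := fun i j => by
        rw [Category.assoc, ψ.comm_h, ← Category.assoc, φ.comm_h, Category.assoc]
      comm_v := fun i j => by
        rw [Category.assoc, ψ.comm_v, ← Category.assoc, φ.comm_v, Category.assoc] }

@[ext]
lemma hom_ext {X Y : BCh k} {φ ψ : X ⟶ Y} (h : ∀ i, φ.f i = ψ.f i) : φ = ψ :=
  Hom.ext (funext h)

/-- The horizontal complex underlying a bicomplex. -/
@[simps]
def toH : BCh k ⥤ HomologicalComplex (ModuleCat.{u} k) horizontalShape where
  obj A :=
    { X := A.X
      d := A.dh
      shape := A.dh_shape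
      d_comp_d' := by
        rintro ⟨_, _⟩ ⟨_, _⟩ ⟨p, q⟩ ⟨h1, h2⟩ ⟨h3, h4⟩
        dsimp only at h1 h2 h3 h4
        subst h3 h4 h1 h2
        exact A.dh_comp_dh _ _ }
  map φ := { f := φ.f, comm' := fun i j _ => φ.comm_h i j }

/-- The vertical complex underlying a bicomplex. -/
@[simps]
def toV : BCh k ⥤ HomologicalComplex (ModuleCat.{u} k) verticalShape where
  obj A :=
    { X := A.X
      d := A.dv
      shape := A.dv_shape
      d_comp_d' := by
        rintro ⟨_, _⟩ ⟨_, _⟩ ⟨p, q⟩ ⟨h1, h2⟩ ⟨h3, h4⟩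
        dsimp only at h1 h2 h3 h4
        subst h3 h4 h1 h2
        have := A.dv_comp_dv p q
        rwa [show q + 2 = q + 1 + 1 by ring] at this }
  map φ := { f := φ.f, comm' := fun i j _ => φ.comm_v i j }

instance : (toH (k := k)).Faithful where
  map_injective {_ _ φ ψ} h := by
    ext i : 1
    exact HomologicalComplex.congr_hom h i

section tensor

variable (A B : BCh k)

/-- The bigraded module underlying the tensor product of bicomplexes. -/
noncomputable def tensorX : ℕ × ℤ → ModuleCat.{u} k :=
  GradedObject.Monoidal.tensorObj A.X B.X

/-- The horizontal differential
`d_h (x ⊗ y) = d_h x ⊗ y + (-1)^|x| x ⊗ d_h y` on the tensor product of bicomplexes. -/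
noncomputable def tensorDh (i j : ℕ × ℤ) : tensorX A B i ⟶ tensorX A B j :=
  (HomologicalComplex.tensorObj (toH.obj A) (toH.obj B)).d i j

/-- The vertical differential
`d_v (x ⊗ y) = d_v x ⊗ y + (-1)^|x| x ⊗ d_v y` on the tensor product of bicomplexes. -/
noncomputable def tensorDv (i j : ℕ × ℤ) : tensorX A B i ⟶ tensorX A B j :=
  (HomologicalComplex.tensorObj (toV.obj A) (toV.obj B)).d i j

/-- The inclusion of `A a ⊗ B b` in the tensor product in bidegree `j`, zero unless `a + b = j`. -/
noncomputable def tensorι (a b j : ℕ × ℤ) : A.X a ⊗ B.X b ⟶ tensorX A B j :=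
  if h : a + b = j then GradedObject.Monoidal.ιTensorObj A.X B.X a b j h else 0

lemma tensorι_eq (a b j : ℕ × ℤ) (h : a + b = j) :
    tensorι A B a b j = GradedObject.Monoidal.ιTensorObj A.X B.X a b j h := dif_pos h

lemma tensorι_eq_zero (a b j : ℕ × ℤ) (h : a + b ≠ j) : tensorι A B a b j = 0 := dif_neg h

variable {A B} in
lemma tensorX_hom_ext {j : ℕ × ℤ} {M : ModuleCat.{u} k} {f g : tensorX A B j ⟶ M}
    (h : ∀ a b, a + b = j → tensorι A B a b j ≫ f = tensorι A B a b j ≫ g) : f = g := by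
  apply GradedObject.Monoidal.tensorObj_ext
  intro a b hab
  have := h a b hab
  rwa [tensorι_eq A B a b j hab] at this

lemma tensorι_dh (a b a' b' i j : ℕ × ℤ) (h : a + b = i) (ha : horizontalShape.next a = a')
    (hb : horizontalShape.next b = b') :
    tensorι A B a b i ≫ tensorDh A B i j =
      A.dh a a' ▷ B.X b ≫ tensorι A B a' b j +
      totalSign (.ofAdd a) • (A.X a ◁ B.dh b b' ≫ tensorι A B a b' j) := by
  subst ha hb
  rw [tensorι_eq A B a b i h]
  exact HomologicalComplex.ι_tensor_d (toH.obj A) (toH.obj B) a b i j h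

lemma tensorι_dv (a b a' b' i j : ℕ × ℤ) (h : a + b = i) (ha : verticalShape.next a = a')
    (hb : verticalShape.next b = b') :
    tensorι A B a b i ≫ tensorDv A B i j =
      A.dv a a' ▷ B.X b ≫ tensorι A B a' b j +
      totalSign (.ofAdd a) • (A.X a ◁ B.dv b b' ≫ tensorι A B a b' j) := by
  subst ha hb
  rw [tensorι_eq A B a b i h]
  exact HomologicalComplex.ι_tensor_d (toV.obj A) (toV.obj B) a b i j h

lemma next_h_succ (p : ℕ) (q : ℤ) : horizontalShape.next (p + 1, q) = (p, q) :=
  horizontalShape.next_eq' ⟨rfl, rfl⟩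

lemma next_h_zero (q : ℤ) : horizontalShape.next (0, q) = (0, q) :=
  horizontalShape.next_eq_self' _ (fun j hj => by
    have := hj.1
    dsimp only at this
    lia)

lemma next_v (p : ℕ) (q : ℤ) : verticalShape.next (p, q + 1) = (p, q) :=
  verticalShape.next_eq' ⟨rfl, rfl⟩

lemma dh_zero (q : ℤ) (j : ℕ × ℤ) : A.dh (0, q) j = 0 :=
  A.dh_shape _ _ (fun h => by have := h.1; dsimp only at this; lia)

lemma totalSign_v (p : ℕ) (q : ℤ) :
    totalSign (.ofAdd (p, q + 1)) = - totalSign (.ofAdd (p, q)) := by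
  change ((p : ℤ) + (q + 1)).negOnePow = - ((p : ℤ) + q).negOnePow
  rw [← add_assoc, Int.negOnePow_succ]

lemma totalSign_h (p : ℕ) (q : ℤ) :
    totalSign (.ofAdd (p + 1, q)) = - totalSign (.ofAdd (p, q)) := by
  change (((p + 1 : ℕ) : ℤ) + q).negOnePow = - ((p : ℤ) + q).negOnePow
  rw [← Int.negOnePow_succ]
  congr 1
  push_cast
  ring

lemma tensor_anticomm (p : ℕ) (q : ℤ) :
    tensorDh A B (p + 1, q + 1) (p, q + 1) ≫ tensorDv A B (p, q + 1) (p, q) +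
      tensorDv A B (p + 1, q + 1) (p + 1, q) ≫ tensorDh A B (p + 1, q) (p, q) = 0 := by
  apply tensorX_hom_ext
  rintro ⟨m, n⟩ ⟨s, t⟩ h
  obtain ⟨h1, h2⟩ := Prod.mk.inj h
  dsimp only at h1 h2
  obtain ⟨n, rfl⟩ : ∃ n', n = n' + 1 := ⟨n - 1, by ring⟩
  obtain ⟨t, rfl⟩ : ∃ t', t = t' + 1 := ⟨t - 1, by ring⟩
  have hA : ∀ (m : ℕ) (n t : ℤ) (s : ℕ) (M : ModuleCat.{u} k) (g : A.X (m, n) ⊗ B.X (s, t) ⟶ M),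
      A.dh (m + 1, n + 1) (m, n + 1) ▷ B.X (s, t) ≫ A.dv (m, n + 1) (m, n) ▷ B.X (s, t) ≫ g =
      - (A.dv (m + 1, n + 1) (m + 1, n) ▷ B.X (s, t) ≫
        A.dh (m + 1, n) (m, n) ▷ B.X (s, t) ≫ g) := fun m n t s M g => by
    apply eq_neg_of_add_eq_zero_left
    rw [← comp_whiskerRight_assoc, ← comp_whiskerRight_assoc, ← Preadditive.add_comp,
      ← MonoidalPreadditive.add_whiskerRight, A.anticomm,
      MonoidalPreadditive.zero_whiskerRight, zero_comp]
  have hB : ∀ (m : ℕ) (n t : ℤ) (s : ℕ) (M : ModuleCat.{u} k) (g : A.X (m, n) ⊗ B.X (s, t) ⟶ M),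
      A.X (m, n) ◁ B.dh (s + 1, t + 1) (s, t + 1) ≫ A.X (m, n) ◁ B.dv (s, t + 1) (s, t) ≫ g =
      - (A.X (m, n) ◁ B.dv (s + 1, t + 1) (s + 1, t) ≫
        A.X (m, n) ◁ B.dh (s + 1, t) (s, t) ≫ g) := fun m n t s M g => by
    apply eq_neg_of_add_eq_zero_left
    rw [← MonoidalCategory.whiskerLeft_comp_assoc, ← MonoidalCategory.whiskerLeft_comp_assoc,
      ← Preadditive.add_comp, ← MonoidalPreadditive.whiskerLeft_add, B.anticomm,
      MonoidalPreadditive.whiskerLeft_zero, zero_comp]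
  rw [Preadditive.comp_add, ← Category.assoc, ← Category.assoc, comp_zero]
  rcases m with _ | m <;> rcases s with _ | s
  · lia
  · rw [tensorι_dh _ _ _ _ _ _ _ _ h (next_h_zero _) (next_h_succ _ _),
      tensorι_dv _ _ _ _ _ _ _ _ h (next_v _ _) (next_v _ _)]
    simp only [Preadditive.add_comp, Linear.units_smul_comp, Category.assoc, dh_zero,
      MonoidalPreadditive.zero_whiskerRight, zero_comp, zero_add]
    rw [tensorι_dv _ _ _ _ _ _ (p, q + 1) _ (by ext <;> simp <;> lia) (next_v _ _) (next_v _ _),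
      tensorι_dh _ _ _ _ _ _ (p + 1, q) _ (by ext <;> simp <;> lia) (next_h_zero _)
        (next_h_succ _ _),
      tensorι_dh _ _ _ _ _ _ (p + 1, q) _ (by ext <;> simp <;> lia) (next_h_zero _)
        (next_h_succ _ _)]
    simp only [Preadditive.comp_add, Linear.comp_units_smul, smul_add, smul_smul, dh_zero,
      MonoidalPreadditive.zero_whiskerRight, zero_comp, zero_add, totalSign_v, hB,
      whisker_exchange_assoc, Int.units_mul_self, one_smul, Preadditive.comp_neg, smul_neg, neg_neg, Units.neg_smul, neg_mul, mul_neg]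
    abel
  · rw [tensorι_dh _ _ _ _ _ _ _ _ h (next_h_succ _ _) (next_h_zero _),
      tensorι_dv _ _ _ _ _ _ _ _ h (next_v _ _) (next_v _ _)]
    simp only [Preadditive.add_comp, Linear.units_smul_comp, Category.assoc, dh_zero,
      MonoidalPreadditive.whiskerLeft_zero, zero_comp, add_zero, smul_zero]
    rw [tensorι_dv _ _ _ _ _ _ (p, q + 1) _ (by ext <;> simp <;> lia) (next_v _ _) (next_v _ _),
      tensorι_dh _ _ _ _ _ _ (p + 1, q) _ (by ext <;> simp <;> lia) (next_h_succ _ _)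
        (next_h_zero _),
      tensorι_dh _ _ _ _ _ _ (p + 1, q) _ (by ext <;> simp <;> lia) (next_h_succ _ _)
        (next_h_zero _)]
    simp only [Preadditive.comp_add, Linear.comp_units_smul, smul_add, smul_smul, dh_zero,
      MonoidalPreadditive.whiskerLeft_zero, zero_comp, add_zero, smul_zero, totalSign_v,
      totalSign_h, hA, comp_zero,
      whisker_exchange_assoc, Int.units_mul_self, one_smul, Preadditive.comp_neg, smul_neg, neg_neg, Units.neg_smul, neg_mul, mul_neg]
    abel
  · rw [tensorι_dh _ _ _ _ _ _ _ _ h (next_h_succ _ _) (next_h_succ _ _),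
      tensorι_dv _ _ _ _ _ _ _ _ h (next_v _ _) (next_v _ _)]
    simp only [Preadditive.add_comp, Linear.units_smul_comp, Category.assoc]
    rw [tensorι_dv _ _ _ _ _ _ (p, q + 1) _ (by ext <;> simp <;> lia) (next_v _ _) (next_v _ _),
      tensorι_dv _ _ _ _ _ _ (p, q + 1) _ (by ext <;> simp <;> lia) (next_v _ _) (next_v _ _),
      tensorι_dh _ _ _ _ _ _ (p + 1, q) _ (by ext <;> simp <;> lia) (next_h_succ _ _)
        (next_h_succ _ _),
      tensorι_dh _ _ _ _ _ _ (p + 1, q) _ (by ext <;> simp <;> lia) (next_h_succ _ _)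
        (next_h_succ _ _)]
    simp only [Preadditive.comp_add, Linear.comp_units_smul, smul_add, smul_smul, totalSign_v,
      totalSign_h, hA, hB, whisker_exchange_assoc, Int.units_mul_self, one_smul, Preadditive.comp_neg, smul_neg, neg_neg, Units.neg_smul,
      neg_mul, mul_neg]
    abel

/-- The tensor product of bicomplexes:
`(A ⊗ B) (p, q)` is the direct sum of the `A (m, n) ⊗ B (s, t)` for `m + s = p` and `n + t = q`,
with `d_h (x ⊗ y) = d_h x ⊗ y + (-1)^|x| x ⊗ d_h y`, `d_v (x ⊗ y) = d_v x ⊗ y + (-1)^|x| x ⊗ d_v y`,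
where `|x|` is the total degree. -/
noncomputable def tensor : BCh k where
  X := tensorX A B
  dh := tensorDh A B
  dv := tensorDv A B
  dh_shape := (HomologicalComplex.tensorObj (toH.obj A) (toH.obj B)).shape
  dv_shape := (HomologicalComplex.tensorObj (toV.obj A) (toV.obj B)).shape
  dh_comp_dh p q := (HomologicalComplex.tensorObj (toH.obj A) (toH.obj B)).d_comp_d _ _ _
  dv_comp_dv p q := (HomologicalComplex.tensorObj (toV.obj A) (toV.obj B)).d_comp_d _ _ _
  anticomm := tensor_anticomm A B

variable {A B} in
/-- The tensor product of morphisms of bicomplexes. -/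
noncomputable def tensorMap {A' B' : BCh k} (φ : A ⟶ A') (ψ : B ⟶ B') :
    tensor A B ⟶ tensor A' B' where
  f := GradedObject.Monoidal.tensorHom φ.f ψ.f
  comm_h := HomologicalComplex.tensorHom_comm (toH.map φ) (toH.map ψ)
  comm_v := HomologicalComplex.tensorHom_comm (toV.map φ) (toV.map ψ)

variable (k) in
/-- The unit of the tensor product: `k` concentrated in bidegree `(0, 0)`. -/
noncomputable def unit : BCh k where
  X := HomologicalComplex.gradedUnit k (ℕ × ℤ)
  dh _ _ := 0
  dv _ _ := 0
  dh_shape _ _ _ := rfl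
  dv_shape _ _ _ := rfl
  dh_comp_dh _ _ := zero_comp
  dv_comp_dv _ _ := zero_comp
  anticomm _ _ := by simp

end tensor

section monoidal

variable (A B C : BCh k)

/-- An isomorphism of bicomplexes from its components. -/
@[simps]
def isoOfComponents {A B : BCh k} (e : ∀ i, A.X i ≅ B.X i)
    (hh : ∀ i j, (e i).hom ≫ B.dh i j = A.dh i j ≫ (e j).hom)
    (hv : ∀ i j, (e i).hom ≫ B.dv i j = A.dv i j ≫ (e j).hom) : A ≅ B where
  hom := { f := fun i => (e i).hom, comm_h := hh, comm_v := hv }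
  inv :=
    { f := fun i => (e i).inv
      comm_h := fun i j => by rw [Iso.inv_comp_eq, ← Category.assoc, hh, Category.assoc,
        Iso.hom_inv_id, Category.comp_id]
      comm_v := fun i j => by rw [Iso.inv_comp_eq, ← Category.assoc, hv, Category.assoc,
        Iso.hom_inv_id, Category.comp_id] }

/-- The associativity constraint. -/
noncomputable def assoc : tensor (tensor A B) C ≅ tensor A (tensor B C) :=
  isoOfComponents
    (fun j => (GradedObject.eval j).mapIso (GradedObject.Monoidal.associator A.X B.X C.X))
    (HomologicalComplex.associator (toH.obj A) (toH.obj B) (toH.obj C)).hom.comm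
    (HomologicalComplex.associator (toV.obj A) (toV.obj B) (toV.obj C)).hom.comm

/-- The left unit constraint. -/
noncomputable def leftU : tensor (unit k) A ≅ A :=
  isoOfComponents
    (fun j => (GradedObject.eval j).mapIso (HomologicalComplex.gradedLeftUnitor A.X))
    (HomologicalComplex.gradedLeftUnitor_comm (toH.obj A))
    (HomologicalComplex.gradedLeftUnitor_comm (toV.obj A))

/-- The right unit constraint. -/
noncomputable def rightU : tensor A (unit k) ≅ A :=
  isoOfComponents
    (fun j => (GradedObject.eval j).mapIso (HomologicalComplex.gradedRightUnitor A.X))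
    (HomologicalComplex.gradedRightUnitor_comm (toH.obj A))
    (HomologicalComplex.gradedRightUnitor_comm (toV.obj A))

noncomputable instance : MonoidalCategoryStruct (BCh k) where
  tensorObj := tensor
  tensorHom := tensorMap
  whiskerLeft A _ _ φ := tensorMap (𝟙 A) φ
  whiskerRight φ B := tensorMap φ (𝟙 B)
  tensorUnit := unit k
  associator := assoc
  leftUnitor := leftU
  rightUnitor := rightU

lemma whiskerLeft_f {B C : BCh k} (φ : B ⟶ C) (j : ℕ × ℤ) :
    (A ◁ φ).f j = GradedObject.Monoidal.whiskerLeft A.X φ.f j := rfl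

lemma whiskerRight_f {B C : BCh k} (φ : B ⟶ C) (j : ℕ × ℤ) :
    (φ ▷ A).f j = GradedObject.Monoidal.whiskerRight φ.f A.X j := rfl

lemma leftUnitor_hom_f :
    (λ_ A).hom.f = (HomologicalComplex.gradedLeftUnitor A.X).hom := rfl

lemma rightUnitor_hom_f :
    (ρ_ A).hom.f = (HomologicalComplex.gradedRightUnitor A.X).hom := rfl

lemma associator_hom_f (j : ℕ × ℤ) :
    (α_ A B C).hom.f j = (GradedObject.Monoidal.associator A.X B.X C.X).hom j := rfl

noncomputable instance : MonoidalCategory (BCh k) where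
  id_tensorHom_id A B := toH.map_injective
    (MonoidalCategory.id_tensorHom_id (toH.obj A) (toH.obj B))
  tensorHom_comp_tensorHom f₁ f₂ g₁ g₂ := toH.map_injective
    (MonoidalCategory.tensorHom_comp_tensorHom (toH.map f₁) (toH.map f₂) (toH.map g₁) (toH.map g₂))
  tensorHom_def f g := toH.map_injective
    (MonoidalCategory.tensorHom_def (toH.map f) (toH.map g))
  whiskerLeft_id A B := toH.map_injective
    (MonoidalCategory.whiskerLeft_id (toH.obj A) (toH.obj B))
  id_whiskerRight A B := toH.map_injective
    (MonoidalCategory.id_whiskerRight (toH.obj A) (toH.obj B))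
  associator_naturality f g h := toH.map_injective
    (MonoidalCategory.associator_naturality (toH.map f) (toH.map g) (toH.map h))
  leftUnitor_naturality f := toH.map_injective
    (MonoidalCategory.leftUnitor_naturality (toH.map f))
  rightUnitor_naturality f := toH.map_injective
    (MonoidalCategory.rightUnitor_naturality (toH.map f))
  pentagon A B C D := by
    ext j : 1
    exact congr_fun (GradedObject.Monoidal.pentagon A.X B.X C.X D.X) j
  triangle A B := by
    ext j : 1
    refine Eq.trans ?_ ((HomologicalComplex.triangle_f (toH.obj A) (toH.obj B) j).trans ?_)
    · change (α_ A (𝟙_ _) B).hom.f j ≫ (A ◁ (λ_ B).hom).f j = _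
      rw [whiskerLeft_f, leftUnitor_hom_f, associator_hom_f]
      rfl
    · rw [whiskerRight_f, rightUnitor_hom_f]
      rfl

/-- The symmetry `x ⊗ y ↦ (-1)^(|x| |y|) y ⊗ x`, where `|x|` is the total degree. -/
noncomputable def symm : A ⊗ B ≅ B ⊗ A where
  hom :=
    { f := HomologicalComplex.braidingX (toH.obj A) (toH.obj B)
      comm_h := (HomologicalComplex.koszulBraiding (toH.obj A) (toH.obj B)).hom.comm
      comm_v := (HomologicalComplex.koszulBraiding (toV.obj A) (toV.obj B)).hom.comm }
  inv :=
    { f := HomologicalComplex.braidingX (toH.obj B) (toH.obj A)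
      comm_h := (HomologicalComplex.koszulBraiding (toH.obj B) (toH.obj A)).hom.comm
      comm_v := (HomologicalComplex.koszulBraiding (toV.obj B) (toV.obj A)).hom.comm }
  hom_inv_id := toH.map_injective
    (HomologicalComplex.koszulBraiding (toH.obj A) (toH.obj B)).hom_inv_id
  inv_hom_id := toH.map_injective
    (HomologicalComplex.koszulBraiding (toH.obj A) (toH.obj B)).inv_hom_id

noncomputable instance : SymmetricCategory (BCh k) where
  braiding := symm
  braiding_naturality_right A _ _ φ := by
    ext j : 1
    exact congr_fun (GradedKoszul.naturality_right totalSign A.X φ.f) j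
  braiding_naturality_left φ A := by
    ext j : 1
    exact congr_fun (GradedKoszul.naturality_left totalSign φ.f A.X) j
  hexagon_forward A B C := by
    ext j : 1
    exact congr_fun (GradedKoszul.hexagon_forward totalSign A.X B.X C.X) j
  hexagon_reverse A B C := by
    ext j : 1
    exact congr_fun (GradedKoszul.hexagon_reverse totalSign A.X B.X C.X) j
  symmetry A B := (symm A B).hom_inv_id

end monoidal

end BCh

namespace BCh

variable {k : Type u} [CommRing k]

/-- The vertical chain complex `X (p, *)` of a bicomplex `X`. -/
@[simps]
def column (p : ℕ) : BCh k ⥤ Ch k where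
  obj A :=
    { X := fun q => A.X (p, q)
      d := fun q r => A.dv (p, q) (p, r)
      shape := fun q r h => A.dv_shape _ _ (fun h' => h h'.2)
      d_comp_d' := by
        rintro _ _ r rfl rfl
        have := A.dv_comp_dv p r
        rwa [show r + 2 = r + 1 + 1 by ring] at this }
  map φ := { f := fun q => φ.f (p, q), comm' := fun q r _ => φ.comm_v (p, q) (p, r) }

/-- The differential `d_h + d_v` of the total complex: on the summand `X (p, n - p)`, it is the
sum of `d_v`, with values in the summand with index `p`, and of `d_h`, with values in the summand
with index `p - 1` (the latter map being zero for `p = 0`). -/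
noncomputable def totD (A : BCh k) (n m : ℤ) :
    ModuleCat.of k (DirectSum ℕ (fun p => A.X (p, n - p))) ⟶
      ModuleCat.of k (DirectSum ℕ (fun p => A.X (p, m - p))) :=
  ModuleCat.ofHom (DirectSum.toModule k ℕ _ (fun p =>
    DirectSum.lof k ℕ (fun p => A.X (p, m - p)) p ∘ₗ (A.dv (p, n - p) (p, m - p)).hom +
    DirectSum.lof k ℕ (fun p => A.X (p, m - p)) (p - 1) ∘ₗ
      (A.dh (p, n - p) (p - 1, m - (p - 1 : ℕ))).hom))

lemma totD_lof (A : BCh k) (n m : ℤ) (p : ℕ) (x : A.X (p, n - p)) :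
    (totD A n m).hom (DirectSum.lof k ℕ (fun p => A.X (p, n - p)) p x) =
      DirectSum.lof k ℕ (fun p => A.X (p, m - p)) p ((A.dv (p, n - p) (p, m - p)).hom x) +
      DirectSum.lof k ℕ (fun p => A.X (p, m - p)) (p - 1)
        ((A.dh (p, n - p) (p - 1, m - (p - 1 : ℕ))).hom x) := by
  simp [totD]

lemma dv_dv_apply (A : BCh k) (i j l : ℕ × ℤ) (x : A.X i) :
    (A.dv j l).hom ((A.dv i j).hom x) = 0 := by
  have := (toV.obj A).d_comp_d i j l
  exact congr_arg (fun f => f.hom x) this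

lemma dh_dh_apply (A : BCh k) (i j l : ℕ × ℤ) (x : A.X i) :
    (A.dh j l).hom ((A.dh i j).hom x) = 0 := by
  have := (toH.obj A).d_comp_d i j l
  exact congr_arg (fun f => f.hom x) this

lemma anticomm_apply (A : BCh k) (i j j' l : ℕ × ℤ) (h1 : j.1 + 1 = i.1) (h2 : j.2 = i.2)
    (h3 : l.1 = j.1) (h4 : l.2 + 1 = j.2) (h5 : j'.1 = i.1) (h6 : j'.2 = l.2) (x : A.X i) :
    (A.dv j l).hom ((A.dh i j).hom x) + (A.dh j' l).hom ((A.dv i j').hom x) = 0 := by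
  obtain ⟨i1, i2⟩ := i
  obtain ⟨j1, j2⟩ := j
  obtain ⟨j1', j2'⟩ := j'
  obtain ⟨p, q⟩ := l
  dsimp only at h1 h2 h3 h4 h5 h6
  subst h6 h5 h3 h2 h1 h4
  exact congr_arg (fun f => f.hom x) (A.anticomm p j2')

lemma totD_totD (A : BCh k) (n : ℤ) :
    totD A (n + 1 + 1) (n + 1) ≫ totD A (n + 1) n = 0 := by
  ext1
  apply DirectSum.linearMap_ext
  intro p
  refine LinearMap.ext (fun x => ?_)
  change (totD A (n + 1) n).hom ((totD A (n + 1 + 1) (n + 1)).hom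
    (DirectSum.lof k ℕ (fun p => A.X (p, n + 1 + 1 - p)) p x)) = 0
  rw [totD_lof, map_add, totD_lof, totD_lof, dv_dv_apply, dh_dh_apply, map_zero, map_zero,
    zero_add, add_zero, add_comm, ← map_add]
  rcases p with _ | p
  · rw [A.dh_shape (0, _) _ (fun h => by have := h.1; dsimp only at this; lia),
      A.dh_shape (0, _) _ (fun h => by have := h.1; dsimp only at this; lia)]
    simp
  · refine (congr_arg _ (anticomm_apply A (p + 1, n + 1 + 1 - (p + 1 : ℕ)) (p, n + 1 - (p : ℕ))
      (p + 1, n + 1 - (p + 1 : ℕ)) (p, n - (p : ℕ)) rfl ?_ rfl ?_ rfl ?_ x)).trans (map_zero _)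
    all_goals
      push_cast
      ring

lemma totD_shape (A : BCh k) (n m : ℤ) (h : ¬ m + 1 = n) : totD A n m = 0 := by
  ext1
  apply DirectSum.linearMap_ext
  intro p
  refine LinearMap.ext (fun x => ?_)
  change (totD A n m).hom (DirectSum.lof k ℕ (fun p => A.X (p, n - p)) p x) = 0
  rw [totD_lof, A.dv_shape _ _ (fun h' => h (by have := h'.2; dsimp only at this; lia)),
    A.dh_shape _ _ (fun h' => h (by have h1 := h'.1; have h2 := h'.2; dsimp only at h1 h2; lia))]
  simp

/-- The map of total graded modules induced by a morphism of bicomplexes. -/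
noncomputable def totMap {A B : BCh k} (φ : A ⟶ B) (n : ℤ) :
    ModuleCat.of k (DirectSum ℕ (fun p => A.X (p, n - p))) ⟶
      ModuleCat.of k (DirectSum ℕ (fun p => B.X (p, n - p))) :=
  ModuleCat.ofHom (DirectSum.lmap (fun p => (φ.f (p, n - p)).hom))

lemma totMap_lof {A B : BCh k} (φ : A ⟶ B) (n : ℤ) (p : ℕ) (x : A.X (p, n - p)) :
    (totMap φ n).hom (DirectSum.lof k ℕ (fun p => A.X (p, n - p)) p x) =
      DirectSum.lof k ℕ (fun p => B.X (p, n - p)) p ((φ.f (p, n - p)).hom x) :=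
  DirectSum.lmap_lof _ _ _

lemma totMap_comm {A B : BCh k} (φ : A ⟶ B) (n m : ℤ) :
    totMap φ n ≫ totD B n m = totD A n m ≫ totMap φ m := by
  ext1
  apply DirectSum.linearMap_ext
  intro p
  refine LinearMap.ext (fun x => ?_)
  change (totD B n m).hom ((totMap φ n).hom (DirectSum.lof k ℕ (fun p => A.X (p, n - p)) p x)) =
    (totMap φ m).hom ((totD A n m).hom (DirectSum.lof k ℕ (fun p => A.X (p, n - p)) p x))
  rw [totMap_lof, totD_lof, totD_lof, map_add, totMap_lof, totMap_lof]
  congr 2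
  · exact congr_arg (fun f => f.hom x) (φ.comm_v (p, n - p) (p, m - p))
  · exact congr_arg (fun f => f.hom x) (φ.comm_h (p, n - p) (p - 1, m - (p - 1 : ℕ)))

/-- The total complex of a bicomplex, `Tot X n = ⨁ X (p, q)` for `p + q = n` (so that the summands
are the `X (p, n - p)` for `p ≥ 0`), with differential `d_h + d_v`. -/
@[simps]
noncomputable def Tot : BCh k ⥤ Ch k where
  obj A :=
    { X := fun n => ModuleCat.of k (DirectSum ℕ (fun p => A.X (p, n - p)))
      d := totD A
      shape := fun n m h => totD_shape A n m h
      d_comp_d' := by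
        rintro _ _ n rfl rfl
        exact totD_totD A n }
  map {A B} φ :=
    { f := totMap φ
      comm' := fun n m _ => totMap_comm φ n m }
  map_id A := by
    ext n : 2
    apply DirectSum.linearMap_ext
    intro p
    refine LinearMap.ext (fun x => ?_)
    exact totMap_lof (𝟙 A) n p x
  map_comp φ ψ := by
    ext n : 2
    apply DirectSum.linearMap_ext
    intro p
    refine LinearMap.ext (fun x => ?_)
    change (totMap (φ ≫ ψ) n).hom (DirectSum.lof k ℕ _ p x) =
      (totMap ψ n).hom ((totMap φ n).hom (DirectSum.lof k ℕ _ p x))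
    rw [totMap_lof, totMap_lof, totMap_lof]
    rfl

/-- The bigraded module underlying a chain complex, put in horizontal degree `0`. -/
def inclX (K : Ch k) : ℕ × ℤ → ModuleCat.{u} k
  | (0, q) => K.X q
  | (_ + 1, _) => ModuleCat.of k PUnit

/-- The differential of a chain complex, as a vertical differential. -/
def inclDv (K : Ch k) : ∀ i j, inclX K i ⟶ inclX K j
  | (0, q), (0, r) => K.d q r
  | (0, _), (_ + 1, _) => 0
  | (_ + 1, _), (_, _) => 0

/-- The map of bigraded modules induced by a morphism of chain complexes. -/
def inclMap {K L : Ch k} (f : K ⟶ L) : ∀ i, inclX K i ⟶ inclX L i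
  | (0, q) => f.f q
  | (_ + 1, _) => 0

/-- The inclusion of chain complexes as bicomplexes concentrated in horizontal degree `0`. -/
@[simps]
def incl (k : Type u) [CommRing k] : Ch k ⥤ BCh k where
  obj K :=
    { X := inclX K
      dh := fun _ _ => 0
      dv := inclDv K
      dh_shape := fun _ _ _ => rfl
      dv_shape := by
        rintro ⟨_ | p, q⟩ ⟨_ | p', r⟩ h
        · exact K.shape q r (fun h' => h ⟨rfl, h'⟩)
        all_goals rfl
      dh_comp_dh := fun _ _ => zero_comp
      dv_comp_dv := by
        rintro (_ | p) q
        · exact K.d_comp_d _ _ _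
        · exact zero_comp
      anticomm := fun _ _ => by simp }
  map f :=
    { f := inclMap f
      comm_h := fun _ _ => by simp
      comm_v := by
        rintro ⟨_ | p, q⟩ ⟨_ | p', r⟩
        · exact f.comm q r
        · exact Limits.comp_zero.trans Limits.zero_comp.symm
        · exact Limits.zero_comp.trans Limits.zero_comp.symm
        · exact Limits.zero_comp.trans Limits.zero_comp.symm }
  map_id K := by
    ext ⟨_ | p, q⟩ x
    · rfl
    · exact Subsingleton.elim (α := PUnit) _ _
  map_comp f g := by
    ext ⟨_ | p, q⟩ x
    · rfl
    · exact Subsingleton.elim (α := PUnit) _ _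

end BCh

namespace HomotopicalAlgebra

variable {C D : Type*} [Category* C] [Category* D]

/-- A monoidal model category: the pushout-product axiom and the unit axiom hold. -/
structure IsMonoidalModelCategory (C : Type*) [Category* C] [MonoidalCategory C]
    [ModelCategory C] : Prop where
  pushoutProduct_cofibration {A B X Y : C} (f : A ⟶ B) (g : X ⟶ Y) [Cofibration f]
    [Cofibration g] :
    Cofibration ((MonoidalCategory.Arrow.pushoutProduct.obj (Arrow.mk f)).obj (Arrow.mk g)).hom
  pushoutProduct_weakEquivalence {A B X Y : C} (f : A ⟶ B) (g : X ⟶ Y) [Cofibration f]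
    [Cofibration g] (h : WeakEquivalence f ∨ WeakEquivalence g) :
    WeakEquivalence
      ((MonoidalCategory.Arrow.pushoutProduct.obj (Arrow.mk f)).obj (Arrow.mk g)).hom
  unit_whiskerRight {Q : C} (q : Q ⟶ 𝟙_ C) (X : C) [IsCofibrant Q] [WeakEquivalence q]
    [IsCofibrant X] : WeakEquivalence (q ▷ X)
  unit_whiskerLeft {Q : C} (q : Q ⟶ 𝟙_ C) (X : C) [IsCofibrant Q] [WeakEquivalence q]
    [IsCofibrant X] : WeakEquivalence (X ◁ q)

/-- A Quillen adjunction: the left adjoint preserves cofibrations and trivial cofibrations. -/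
structure IsQuillenAdjunction [ModelCategory C] [ModelCategory D] {F : C ⥤ D} {G : D ⥤ C}
    (adj : F ⊣ G) : Prop where
  cofibration_map {X Y : C} (f : X ⟶ Y) [Cofibration f] : Cofibration (F.map f)
  weakEquivalence_map {X Y : C} (f : X ⟶ Y) [Cofibration f] [WeakEquivalence f] :
    WeakEquivalence (F.map f)

/-- A Quillen equivalence: a Quillen adjunction such that, for `X` cofibrant and `Y` fibrant, a
morphism `F X ⟶ Y` is a weak equivalence if and only if its adjunct `X ⟶ G Y` is. -/
structure IsQuillenEquivalence [ModelCategory C] [ModelCategory D] {F : C ⥤ D} {G : D ⥤ C}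
    (adj : F ⊣ G) : Prop extends IsQuillenAdjunction adj where
  weakEquivalence_iff {X : C} {Y : D} [IsCofibrant X] [IsFibrant Y] (f : F.obj X ⟶ Y) :
    WeakEquivalence f ↔ WeakEquivalence (adj.homEquiv X Y f)

/-- A strong symmetric monoidal Quillen equivalence: a Quillen equivalence between symmetric
monoidal model categories whose left adjoint is strong symmetric monoidal and sends cofibrant
replacements `Q ⟶ 𝟙` of the unit to weak equivalences. -/
structure IsStrongSymmetricMonoidalQuillenEquivalence [MonoidalCategory C] [SymmetricCategory C]
    [MonoidalCategory D] [SymmetricCategory D] [ModelCategory C] [ModelCategory D]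
    {F : C ⥤ D} {G : D ⥤ C} (adj : F ⊣ G) : Prop extends IsQuillenEquivalence adj where
  source : IsMonoidalModelCategory C
  target : IsMonoidalModelCategory D
  braided : Nonempty F.Braided
  weakEquivalence_map_unit {Q : C} (q : Q ⟶ 𝟙_ C) [IsCofibrant Q] [WeakEquivalence q] :
    WeakEquivalence (F.map q)

end HomotopicalAlgebra

open HomotopicalAlgebra

/-- The projective model structure on chain complexes: weak equivalences are the
quasi-isomorphisms and fibrations are the degreewise surjections. -/
structure IsProjectiveModelStructure {k : Type u} [CommRing k] (m : ModelCategory (Ch k)) :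
    Prop where
  weakEquivalence_iff {K L : Ch k} (f : K ⟶ L) : WeakEquivalence f ↔ QuasiIso f
  fibration_iff {K L : Ch k} (f : K ⟶ L) :
    Fibration f ↔ ∀ n, Function.Surjective (f.f n)

/-- The total model structure on bicomplexes: weak equivalences are the morphisms which induce a
quasi-isomorphism on total complexes, fibrations are the pointwise surjective morphisms which
induce isomorphisms on the vertical homology in horizontal degrees `p > 0`. -/
structure IsTotalModelStructure {k : Type u} [CommRing k] (m : ModelCategory (BCh k)) :
    Prop where
  weakEquivalence_iff {A B : BCh k} (f : A ⟶ B) :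
    WeakEquivalence f ↔ QuasiIso (BCh.Tot.map f)
  fibration_iff {A B : BCh k} (f : A ⟶ B) :
    Fibration f ↔ (∀ i, Function.Surjective (f.f i)) ∧
      ∀ p : ℕ, 0 < p → QuasiIso ((BCh.column p).map f)

/-! Both model structures are cofibrantly generated, and all of their classes can be described by
elements. `cell k p q True` is the free bicomplex on a generator in bidegree (p, q + 1), and `cell k
p q False` is its part generated by the vertical boundary of that generator. A map lifts on the
right against `cellIncl k p q` for all q exactly when its p-th column is a surjective
quasi-isomorphism (`forall_colLift_iff`). Taking these inclusions for p > 0, together with 0 → `cell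
k 0 q True`, one gets generators whose right lifting class consists of the stated fibrations; taking
them for all p gives the generating cofibrations.

The link with Tot is a descent along columns (`exists_tot_sub_mem_column`). An element of Tot is a
finite sum and the bicomplex lives in p ≥ 0, so if the kernels of a map are acyclic in the columns p
> 0, the highest component can be removed repeatedly by boundaries, until only column 0 remains.
Hence a fibration is a weak equivalence if and only if its column 0 is a quasi-isomorphism
(`cofGen_rlp`), and if the columns p > 0 of X are acyclic then X_{0,*} → Tot X is a
quasi-isomorphism (`quasiIso_colTot`).

That maps with the left lifting property against fibrations are weak equivalences follows from a
right adjoint `coTot` of Tot that sends surjections to fibrations: Tot of such a map lifts against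
all surjections, hence is a quasi-isomorphism (`Ch.quasiIso_of_llp`). The small object argument
applies because bicomplexes form a Grothendieck abelian category. The projective structure on Ch is
obtained from column 0 of the same generators.

The Quillen equivalence is then immediate: iK and any fibrant X have acyclic columns for p > 0, so
by `quasiIso_colTot` a map iK → X is a weak equivalence if and only if K → X_{0,*} is one.

For the pushout-product axiom, an internal hom of bicomplexes is constructed, so that only pairs of
generators have to be tested. Maps out of cell ⊗ Y are elements of the internal hom, and the
required extension amounts to choosing the value of a family at a generator and at its horizontal
boundary, each choice being one lifting problem in a single column
(`hasLiftingProperty_pushoutProduct_cellIncl`). The axiom passes to Ch because i is fully faithful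
and strong monoidal and preserves both factorization systems. The unit axiom follows since the units
are cofibrant. -/

open scoped ZeroObject

/-! ### Quasi-isomorphisms of chain complexes in terms of elements -/

namespace Ch

variable {k : Type u} [CommRing k]

lemma d_d_apply (K : Ch k) (i j l : ℤ) (x : K.X i) : (K.d j l).hom ((K.d i j).hom x) = 0 :=
  congr_arg (fun f => f.hom x) (K.d_comp_d i j l)

lemma f_d_apply {K L : Ch k} (f : K ⟶ L) (i j : ℤ) (x : K.X i) :
    (f.f j).hom ((K.d i j).hom x) = (L.d i j).hom ((f.f i).hom x) :=
  (congr_arg (fun f => f.hom x) (f.comm i j)).symm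

lemma iCycles_injective (K : Ch k) (n : ℤ) : Function.Injective (K.iCycles n).hom :=
  (ModuleCat.mono_iff_injective _).1 inferInstance

lemma exists_cycles (K : Ch k) (n : ℤ) (z : K.X (n + 1)) (hz : (K.d (n + 1) n).hom z = 0) :
    ∃ c : K.cycles (n + 1), (K.iCycles (n + 1)).hom c = z := by
  have h : ModuleCat.ofHom (LinearMap.toSpanSingleton k _ z) ≫ K.d (n + 1) n = 0 := by
    ext
    simpa using hz
  refine ⟨(K.liftCycles (ModuleCat.ofHom (LinearMap.toSpanSingleton k _ z)) n
    (by simp [ChainComplex.next]) h).hom (1 : k), ?_⟩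
  have := congr_arg (fun f => f.hom (1 : k)) (K.liftCycles_i
    (ModuleCat.ofHom (LinearMap.toSpanSingleton k _ z)) n (by simp) h)
  exact this.trans (one_smul k z)

lemma d_iCycles_apply (K : Ch k) (n m : ℤ) (c : K.cycles n) :
    (K.d n m).hom ((K.iCycles n).hom c) = 0 :=
  congr_arg (fun f => f.hom c) (K.iCycles_d n m)

lemma homologyπ_eq_zero_iff (K : Ch k) (n : ℤ) (c : K.cycles n) :
    (K.homologyπ n).hom c = 0 ↔ ∃ w : K.X (n + 1), (K.d (n + 1) n).hom w = (K.iCycles n).hom c := by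
  have hex := (ShortComplex.exact_of_g_is_cokernel (ShortComplex.mk _ _
    (K.toCycles_comp_homologyπ (n + 1) n)) (K.homologyIsCokernel (n + 1) n (by simp)))
  rw [ShortComplex.moduleCat_exact_iff] at hex
  constructor
  · intro h
    obtain ⟨w, hw⟩ := hex c h
    refine ⟨w, ?_⟩
    rw [← hw]
    exact (congr_arg (fun f => f.hom w) (K.toCycles_i (n + 1) n)).symm
  · rintro ⟨w, hw⟩
    have : c = (K.toCycles (n + 1) n).hom w := by
      apply iCycles_injective
      rw [← hw]
      exact (congr_arg (fun f => f.hom w) (K.toCycles_i (n + 1) n)).symm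
    rw [this]
    exact congr_arg (fun f => f.hom w) (K.toCycles_comp_homologyπ (n + 1) n)

/-- A chain map is a quasi-isomorphism if and only if, in terms of elements, it is bijective
on homology classes. -/
lemma quasiIso_iff_elements {K L : Ch k} (f : K ⟶ L) :
    QuasiIso f ↔
      (∀ (n : ℤ) (x : K.X (n + 1)) (w : L.X (n + 1 + 1)), (K.d (n + 1) n).hom x = 0 →
        (f.f (n + 1)).hom x = (L.d (n + 1 + 1) (n + 1)).hom w →
        ∃ v : K.X (n + 1 + 1), (K.d (n + 1 + 1) (n + 1)).hom v = x) ∧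
      (∀ (n : ℤ) (z : L.X (n + 1)), (L.d (n + 1) n).hom z = 0 →
        ∃ (x : K.X (n + 1)) (w : L.X (n + 1 + 1)), (K.d (n + 1) n).hom x = 0 ∧
          z = (f.f (n + 1)).hom x + (L.d (n + 1 + 1) (n + 1)).hom w) := by
  -- Every integer is a successor, so nothing is lost by writing degrees as n + 1, which keeps the
  -- differentials free of casts.
  have key : QuasiIso f ↔ ∀ n : ℤ, Function.Bijective
      (HomologicalComplex.homologyMap f (n + 1)).hom := by
    rw [quasiIso_iff]
    constructor
    · intro h n
      have := h (n + 1)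
      rw [quasiIsoAt_iff_isIso_homologyMap] at this
      exact (ConcreteCategory.isIso_iff_bijective _).1 this
    · intro h n
      rw [quasiIsoAt_iff_isIso_homologyMap]
      have := h (n - 1)
      rw [sub_add_cancel] at this
      exact (ConcreteCategory.isIso_iff_bijective _).2 this
  have hsurj : ∀ (M : Ch k) (n : ℤ) (y : M.homology n), ∃ c, (M.homologyπ n).hom c = y :=
    fun M n => (ModuleCat.epi_iff_surjective _).1 inferInstance
  have hmap : ∀ (n : ℤ) (c : K.cycles n), (HomologicalComplex.homologyMap f n).hom
      ((K.homologyπ n).hom c) = (L.homologyπ n).hom ((HomologicalComplex.cyclesMap f n).hom c) :=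
    fun n c => congr_arg (fun g => g.hom c) (HomologicalComplex.homologyπ_naturality f n)
  have hcyc : ∀ (n : ℤ) (c : K.cycles n), (L.iCycles n).hom
      ((HomologicalComplex.cyclesMap f n).hom c) = (f.f n).hom ((K.iCycles n).hom c) :=
    fun n c => congr_arg (fun g => g.hom c) (HomologicalComplex.cyclesMap_i f n)
  rw [key]
  constructor
  · intro h
    constructor
    · intro n x w hx hw
      obtain ⟨c, rfl⟩ := exists_cycles K n x hx
      have := (homologyπ_eq_zero_iff L (n + 1) ((HomologicalComplex.cyclesMap f (n + 1)).hom c)).2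
        ⟨w, by rw [hcyc, hw]⟩
      rw [← hmap] at this
      exact (homologyπ_eq_zero_iff K (n + 1) c).1 ((h n).1 (this.trans (map_zero _).symm))
    · intro n z hz
      obtain ⟨c, rfl⟩ := exists_cycles L n z hz
      obtain ⟨y, hy⟩ := (h n).2 ((L.homologyπ (n + 1)).hom c)
      obtain ⟨b, rfl⟩ := hsurj K _ y
      rw [hmap, ← sub_eq_zero, ← map_sub, homologyπ_eq_zero_iff] at hy
      obtain ⟨w, hw⟩ := hy
      refine ⟨(K.iCycles (n + 1)).hom b, -w, d_iCycles_apply K _ _ b, ?_⟩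
      rw [map_neg, hw, map_sub, hcyc]
      abel
  · rintro ⟨h1, h2⟩ n
    constructor
    · rw [injective_iff_map_eq_zero]
      intro y hy
      obtain ⟨b, rfl⟩ := hsurj K _ y
      rw [hmap, homologyπ_eq_zero_iff] at hy
      obtain ⟨w, hw⟩ := hy
      rw [homologyπ_eq_zero_iff]
      exact h1 n _ w (d_iCycles_apply K _ _ b) (by rw [hw, hcyc])
    · intro y
      obtain ⟨c, rfl⟩ := hsurj L _ y
      obtain ⟨x, w, hx, hw⟩ := h2 n ((L.iCycles (n + 1)).hom c) (d_iCycles_apply L _ _ c)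
      obtain ⟨b, rfl⟩ := exists_cycles K n x hx
      refine ⟨(K.homologyπ (n + 1)).hom b, ?_⟩
      rw [hmap, eq_comm, ← sub_eq_zero, ← map_sub, homologyπ_eq_zero_iff]
      refine ⟨w, ?_⟩
      rw [map_sub, hcyc, hw]
      abel

/-- The elementwise form of acyclicity of the kernel of a chain map. -/
def KerAcyclic {K L : Ch k} (f : K ⟶ L) : Prop :=
  ∀ (n : ℤ) (x : K.X (n + 1)), (f.f (n + 1)).hom x = 0 → (K.d (n + 1) n).hom x = 0 →
    ∃ w : K.X (n + 1 + 1), (f.f (n + 1 + 1)).hom w = 0 ∧ (K.d (n + 1 + 1) (n + 1)).hom w = x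

/-- A surjective chain map is a quasi-isomorphism if and only if its kernel is acyclic. -/
lemma quasiIso_iff_kerAcyclic {K L : Ch k} (f : K ⟶ L)
    (hf : ∀ n, Function.Surjective (f.f n).hom) : QuasiIso f ↔ KerAcyclic f := by
  rw [quasiIso_iff_elements]
  constructor
  · rintro ⟨h1, h2⟩ n x hfx hdx
    obtain ⟨v, hv⟩ := h1 n x 0 hdx (by rw [hfx, map_zero])
    obtain ⟨y, u, hy, hu⟩ := h2 (n + 1) ((f.f (n + 1 + 1)).hom v) (by
      rw [← f_d_apply, hv, hfx])
    obtain ⟨u', rfl⟩ := hf _ u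
    -- Here v bounds x, and f v is a cycle because f x = 0. So f v is f y plus the boundary of f u'
    -- for some cycle y, and subtracting y and d u' moves v into the kernel without changing its
    -- boundary.
    refine ⟨v - y - (K.d _ _).hom u', ?_, ?_⟩
    · rw [map_sub, map_sub, hu, f_d_apply]
      abel
    · rw [map_sub, map_sub, hv, hy, d_d_apply, sub_zero, sub_zero]
  · intro h
    constructor
    · intro n x w hx hw
      obtain ⟨w', rfl⟩ := hf _ w
      obtain ⟨v, -, hv⟩ := h n (x - (K.d _ _).hom w') (by rw [map_sub, hw, f_d_apply, sub_self])
        (by rw [map_sub, hx, d_d_apply, sub_zero])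
      exact ⟨v + w', by rw [map_add, hv, sub_add_cancel]⟩
    · intro n z hz
      -- The chosen lift x of the cycle z need not be a cycle, but its boundary is a cycle of the
      -- kernel one degree lower. Acyclicity is applied in that degree.
      obtain ⟨n, rfl⟩ : ∃ m, n = m + 1 := ⟨n - 1, by ring⟩
      obtain ⟨x, rfl⟩ := hf _ z
      rw [← f_d_apply] at hz
      obtain ⟨w, hw1, hw2⟩ := h n _ hz (d_d_apply K _ _ _ _)
      refine ⟨x - w, 0, ?_, ?_⟩
      · rw [map_sub, hw2, sub_self]
      · rw [map_sub, hw1, map_zero, sub_zero, add_zero]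

/-! ### Families of elements, the cone, and left lifting against surjections -/

/-- The product of the terms of a chain complex. -/
abbrev Family (K : Ch k) := ∀ n, K.X n

/-- The differential on the product of the terms of a chain complex. -/
@[simps]
def famD (K : Ch k) : Family K →ₗ[k] Family K where
  toFun x n := (K.d (n + 1) n).hom (x (n + 1))
  map_add' x y := by ext n; simp
  map_smul' r x := by ext n; simp

@[simp]
lemma famD_famD (K : Ch k) (x : Family K) : famD K (famD K x) = 0 := by
  ext n
  exact d_d_apply K _ _ _ _

/-- The map induced by a chain map on products of terms. -/
@[simps]
def famMap {K L : Ch k} (f : K ⟶ L) : Family K →ₗ[k] Family L where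
  toFun x n := (f.f n).hom (x n)
  map_add' x y := by ext n; simp
  map_smul' r x := by ext n; simp

lemma famMap_famD {K L : Ch k} (f : K ⟶ L) (x : Family K) :
    famMap f (famD K x) = famD L (famMap f x) := by
  ext n
  exact f_d_apply f _ _ _

/-- The families concentrated in degree `n`. -/
def famAt (K : Ch k) (n : ℤ) : Submodule k (Family K) where
  carrier := { x | ∀ m, m ≠ n → x m = 0 }
  add_mem' {x y} hx hy m h := by simp [hx m h, hy m h]
  zero_mem' m h := rfl
  smul_mem' r x hx m h := by simp [hx m h]

/-- The degree of an element is a membership condition in a fixed module rather than part of its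
type, so an equality of degrees such as m + 1 = n needs no transport. -/
lemma famD_mem {K : Ch k} {n : ℤ} {x : Family K} (hx : x ∈ famAt K n) {m : ℤ} (h : m + 1 = n) :
    famD K x ∈ famAt K m := fun i hi => by
  rw [famD_apply, hx (i + 1) (by lia), map_zero]

lemma famMap_mem {K L : Ch k} (f : K ⟶ L) {n : ℤ} {x : Family K} (hx : x ∈ famAt K n) :
    famMap f x ∈ famAt L n := fun i hi => by
  rw [famMap_apply, hx i hi, map_zero]

/-- An element of a chain complex, as a family concentrated in one degree. -/
def famSingle (K : Ch k) (n : ℤ) : K.X n →ₗ[k] Family K := LinearMap.single k (fun n => K.X n) n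

lemma famSingle_mem (K : Ch k) (n : ℤ) (x : K.X n) : famSingle K n x ∈ famAt K n :=
  fun _ h => Pi.single_eq_of_ne (M := fun n => K.X n) h x

@[simp]
lemma famSingle_same (K : Ch k) (n : ℤ) (x : K.X n) : famSingle K n x n = x :=
  Pi.single_eq_same (M := fun n => K.X n) n x

lemma famAt_ext {K : Ch k} {n : ℤ} {x y : Family K} (hx : x ∈ famAt K n) (hy : y ∈ famAt K n)
    (h : x n = y n) : x = y := by
  ext m
  by_cases hm : m = n
  · subst hm; exact h
  · rw [hx m hm, hy m hm]

/-- The differential of the cone of a chain complex. -/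
def coneD (K : Ch k) (n : ℤ) : (famAt K (n + 1)).prod (famAt K (n + 1 + 1)) →ₗ[k]
    (famAt K n).prod (famAt K (n + 1)) where
  toFun x := ⟨(famD K x.1.1, x.1.1 - famD K x.1.2), famD_mem x.2.1 rfl,
    sub_mem x.2.1 (famD_mem x.2.2 rfl)⟩
  map_add' x y := by
    ext : 1
    simp [add_sub_add_comm]
  map_smul' r x := by
    ext : 1
    simp [smul_sub]

/-- The complex of pairs `(b, c)` where `c` has degree one more than `b`, with the differential
`d (b, c) = (d b, b - d c)`. It is contractible, and the first projection is a chain map. -/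
noncomputable def cone (K : Ch k) : Ch k :=
  ChainComplex.of (fun n => ModuleCat.of k ((famAt K n).prod (famAt K (n + 1))))
    (fun n => ModuleCat.ofHom (coneD K n)) (fun n => by
      ext1
      refine LinearMap.ext (fun x => Subtype.ext ?_)
      change (famD K (famD K x.1.1), famD K x.1.1 - famD K (x.1.1 - famD K x.1.2)) = 0
      simp)

lemma cone_d (K : Ch k) (n : ℤ) (x : (famAt K (n + 1)).prod (famAt K (n + 1 + 1))) :
    ((cone K).d (n + 1) n).hom x = coneD K n x := by
  have h := ChainComplex.of_d (fun n => ModuleCat.of k ((famAt K n).prod (famAt K (n + 1))))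
    (fun n => ModuleCat.ofHom (coneD K n)) n
  exact congr_arg (fun f => f.hom x) h

/-- The projection from the cone. -/
noncomputable def coneπ (K : Ch k) : cone K ⟶ K where
  f n := ModuleCat.ofHom
    { toFun := fun x => x.1.1 n
      map_add' := fun x y => rfl
      map_smul' := fun r x => rfl }
  comm' := by
    rintro _ n rfl
    ext1
    refine LinearMap.ext (fun x => ?_)
    exact (congr_arg (fun y : (famAt K n).prod (famAt K (n + 1)) => y.1.1 n) (cone_d K n x)).symm

lemma coneπ_surjective (K : Ch k) (n : ℤ) : Function.Surjective ((coneπ K).f n).hom := fun x =>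
  ⟨⟨(famSingle K n x, 0), famSingle_mem _ _ _, zero_mem _⟩, famSingle_same K n x⟩

/-- A chain map with the left lifting property with respect to all surjections is a
quasi-isomorphism. -/
lemma quasiIso_of_llp {A B : Ch k} (f : A ⟶ B)
    (hf : ∀ {K L : Ch k} (g : K ⟶ L), (∀ n, Function.Surjective (g.f n).hom) →
      HasLiftingProperty f g) : QuasiIso f := by
  -- Lifting against A → 0 provides a retraction of f.
  obtain ⟨r, hr⟩ : ∃ r : B ⟶ A, f ≫ r = 𝟙 A := by
    have := hf (0 : A ⟶ 0) (fun n x => ⟨0, by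
      have : Subsingleton ((0 : Ch k).X n) := ModuleCat.subsingleton_of_isZero
        (Functor.map_isZero (HomologicalComplex.eval _ _ n) (isZero_zero _))
      exact Subsingleton.elim _ _⟩)
    have sq : CommSq (𝟙 A) f (0 : A ⟶ 0) 0 := ⟨by simp⟩
    exact ⟨sq.lift, sq.fac_left⟩
  -- The map 1 - r ≫ f vanishes after precomposition with f, so it lifts along the cone projection,
  -- with zero on A. Such a lift is a null-homotopy of 1 - r ≫ f.
  obtain ⟨l, hl⟩ : ∃ l : B ⟶ cone B, l ≫ coneπ B = 𝟙 B - r ≫ f := by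
    have := hf (coneπ B) (coneπ_surjective B)
    have sq : CommSq 0 f (coneπ B) (𝟙 B - r ≫ f) := ⟨by simp [reassoc_of% hr]⟩
    exact ⟨sq.lift, sq.fac_right⟩
  have hr' : ∀ n (x : A.X n), (r.f n).hom ((f.f n).hom x) = x := fun n x =>
    congr_arg (fun g => (g.f n).hom x) hr
  rw [quasiIso_iff_elements]
  constructor
  · intro n x w hx hw
    refine ⟨(r.f _).hom w, ?_⟩
    rw [← f_d_apply, ← hw, hr']
  · intro n z hz
    have h1 : ((coneπ B).f (n + 1)).hom ((l.f (n + 1)).hom z) = z - (f.f _).hom ((r.f _).hom z) :=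
      congr_arg (fun g => (g.f (n + 1)).hom z) hl
    have h2 := f_d_apply l (n + 1) n z
    rw [hz, map_zero] at h2
    -- For a cycle z, the image l z = (b, c) is a cycle of the cone; the second component of its
    -- differential says b = d c, while b = z - f (r z) by the choice of l.
    have h3 := congr_arg (fun x : (famAt B n).prod (famAt B (n + 1)) => x.1.2 (n + 1))
      (h2.trans (cone_d B n _))
    refine ⟨(r.f _).hom z, ((l.f (n + 1)).hom z).1.2 (n + 1 + 1), ?_, ?_⟩
    · rw [← f_d_apply, hz, map_zero]
    · have h4 : (0 : B.X (n + 1)) = ((l.f (n + 1)).hom z).1.1 (n + 1) -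
          (B.d (n + 1 + 1) (n + 1)).hom (((l.f (n + 1)).hom z).1.2 (n + 1 + 1)) := by
        exact h3
      have h5 : ((l.f (n + 1)).hom z).1.1 (n + 1) = z - (f.f _).hom ((r.f _).hom z) := h1
      rw [← sub_eq_zero.1 h4.symm, h5]
      abel

end Ch

/-! ### Bicomplexes form a Grothendieck abelian category -/

namespace BCh

variable {k : Type u} [CommRing k]

section preadditive

variable {A B : BCh k}

instance : Zero (A ⟶ B) := ⟨{ f := fun _ => 0, comm_h := by simp, comm_v := by simp }⟩

instance : Add (A ⟶ B) := ⟨fun φ ψ =>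
  { f := fun i => φ.f i + ψ.f i
    comm_h := fun i j => by rw [Preadditive.add_comp, Preadditive.comp_add, φ.comm_h, ψ.comm_h]
    comm_v := fun i j => by rw [Preadditive.add_comp, Preadditive.comp_add, φ.comm_v, ψ.comm_v] }⟩

instance : Neg (A ⟶ B) := ⟨fun φ =>
  { f := fun i => - φ.f i
    comm_h := fun i j => by rw [Preadditive.neg_comp, Preadditive.comp_neg, φ.comm_h]
    comm_v := fun i j => by rw [Preadditive.neg_comp, Preadditive.comp_neg, φ.comm_v] }⟩

instance : AddCommGroup (A ⟶ B) where
  add_assoc _ _ _ := by ext i : 1; exact add_assoc _ _ _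
  zero_add _ := by ext i : 1; exact zero_add _
  add_zero _ := by ext i : 1; exact add_zero _
  add_comm _ _ := by ext i : 1; exact add_comm _ _
  neg_add_cancel _ := by ext i : 1; exact neg_add_cancel _
  nsmul := nsmulRec
  zsmul := zsmulRec

instance : Preadditive (BCh k) where
  add_comp _ _ _ _ _ _ := by ext i : 1; exact Preadditive.add_comp _ _ _ _ _ _
  comp_add _ _ _ _ _ _ := by ext i : 1; exact Preadditive.comp_add _ _ _ _ _ _

end preadditive

lemma dh_dv_comm (A : BCh k) (i j l j' : ℕ × ℤ) (h : horizontalShape.Rel i j)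
    (hv : verticalShape.Rel j l) (hv' : verticalShape.Rel i j') (hh : horizontalShape.Rel j' l) :
    A.dh i j ≫ A.dv j l = - (A.dv i j' ≫ A.dh j' l) := by
  ext x
  exact eq_neg_of_add_eq_zero_left
    (anticomm_apply A i j j' l h.1 h.2 hv.1 hv.2 hv'.1 hh.2.symm x)

/-- The sign (-1)^q on the horizontal differential in row q turns anticommuting squares into
commuting ones, so that it becomes a chain map between columns. -/
lemma units_dh_dv (A : BCh k) (p p' : ℕ) (m : ℤ) :
    ((m + 1).negOnePow • A.dh (p, m + 1) (p', m + 1)) ≫ A.dv (p', m + 1) (p', m) =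
      A.dv (p, m + 1) (p, m) ≫ (m.negOnePow • A.dh (p, m) (p', m)) := by
  rw [Linear.units_smul_comp, Linear.comp_units_smul]
  by_cases h : p' + 1 = p
  · rw [dh_dv_comm A (p, m + 1) (p', m + 1) (p', m) (p, m) ⟨h, rfl⟩ ⟨rfl, rfl⟩ ⟨rfl, rfl⟩ ⟨h, rfl⟩, Int.negOnePow_succ,
      smul_neg, Units.neg_smul, neg_neg]
  · rw [A.dh_shape _ _ (fun h' => h h'.1), A.dh_shape _ _ (fun h' => h h'.1)]
    simp

lemma units_dh_dh (A : BCh k) (p : ℕ) (q : ℤ) (u : ℤˣ) :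
    (u • A.dh (p + 1 + 1, q) (p + 1, q)) ≫ (u • A.dh (p + 1, q) (p, q)) = 0 := by
  rw [Linear.units_smul_comp, Linear.comp_units_smul, A.dh_comp_dh, smul_zero, smul_zero]

lemma units_comm_h {A B : BCh k} (φ : A ⟶ B) (u : ℤˣ) (i j : ℕ × ℤ) :
    φ.f i ≫ (u • B.dh i j) = (u • A.dh i j) ≫ φ.f j := by
  rw [Linear.units_smul_comp, Linear.comp_units_smul, φ.comm_h]

/-- The chain map between columns given by the horizontal differentials, with a sign. -/
def columnD (A : BCh k) (p p' : ℕ) : (column p).obj A ⟶ (column p').obj A where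
  f q := q.negOnePow • A.dh (p, q) (p', q)
  comm' := by
    rintro _ m rfl
    exact units_dh_dv A p p' m

variable (k) in
/-- Bicomplexes as complexes of chain complexes. -/
def columns : BCh k ⥤ ChainComplex (Ch k) ℕ where
  obj A :=
    { X := fun p => (column p).obj A
      d := columnD A
      shape := fun p p' h => by
        ext1 q
        exact (congr_arg (fun g => q.negOnePow • g)
          (A.dh_shape (p, q) (p', q) (fun h' => h h'.1))).trans
          (show q.negOnePow • (0 : A.X (p, q) ⟶ A.X (p', q)) = 0 from smul_zero _)
      d_comp_d' := by
        rintro _ _ p rfl rfl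
        ext1 q
        exact units_dh_dh A p q _ }
  map φ :=
    { f := fun p => (column p).map φ
      comm' := fun p p' _ => by
        ext1 q
        exact units_comm_h φ _ _ _ }

instance : (columns k).Faithful where
  map_injective {A B φ ψ} h := by
    ext ⟨p, q⟩ : 1
    exact congr_arg (fun g => (g.f p).f q) h

/-- Horizontal differentials vanish between different rows and vertical ones between different
columns, so the remaining cases are those assumed, up to a sign that cancels. -/
lemma exists_columns_map_eq {A B : BCh k} (f : ∀ i, A.X i ⟶ B.X i)
    (hv : ∀ p q q', f (p, q) ≫ B.dv (p, q) (p, q') = A.dv (p, q) (p, q') ≫ f (p, q'))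
    (hh : ∀ p p' q, f (p, q) ≫ (q.negOnePow • B.dh (p, q) (p', q)) =
      (q.negOnePow • A.dh (p, q) (p', q)) ≫ f (p', q)) :
    ∃ φ : A ⟶ B, φ.f = f := by
  refine ⟨{ f := f, comm_h := ?_, comm_v := ?_ }, rfl⟩
  · rintro ⟨p, q⟩ ⟨p', q'⟩
    by_cases h : q' = q
    · subst h
      have := hh p p' q'
      rw [Linear.units_smul_comp, Linear.comp_units_smul] at this
      exact smul_left_cancel _ this
    · rw [A.dh_shape _ _ (fun h' => h h'.2), B.dh_shape _ _ (fun h' => h h'.2), zero_comp,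
        comp_zero]
  · rintro ⟨p, q⟩ ⟨p', q'⟩
    by_cases h : p' = p
    · subst h
      exact hv p' q q'
    · rw [A.dv_shape _ _ (fun h' => h h'.1), B.dv_shape _ _ (fun h' => h h'.1), zero_comp,
        comp_zero]

instance : (columns k).Full where
  map_surjective {A B} φ := by
    obtain ⟨ψ, hψ⟩ := exists_columns_map_eq (A := A) (B := B) (fun i => (φ.f i.1).f i.2)
      (fun p q q' => (φ.f p).comm q q')
      (fun p p' q => congr_arg (fun g => g.f q) (φ.comm p p'))
    refine ⟨ψ, ?_⟩
    ext p q : 2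
    exact congr_fun hψ (p, q)

/-- The bicomplex attached to a complex of chain complexes. -/
def ofColumns (C : ChainComplex (Ch k) ℕ) : BCh k where
  X i := (C.X i.1).X i.2
  -- The sign introduced by `columnD` is undone here, since it is its own inverse.
  dh i j := if h : j.2 = i.2 then
    i.2.negOnePow • ((C.d i.1 j.1).f i.2 ≫ eqToHom (by rw [h])) else 0
  dv i j := if h : j.1 = i.1 then (C.X i.1).d i.2 j.2 ≫ eqToHom (by rw [h]) else 0
  dh_shape i j h := by
    split_ifs with h'
    · rw [C.shape _ _ (fun h'' => h ⟨h'', h'⟩)]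
      simp
    · rfl
  dv_shape i j h := by
    split_ifs with h'
    · rw [(C.X i.1).shape _ _ (fun h'' => h ⟨h', h''⟩), zero_comp]
    · rfl
  dh_comp_dh p q := by
    have := congr_arg (fun g => g.f q) (C.d_comp_d (p + 2) (p + 1) p)
    dsimp at this
    simp [Linear.units_smul_comp, Linear.comp_units_smul, this]
  dv_comp_dv p q := by simp
  anticomm p q := by
    simp [Linear.units_smul_comp, Linear.comp_units_smul, Int.negOnePow_succ]

instance : (columns k).EssSurj where
  mem_essImage C := by
    have hv : ∀ p q r, (ofColumns C).dv (p, q) (p, r) = (C.X p).d q r := fun p q r => by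
      simp [ofColumns]
    have hh : ∀ p p' q, q.negOnePow • (ofColumns C).dh (p, q) (p', q) = (C.d p p').f q :=
      fun p p' q => by
      have h : (ofColumns C).dh (p, q) (p', q) = q.negOnePow • (C.d p p').f q := by
        simp [ofColumns]
      exact (congr_arg (fun g => q.negOnePow • g) h).trans
        (show q.negOnePow • q.negOnePow • (C.d p p').f q = _ by
          rw [smul_smul, Int.units_mul_self, one_smul])
    refine ⟨ofColumns C, ⟨HomologicalComplex.Hom.isoOfComponents
      (fun p => HomologicalComplex.Hom.isoOfComponents (fun q => Iso.refl _) (fun q r _ => ?_))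
      (fun p p' _ => ?_)⟩⟩
    · exact (Category.id_comp _).trans ((hv p q r).symm.trans (Category.comp_id _).symm)
    · ext1 q
      exact (Category.id_comp _).trans ((hh p p' q).symm.trans (Category.comp_id _).symm)

instance : (columns k).IsEquivalence where

instance : HasFiniteProducts (BCh k) where
  out n := Adjunction.hasLimitsOfShape_of_equivalence (columns k)

noncomputable instance : Abelian (BCh k) := abelianOfEquivalence (columns k)

instance : IsGrothendieckAbelian.{u} (BCh k) :=
  IsGrothendieckAbelian.of_equivalence (columns k).asEquivalence.symm

lemma mono_of_injective {A B : BCh k} (φ : A ⟶ B) (h : ∀ i, Function.Injective (φ.f i).hom) :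
    Mono φ where
  right_cancellation α β hαβ := by
    ext i x
    exact h i (congr_arg (fun g => (g.f i).hom x) hαβ)

end BCh

/-! ### Small object argument -/

/-- In a Grothendieck abelian category, any small set of monomorphisms permits the small object
argument. -/
lemma CategoryTheory.IsGrothendieckAbelian.hasSmallObjectArgument {C : Type*} [Category* C]
    [Abelian C] [IsGrothendieckAbelian.{u} C] (I : MorphismProperty C)
    [MorphismProperty.IsSmall.{u} I] (hI : I ≤ MorphismProperty.monomorphisms C) :
    MorphismProperty.HasSmallObjectArgument.{u} I := by
  obtain ⟨ι, A, B, f, rfl⟩ := (MorphismProperty.isSmall_iff_eq_ofHoms.{u} I).1 inferInstance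
  -- κ is a regular cardinal larger than the total number of subobjects of all the sources;
  -- morphisms from such a source commute with colimits over κ of chains of monomorphisms.
  obtain ⟨κ, hκ', hκ⟩ := HasCardinalLT.exists_regular_cardinal.{u}
    (Σ i, Subobject (A i))
  have : Fact κ.IsRegular := ⟨hκ'⟩
  have : Nonempty κ.ord.ToType := by simpa using hκ'.ne_zero
  have := WellFoundedLT.toOrderBot κ.ord.ToType
  exact ⟨κ, inferInstance, inferInstance,
    { preservesColimit {A' B' X Y} i hi f' hf := by
        -- Each stage of a relative cell complex is a pushout of a coproduct of maps in I, hence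
        -- again a monomorphism.
        let hf' : (MorphismProperty.monomorphisms C).TransfiniteCompositionOfShape
            κ.ord.ToType f' :=
          { toTransfiniteCompositionOfShape := hf.toTransfiniteCompositionOfShape
            map_mem j hj := by
              have := (hf.attachCells j hj).pushouts_coproducts
              simp only [MorphismProperty.ofHoms_homFamily] at this
              refine (?_ : _ ≤ MorphismProperty.monomorphisms C) _ this
              simp only [MorphismProperty.pushouts_le_iff, MorphismProperty.coproducts_le_iff]
              exact hI }
        have (j j' : κ.ord.ToType) (φ : j ⟶ j') : Mono (hf'.F.map φ) := hf'.mem_map φ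
        apply IsGrothendieckAbelian.preservesColimit_coyoneda_obj_of_mono (Y := hf'.F) (κ := κ)
        obtain ⟨a⟩ := hi
        exact hκ.of_injective (fun s => (⟨a, s⟩ : Σ i, Subobject (A i)))
          (fun s t h => by simpa using h) }⟩

/-! ### Free bicomplexes on one generator and on one vertical cycle -/

namespace BCh

section cells

variable (k : Type u) [CommRing k]

/-- The submodule of `k` which is `k` if `P` holds and zero otherwise. -/
def piece (P : Prop) : Submodule k k where
  carrier := {r | ¬ P → r = 0}
  add_mem' hx hy h := by rw [hx h, hy h, add_zero]
  zero_mem' _ := rfl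
  smul_mem' c _ hx h := by rw [hx h, smul_zero]

open Classical in
/-- Multiplication by a scalar, on truncated copies of `k`. -/
noncomputable def pieceMap (P Q : Prop) (c : k) : piece k P →ₗ[k] piece k Q where
  toFun r := ⟨if Q then c * r.1 else 0, fun h => if_neg h⟩
  map_add' x y := by
    ext
    dsimp
    split_ifs <;> ring
  map_smul' x y := by
    ext
    dsimp
    split_ifs <;> ring

variable {k}

open Classical in
lemma pieceMap_coe (P Q : Prop) (c : k) (r : piece k P) :
    (pieceMap k P Q c r).1 = if Q then c * r.1 else 0 := rfl

lemma pieceMap_eq_zero (P Q : Prop) (c : k) (r : piece k P) (h : c = 0 ∨ r = 0) :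
    pieceMap k P Q c r = 0 := by
  apply Subtype.ext
  rcases h with rfl | rfl <;> simp [pieceMap_coe]

/-- The bidegrees in which the cell is nonzero. -/
def cellSupp (p : ℕ) (q : ℤ) (b : Prop) (a : ℕ × ℤ) : Prop :=
  (a.1 = p ∨ a.1 + 1 = p) ∧ (a.2 = q ∨ (b ∧ a.2 = q + 1))

variable (k) in
/-- For `b` true, this is the free bicomplex on a generator in bidegree `(p, q + 1)`; for
`b` false, it is the free bicomplex on a vertical cycle in bidegree `(p, q)`. -/
noncomputable def cell (p : ℕ) (q : ℤ) (b : Prop) : BCh k where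
  X a := ModuleCat.of k (piece k (cellSupp p q b a))
  dh i j := ModuleCat.ofHom (pieceMap k _ _
    (if (j.1 + 1 = i.1 ∧ j.2 = i.2) ∧ i.1 = p then 1 else 0))
  -- The sign -1 outside column p makes the unique square of the free bicomplex anticommute.
  dv i j := ModuleCat.ofHom (pieceMap k _ _
    (if (j.1 = i.1 ∧ j.2 + 1 = i.2) ∧ i.2 = q + 1 then (if i.1 = p then 1 else -1) else 0))
  dh_shape i j h := by
    ext1
    exact LinearMap.ext (fun r => pieceMap_eq_zero _ _ _ r (Or.inl (if_neg (fun h' => h h'.1))))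
  dv_shape i j h := by
    ext1
    exact LinearMap.ext (fun r => pieceMap_eq_zero _ _ _ r (Or.inl (if_neg (fun h' => h h'.1))))
  dh_comp_dh m n := by
    ext1
    refine LinearMap.ext (fun r => pieceMap_eq_zero _ _ _ _ ?_)
    by_cases h : m + 1 = p
    · exact Or.inr (pieceMap_eq_zero _ _ _ _ (Or.inl (if_neg (fun h' => by
        have := h'.2
        dsimp only at this
        lia))))
    · exact Or.inl (if_neg (fun h' => h h'.2))
  dv_comp_dv m n := by
    ext1
    refine LinearMap.ext (fun r => pieceMap_eq_zero _ _ _ _ ?_)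
    by_cases h : n + 1 = q + 1
    · exact Or.inr (pieceMap_eq_zero _ _ _ _ (Or.inl (if_neg (fun h' => by
        have := h'.2
        dsimp only at this
        lia))))
    · exact Or.inl (if_neg (fun h' => h h'.2))
  anticomm m n := by
    ext r
    change (pieceMap k _ _ _ (pieceMap k _ _ _ r)).1 + (pieceMap k _ _ _ (pieceMap k _ _ _ r)).1
      = (0 : k)
    simp only [pieceMap_coe]
    obtain ⟨r, hr⟩ := r
    by_cases hs : cellSupp p q b (m + 1, n + 1)
    · by_cases h1 : m + 1 = p <;> by_cases h2 : n = q
      · have hb : b := by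
          rcases hs.2 with h | h
          · dsimp at h; lia
          · exact h.1
        subst h1 h2
        simp [cellSupp, hb]
      · simp [h2]
      · simp [h1]
      · simp [h1]
    · simp [show r = 0 from hr hs]

lemma cell_dh_coe (p : ℕ) (q : ℤ) (b : Prop) (i j : ℕ × ℤ) (r : (cell k p q b).X i)
    (h : j.1 + 1 = i.1 ∧ j.2 = i.2) (hi : i.1 = p) :
    (((cell k p q b).dh i j).hom r).1 = r.1 := by
  obtain ⟨r, hr⟩ := r
  refine (pieceMap_coe _ _ _ _).trans ?_
  rw [if_pos (c := _ ∧ _) ⟨h, hi⟩, one_mul]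
  by_cases h' : cellSupp p q b j
  · exact if_pos h'
  -- A horizontal step from column p stays in the support, so if the target is outside the support
  -- then r was already zero.
  · refine (if_neg h').trans (hr (fun h'' => h' ⟨Or.inr (by lia), ?_⟩)).symm
    rw [h.2]
    exact h''.2

lemma cell_dh_eq_zero (p : ℕ) (q : ℤ) (b : Prop) (i j : ℕ × ℤ) (r : (cell k p q b).X i)
    (hi : i.1 ≠ p) : ((cell k p q b).dh i j).hom r = 0 := by
  apply Subtype.ext
  refine (pieceMap_coe _ _ _ _).trans ?_
  rw [if_neg (c := _ ∧ _) (fun h => hi h.2), zero_mul, ite_self]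
  rfl

lemma cell_dv_coe (p : ℕ) (q : ℤ) (b : Prop) (i j : ℕ × ℤ) (r : (cell k p q b).X i)
    (h : j.1 = i.1 ∧ j.2 + 1 = i.2) (hi : i.2 = q + 1) :
    (((cell k p q b).dv i j).hom r).1 = if i.1 = p then r.1 else - r.1 := by
  obtain ⟨r, hr⟩ := r
  refine (pieceMap_coe _ _ _ _).trans ?_
  rw [if_pos (c := _ ∧ i.2 = q + 1) ⟨h, hi⟩]
  by_cases h' : cellSupp p q b j
  · refine (if_pos h').trans ?_
    split_ifs <;> ring
  · have h0 : r = 0 := hr (fun h'' => h' ⟨by rw [h.1]; exact h''.1, Or.inl (by lia)⟩)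
    simp [h0]

lemma cell_dv_eq_zero (p : ℕ) (q : ℤ) (b : Prop) (i j : ℕ × ℤ) (r : (cell k p q b).X i)
    (hi : i.2 ≠ q + 1) : ((cell k p q b).dv i j).hom r = 0 := by
  apply Subtype.ext
  refine (pieceMap_coe _ _ _ _).trans ?_
  rw [if_neg (c := _ ∧ _) (fun h => hi h.2), zero_mul, ite_self]
  rfl

/-- The element of the cell given by a scalar. -/
def cellElt (p : ℕ) (q : ℤ) (b : Prop) (a : ℕ × ℤ) (h : cellSupp p q b a) (r : k) :
    (cell k p q b).X a := ⟨r, fun h' => (h' h).elim⟩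

lemma cell_elt_eq_zero (p : ℕ) (q : ℤ) (b : Prop) (a : ℕ × ℤ) (h : ¬ cellSupp p q b a)
    (x : (cell k p q b).X a) : x = 0 := Subtype.ext (x.2 h)

/-- The morphism from a cell attached to a family of elements. -/
noncomputable def cellHom {p : ℕ} {q : ℤ} {b : Prop} {A : BCh k} (e : ∀ a, A.X a)
    (h1 : ∀ i j : ℕ × ℤ, cellSupp p q b i → (j.1 + 1 = i.1 ∧ j.2 = i.2) → i.1 = p →
      (A.dh i j).hom (e i) = e j)
    (h2 : ∀ i j : ℕ × ℤ, cellSupp p q b i → i.1 ≠ p → (A.dh i j).hom (e i) = 0)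
    (h3 : ∀ i j : ℕ × ℤ, cellSupp p q b i → (j.1 = i.1 ∧ j.2 + 1 = i.2) → i.2 = q + 1 →
      (A.dv i j).hom (e i) = if i.1 = p then e j else - e j)
    (h4 : ∀ i j : ℕ × ℤ, cellSupp p q b i → i.2 ≠ q + 1 → (A.dv i j).hom (e i) = 0) :
    cell k p q b ⟶ A where
  f a := ModuleCat.ofHom ((LinearMap.toSpanSingleton k _ (e a)).comp
    (piece k (cellSupp p q b a)).subtype)
  comm_h i j := by
    ext x
    change (A.dh i j).hom (x.1 • e i) = (((cell k p q b).dh i j).hom x).1 • e j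
    by_cases hs : cellSupp p q b i
    · rw [map_smul]
      by_cases hp : i.1 = p
      · by_cases hj : j.1 + 1 = i.1 ∧ j.2 = i.2
        · rw [h1 i j hs hj hp, cell_dh_coe p q b i j x hj hp]
        · rw [A.dh_shape i j hj, (cell k p q b).dh_shape i j hj]
          exact (smul_zero _).trans (zero_smul _ _).symm
      · rw [cell_dh_eq_zero p q b i j x hp, h2 i j hs hp]
        exact (smul_zero _).trans (zero_smul _ _).symm
    · rw [cell_elt_eq_zero p q b i hs x, map_zero]
      exact ((congr_arg _ (zero_smul _ _)).trans (map_zero _)).trans (zero_smul _ _).symm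
  comm_v i j := by
    ext x
    change (A.dv i j).hom (x.1 • e i) = (((cell k p q b).dv i j).hom x).1 • e j
    by_cases hs : cellSupp p q b i
    · rw [map_smul]
      by_cases hp : i.2 = q + 1
      · by_cases hj : j.1 = i.1 ∧ j.2 + 1 = i.2
        · rw [h3 i j hs hj hp, cell_dv_coe p q b i j x hj hp]
          split_ifs
          · rfl
          · rw [smul_neg, neg_smul]
        · rw [A.dv_shape i j hj, (cell k p q b).dv_shape i j hj]
          exact (smul_zero _).trans (zero_smul _ _).symm
      · rw [cell_dv_eq_zero p q b i j x hp, h4 i j hs hp]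
        exact (smul_zero _).trans (zero_smul _ _).symm
    · rw [cell_elt_eq_zero p q b i hs x, map_zero]
      exact ((congr_arg _ (zero_smul _ _)).trans (map_zero _)).trans (zero_smul _ _).symm

variable (k) in
/-- The generating cofibration: the inclusion of the subobject generated by the vertical
differential of the generator in a free bicomplex. -/
noncomputable def cellIncl (p : ℕ) (q : ℤ) : cell k p q False ⟶ cell k p q True where
  f a := ModuleCat.ofHom (Submodule.inclusion (fun r hr h => hr (fun h' => h
    ⟨h'.1, Or.inl (h'.2.resolve_right (fun h'' => h''.1))⟩)))
  comm_h i j := by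
    ext x
    apply Subtype.ext
    by_cases h : j.1 + 1 = i.1 ∧ j.2 = i.2
    · by_cases hi : i.1 = p
      · exact (cell_dh_coe p q _ i j _ h hi).trans (cell_dh_coe p q _ i j x h hi).symm
      · exact (congr_arg Subtype.val (cell_dh_eq_zero p q _ i j _ hi)).trans
          (congr_arg Subtype.val (cell_dh_eq_zero p q False i j x hi)).symm
    · rw [dh_shape _ i j h, dh_shape _ i j h]
      rfl
  comm_v i j := by
    ext x
    apply Subtype.ext
    by_cases h : j.1 = i.1 ∧ j.2 + 1 = i.2
    · by_cases hi : i.2 = q + 1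
      · exact (cell_dv_coe p q _ i j _ h hi).trans (cell_dv_coe p q _ i j x h hi).symm
      · exact (congr_arg Subtype.val (cell_dv_eq_zero p q _ i j _ hi)).trans
          (congr_arg Subtype.val (cell_dv_eq_zero p q False i j x hi)).symm
    · rw [dv_shape _ i j h, dv_shape _ i j h]
      rfl

instance (p : ℕ) (q : ℤ) : Mono (cellIncl k p q) :=
  mono_of_injective _ (fun a x y h => Subtype.ext (congr_arg (fun z => z.1) h :))

end cells

end BCh

/-! ### Maps out of the cells and lifting against them -/

namespace BCh

variable {k : Type u} [CommRing k]

lemma dh_eq_zero (A : BCh k) (p p' : ℕ) (q q' : ℤ) (h : p' + 1 ≠ p ∨ q' ≠ q) :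
    A.dh (p, q) (p', q') = 0 :=
  A.dh_shape _ _ (fun h' => h.elim (fun h => h h'.1) (fun h => h h'.2))

lemma dv_eq_zero (A : BCh k) (p p' : ℕ) (q q' : ℤ) (h : p' ≠ p ∨ q' + 1 ≠ q) :
    A.dv (p, q) (p', q') = 0 :=
  A.dv_shape _ _ (fun h' => h.elim (fun h => h h'.1) (fun h => h h'.2))

/-- Vertical cycles are required to be killed by the differentials to all bidegrees, which makes
sense in a row not written as a successor; only the adjacent target carries information. -/
lemma dv_apply_eq_zero (A : BCh k) (p : ℕ) (q : ℤ) (x : A.X (p, q + 1))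
    (h : (A.dv (p, q + 1) (p, q)).hom x = 0) (j : ℕ × ℤ) : (A.dv (p, q + 1) j).hom x = 0 := by
  obtain ⟨p', q'⟩ := j
  by_cases h' : p' ≠ p ∨ q' + 1 ≠ q + 1
  · rw [dv_eq_zero A _ _ _ _ h']
    rfl
  · obtain ⟨rfl, h''⟩ := not_or.1 h' |>.imp not_not.1 not_not.1
    obtain rfl : q' = q := by lia
    exact h

lemma f_dh_apply {A B : BCh k} (φ : A ⟶ B) (i j : ℕ × ℤ) (x : A.X i) :
    (φ.f j).hom ((A.dh i j).hom x) = (B.dh i j).hom ((φ.f i).hom x) :=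
  (congr_arg (fun f => f.hom x) (φ.comm_h i j)).symm

lemma f_dv_apply {A B : BCh k} (φ : A ⟶ B) (i j : ℕ × ℤ) (x : A.X i) :
    (φ.f j).hom ((A.dv i j).hom x) = (B.dv i j).hom ((φ.f i).hom x) :=
  (congr_arg (fun f => f.hom x) (φ.comm_v i j)).symm

lemma comp_f_apply {A B C : BCh k} (φ : A ⟶ B) (ψ : B ⟶ C) (i : ℕ × ℤ) (x : A.X i) :
    ((φ ≫ ψ).f i).hom x = (ψ.f i).hom ((φ.f i).hom x) := rfl

lemma dv_dh_apply (A : BCh k) (p p' : ℕ) (q : ℤ) (x : A.X (p, q + 1)) (h : p' + 1 = p) :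
    (A.dv (p', q + 1) (p', q)).hom ((A.dh (p, q + 1) (p', q + 1)).hom x) =
      - (A.dh (p, q) (p', q)).hom ((A.dv (p, q + 1) (p, q)).hom x) :=
  eq_neg_of_add_eq_zero_left (anticomm_apply A (p, q + 1) (p', q + 1) (p, q) (p', q)
    h rfl rfl rfl rfl rfl x)

/-- The transport of elements along an equality of bidegrees, zero if they are distinct. -/
noncomputable def transport (A : BCh k) (i j : ℕ × ℤ) : A.X i ⟶ A.X j :=
  if h : i = j then eqToHom (by rw [h]) else 0

@[simp] lemma transport_self (A : BCh k) (i : ℕ × ℤ) (x : A.X i) :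
    (A.transport i i).hom x = x := by
  simp [transport]

lemma transport_ne (A : BCh k) {i j : ℕ × ℤ} (h : i ≠ j) : A.transport i j = 0 := dif_neg h

section free

variable (A : BCh k) (p : ℕ) (q : ℤ)

/-- The components of the morphism from a free bicomplex. -/
noncomputable def freeFam (e : A.X (p, q + 1)) (a : ℕ × ℤ) : A.X a :=
  -- The four summands have distinct target bidegrees and vanish off them, so at most one survives
  -- at each a. The sum replaces a case distinction with casts.
  (A.transport (p, q + 1) a).hom e + (A.dh (p, q + 1) a).hom e + (A.dv (p, q + 1) a).hom e +
    (A.dh (p, q) a).hom ((A.dv (p, q + 1) (p, q)).hom e)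

variable {A p q}

lemma freeFam_top (e : A.X (p, q + 1)) : freeFam A p q e (p, q + 1) = e := by
  rw [freeFam, dh_eq_zero _ _ _ _ _ (by lia), dv_eq_zero _ _ _ _ _ (by lia),
    dh_eq_zero _ _ _ _ _ (by lia)]
  simp

lemma freeFam_h (e : A.X (p, q + 1)) (p' : ℕ) (h : p' + 1 = p) :
    freeFam A p q e (p', q + 1) = (A.dh (p, q + 1) (p', q + 1)).hom e := by
  rw [freeFam, dv_eq_zero _ _ _ _ _ (by lia), dh_eq_zero A p p' q _ (by lia),
    transport_ne _ (by simp; lia)]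
  simp

lemma freeFam_v (e : A.X (p, q + 1)) :
    freeFam A p q e (p, q) = (A.dv (p, q + 1) (p, q)).hom e := by
  rw [freeFam, dh_eq_zero _ _ _ _ _ (by lia), dh_eq_zero A p p q q (by lia),
    transport_ne _ (by simp)]
  simp

lemma freeFam_hv (e : A.X (p, q + 1)) (p' : ℕ) (h : p' + 1 = p) :
    freeFam A p q e (p', q) = (A.dh (p, q) (p', q)).hom ((A.dv (p, q + 1) (p, q)).hom e) := by
  rw [freeFam, dh_eq_zero _ _ _ _ _ (by lia), dv_eq_zero A _ _ _ _ (by lia),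
    transport_ne _ (by simp)]
  simp

/-- The morphism from a free bicomplex attached to an element. -/
noncomputable def freeHom (e : A.X (p, q + 1)) : cell k p q True ⟶ A :=
  cellHom (freeFam A p q e)
    (by
      rintro ⟨i1, i2⟩ ⟨j1, j2⟩ ⟨-, hi⟩ ⟨h1, h2⟩ rfl
      dsimp only at h1 h2 hi e ⊢
      subst h2
      rcases hi with rfl | ⟨-, rfl⟩
      · rw [freeFam_v, freeFam_hv _ _ h1]
      · rw [freeFam_top, freeFam_h _ _ h1])
    (by
      rintro ⟨i1, i2⟩ ⟨j1, j2⟩ ⟨hp, hi⟩ hne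
      dsimp only at hp hi hne ⊢
      replace hp := hp.resolve_left hne
      rcases hi with rfl | ⟨-, rfl⟩
      · rw [freeFam_hv _ _ hp, dh_dh_apply]
      · rw [freeFam_h _ _ hp, dh_dh_apply])
    (by
      rintro ⟨i1, i2⟩ ⟨j1, j2⟩ ⟨hp, -⟩ ⟨h1, h2⟩ hi
      dsimp only at hp h1 h2 hi ⊢
      subst hi h1
      obtain rfl : q = j2 := by lia
      split_ifs with h
      · subst h
        rw [freeFam_v, freeFam_top]
      · replace hp := hp.resolve_left h
        -- Anticommutativity in A produces exactly the sign -1 of the cell outside column p.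
        rw [freeFam_hv _ _ hp, freeFam_h _ _ hp, dv_dh_apply _ _ _ _ _ hp])
    (by
      rintro ⟨i1, i2⟩ j ⟨hp, hi⟩ hne
      dsimp only at hp hi hne ⊢
      obtain rfl := hi.resolve_right (fun h => hne h.2)
      obtain ⟨j1, j2⟩ := j
      by_cases hj : j1 ≠ i1 ∨ j2 + 1 ≠ i2
      · rw [dv_eq_zero A _ _ _ _ hj]
        rfl
      obtain ⟨rfl, rfl⟩ := not_or.1 hj |>.imp not_not.1 not_not.1
      by_cases h : j1 = p
      · subst h
        rw [freeFam_v, dv_dv_apply]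
      · replace hp := hp.resolve_left h
        rw [freeFam_hv _ _ hp, dv_dh_apply _ _ _ _ _ hp, dv_dv_apply, map_zero, neg_zero])

variable (A p q) in
/-- The components of the morphism from the free bicomplex on a vertical cycle. -/
noncomputable def cycFam (e : A.X (p, q)) (a : ℕ × ℤ) : A.X a :=
  (A.transport (p, q) a).hom e + (A.dh (p, q) a).hom e

lemma cycFam_top (e : A.X (p, q)) : cycFam A p q e (p, q) = e := by
  rw [cycFam, dh_eq_zero _ _ _ _ _ (by lia)]
  simp

lemma cycFam_h (e : A.X (p, q)) (p' : ℕ) (h : p' + 1 = p) :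
    cycFam A p q e (p', q) = (A.dh (p, q) (p', q)).hom e := by
  rw [cycFam, transport_ne _ (by simp; lia)]
  simp

/-- The morphism attached to a vertical cycle. -/
noncomputable def cycHom (e : A.X (p, q)) (he : ∀ j, (A.dv (p, q) j).hom e = 0) :
    cell k p q False ⟶ A :=
  cellHom (cycFam A p q e)
    (by
      rintro ⟨i1, i2⟩ ⟨j1, j2⟩ ⟨-, hi⟩ ⟨h1, h2⟩ rfl
      dsimp only at h1 h2 hi e ⊢
      subst h2
      obtain rfl := hi.resolve_right (fun h => h.1)
      rw [cycFam_top, cycFam_h _ _ h1])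
    (by
      rintro ⟨i1, i2⟩ ⟨j1, j2⟩ ⟨hp, hi⟩ hne
      dsimp only at hp hi hne ⊢
      replace hp := hp.resolve_left hne
      obtain rfl := hi.resolve_right (fun h => h.1)
      rw [cycFam_h _ _ hp, dh_dh_apply])
    (by
      rintro ⟨i1, i2⟩ ⟨j1, j2⟩ ⟨-, hi⟩ - h
      have := (hi.resolve_right (fun h => h.1)).symm.trans h
      lia)
    (by
      rintro ⟨i1, i2⟩ ⟨j1, j2⟩ ⟨hp, hi⟩ hne
      dsimp only at hp hi hne ⊢
      obtain rfl := hi.resolve_right (fun h => h.1)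
      by_cases hj : j1 ≠ i1 ∨ j2 + 1 ≠ i2
      · rw [dv_eq_zero A _ _ _ _ hj]
        rfl
      obtain ⟨rfl, rfl⟩ := not_or.1 hj |>.imp not_not.1 not_not.1
      by_cases h : j1 = p
      · subst h
        rw [cycFam_top, he]
      · replace hp := hp.resolve_left h
        rw [cycFam_h _ _ hp, dv_dh_apply _ _ _ _ _ hp, he, map_zero, neg_zero])

lemma freeHom_apply (e : A.X (p, q + 1)) (a : ℕ × ℤ) (x : (cell k p q True).X a) :
    ((freeHom e).f a).hom x = x.1 • freeFam A p q e a := rfl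

lemma cycHom_apply (e : A.X (p, q)) (he : ∀ j, (A.dv (p, q) j).hom e = 0) (a : ℕ × ℤ)
    (x : (cell k p q False).X a) : ((cycHom e he).f a).hom x = x.1 • cycFam A p q e a := rfl

variable (k p q)

lemma cellSupp_top : cellSupp p q True (p, q + 1) := ⟨Or.inl rfl, Or.inr ⟨trivial, rfl⟩⟩
lemma cellSupp_v (b : Prop) : cellSupp p q b (p, q) := ⟨Or.inl rfl, Or.inl rfl⟩

/-- The generator of a free bicomplex. -/
def freeGen : (cell k p q True).X (p, q + 1) := cellElt p q True (p, q + 1) (cellSupp_top p q) 1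

/-- The generator of the free bicomplex on a vertical cycle. -/
def cycGen : (cell k p q False).X (p, q) := cellElt p q False (p, q) (cellSupp_v p q _) 1

variable {k p q}

lemma freeHom_gen (e : A.X (p, q + 1)) : ((freeHom e).f (p, q + 1)).hom (freeGen k p q) = e := by
  refine (freeHom_apply _ _ _).trans ?_
  rw [freeFam_top]
  exact one_smul _ _

lemma cycHom_gen (e : A.X (p, q)) (he : ∀ j, (A.dv (p, q) j).hom e = 0) :
    ((cycHom e he).f (p, q)).hom (cycGen k p q) = e := by
  refine (cycHom_apply _ _ _ _).trans ?_
  rw [cycFam_top]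
  exact one_smul _ _

lemma cycGen_dv (j : ℕ × ℤ) : ((cell k p q False).dv (p, q) j).hom (cycGen k p q) = 0 :=
  cell_dv_eq_zero p q _ _ _ _ (by simp)

/-- This makes `cellIncl` the universal instance of a vertical cycle being the boundary of an
element. -/
lemma cellIncl_cycGen : ((cellIncl k p q).f (p, q)).hom (cycGen k p q) =
    ((cell k p q True).dv (p, q + 1) (p, q)).hom (freeGen k p q) :=
  Subtype.ext ((cell_dv_coe p q True (p, q + 1) (p, q) (freeGen k p q)
    ⟨rfl, rfl⟩ rfl).trans (if_pos rfl)).symm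

lemma eq_smul_cellElt {b : Prop} {a : ℕ × ℤ} (h : cellSupp p q b a) (x : (cell k p q b).X a) :
    x = x.1 • cellElt p q b a h (1 : k) := Subtype.ext (mul_one _).symm

lemma cellElt_h {b : Prop} {i j : ℕ × ℤ} (h : j.1 + 1 = i.1 ∧ j.2 = i.2) (hi : i.1 = p)
    (hs : cellSupp p q b i) (hs' : cellSupp p q b j) :
    cellElt p q b j hs' (1 : k) = ((cell k p q b).dh i j).hom (cellElt p q b i hs (1 : k)) :=
  Subtype.ext (cell_dh_coe p q b i j (cellElt p q b i hs (1 : k)) h hi).symm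

lemma cellElt_v {p : ℕ} {q : ℤ}
    (hs : cellSupp p q True (p, q + 1)) (hs' : cellSupp p q True (p, q)) :
    cellElt p q True (p, q) hs' (1 : k) =
      ((cell k p q True).dv (p, q + 1) (p, q)).hom (cellElt p q True (p, q + 1) hs (1 : k)) :=
  Subtype.ext ((cell_dv_coe p q True (p, q + 1) (p, q) (cellElt p q True (p, q + 1) hs (1 : k))
    ⟨rfl, rfl⟩ rfl).trans (if_pos rfl)).symm

/-- In each supported bidegree the cell is spanned by the generator, by one of its two boundaries,
or by its iterated boundary. -/
lemma free_hom_ext {φ ψ : cell k p q True ⟶ A}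
    (h : (φ.f (p, q + 1)).hom (freeGen k p q) = (ψ.f (p, q + 1)).hom (freeGen k p q)) : φ = ψ := by
  ext ⟨i1, i2⟩ x
  by_cases hs : cellSupp p q True (i1, i2)
  · rw [eq_smul_cellElt hs x, map_smul, map_smul]
    congr 1
    obtain ⟨rfl | hp, rfl | ⟨-, rfl⟩⟩ := id hs
    · erw [cellElt_v (cellSupp_top _ _) hs, f_dv_apply, f_dv_apply]
      exact congr_arg _ h
    · exact h
    · erw [cellElt_h (i := (p, i2)) ⟨hp, rfl⟩ rfl (cellSupp_v _ _ _) hs,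
        cellElt_v (cellSupp_top _ _) _, f_dh_apply, f_dh_apply, f_dv_apply, f_dv_apply]
      exact congr_arg _ (congr_arg _ h)
    · erw [cellElt_h (i := (p, q + 1)) ⟨hp, rfl⟩ rfl (cellSupp_top _ _) hs,
        f_dh_apply, f_dh_apply]
      exact congr_arg _ h
  · rw [cell_elt_eq_zero _ _ _ _ hs x, map_zero, map_zero]

lemma cyc_hom_ext {φ ψ : cell k p q False ⟶ A}
    (h : (φ.f (p, q)).hom (cycGen k p q) = (ψ.f (p, q)).hom (cycGen k p q)) : φ = ψ := by
  ext ⟨i1, i2⟩ x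
  by_cases hs : cellSupp p q False (i1, i2)
  · rw [eq_smul_cellElt hs x, map_smul, map_smul]
    congr 1
    obtain ⟨rfl | hp, rfl | h'⟩ := id hs
    · exact h
    · exact h'.1.elim
    · erw [cellElt_h (i := (p, i2)) ⟨hp, rfl⟩ rfl (cellSupp_v _ _ _) hs,
        f_dh_apply, f_dh_apply]
      exact congr_arg _ h
    · exact h'.1.elim
  · rw [cell_elt_eq_zero _ _ _ _ hs x, map_zero, map_zero]

end free

/-- The lifting condition against the generating cofibration in bidegree `(p, q)`. -/
def ColLift {E F : BCh k} (f : E ⟶ F) (p : ℕ) (q : ℤ) : Prop :=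
  ∀ (x : E.X (p, q)) (y : F.X (p, q + 1)), (∀ j, (E.dv (p, q) j).hom x = 0) →
    (f.f (p, q)).hom x = (F.dv (p, q + 1) (p, q)).hom y →
    ∃ x' : E.X (p, q + 1), (f.f (p, q + 1)).hom x' = y ∧ (E.dv (p, q + 1) (p, q)).hom x' = x

/-- A commutative square from `cellIncl` to f is a vertical cycle x of E and an element y of F with
f x = d_v y, because the two cells represent vertical cycles and elements respectively. -/
lemma hasLiftingProperty_cellIncl_iff {E F : BCh k} (f : E ⟶ F) (p : ℕ) (q : ℤ) :
    HasLiftingProperty (cellIncl k p q) f ↔ ColLift f p q := by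
  constructor
  · intro h x y hx hxy
    have sq : CommSq (cycHom x hx) (cellIncl k p q) f (freeHom y) := ⟨cyc_hom_ext (by
      rw [comp_f_apply, comp_f_apply, cycHom_gen, cellIncl_cycGen, f_dv_apply, freeHom_gen, hxy])⟩
    refine ⟨(sq.lift.f _).hom (freeGen k p q), ?_, ?_⟩
    · rw [← comp_f_apply, sq.fac_right, freeHom_gen]
    · rw [← f_dv_apply, ← cellIncl_cycGen, ← comp_f_apply, sq.fac_left, cycHom_gen]
  · intro h
    refine ⟨fun {u v} sq => ?_⟩
    obtain ⟨e, he1, he2⟩ := h ((u.f _).hom (cycGen k p q)) ((v.f _).hom (freeGen k p q))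
      (fun j => by rw [← f_dv_apply, cycGen_dv, map_zero])
      (by rw [← comp_f_apply, sq.w, comp_f_apply, cellIncl_cycGen, f_dv_apply])
    refine ⟨⟨⟨freeHom e, cyc_hom_ext ?_, free_hom_ext ?_⟩⟩⟩
    · rw [comp_f_apply, cellIncl_cycGen, f_dv_apply, freeHom_gen, he2]
    · rw [comp_f_apply, freeHom_gen, he1]

/-- The elementwise form of acyclicity of the kernel, in the column `p`. -/
def ColKerAcyclic {E F : BCh k} (f : E ⟶ F) (p : ℕ) : Prop :=
  ∀ (q : ℤ) (x : E.X (p, q + 1)), (f.f (p, q + 1)).hom x = 0 →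
    (E.dv (p, q + 1) (p, q)).hom x = 0 →
    ∃ w : E.X (p, q + 1 + 1), (f.f (p, q + 1 + 1)).hom w = 0 ∧
      (E.dv (p, q + 1 + 1) (p, q + 1)).hom w = x

lemma quasiIso_column_iff {E F : BCh k} (f : E ⟶ F) (p : ℕ)
    (hf : ∀ q, Function.Surjective (f.f (p, q)).hom) :
    QuasiIso ((column p).map f) ↔ ColKerAcyclic f p :=
  Ch.quasiIso_iff_kerAcyclic _ hf

/-- The usual characterization of trivial fibrations of complexes by lifting against inclusions of
spheres in discs, applied to the single column p. -/
lemma forall_colLift_iff {E F : BCh k} (f : E ⟶ F) (p : ℕ) :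
    (∀ q, ColLift f p q) ↔ (∀ q, Function.Surjective (f.f (p, q)).hom) ∧
      QuasiIso ((column p).map f) := by
  constructor
  · intro h
    have hs : ∀ q, ∀ y, (∀ j, (F.dv (p, q) j).hom y = 0) → ∃ x, (f.f (p, q)).hom x = y := by
      intro q y hy
      obtain ⟨q, rfl⟩ : ∃ q', q = q' + 1 := ⟨q - 1, by ring⟩
      obtain ⟨x', h1, -⟩ := h q 0 y (by simp) (by rw [map_zero, hy])
      exact ⟨x', h1⟩
    have hs' : ∀ q, Function.Surjective (f.f (p, q)).hom := by
      intro q y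
      obtain ⟨q, rfl⟩ : ∃ q', q = q' + 1 := ⟨q - 1, by ring⟩
      obtain ⟨q, rfl⟩ : ∃ q', q = q' + 1 := ⟨q - 1, by ring⟩
      -- Surjectivity takes two liftings: d_v y is lifted to a vertical cycle z, and then y is
      -- lifted to an element with boundary z.
      obtain ⟨z, hz1, hz2⟩ := h q 0 ((F.dv (p, q + 1 + 1) (p, q + 1)).hom y) (by simp)
        (by rw [dv_dv_apply, map_zero])
      obtain ⟨x', h1, -⟩ := h (q + 1) z y (dv_apply_eq_zero _ _ _ _ hz2) hz1
      exact ⟨x', h1⟩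
    refine ⟨hs', (quasiIso_column_iff f p hs').2 ?_⟩
    intro q x hx hdx
    exact h (q + 1) x 0 (dv_apply_eq_zero _ _ _ _ hdx) (by rw [map_zero]; exact hx)
  · rintro ⟨hs, hq⟩ q x y hx hxy
    rw [quasiIso_column_iff f p hs] at hq
    obtain ⟨q, rfl⟩ : ∃ q', q = q' + 1 := ⟨q - 1, by ring⟩
    obtain ⟨x', hx'⟩ := hs _ y
    -- For an arbitrary lift x' of y, the defect x - d_v x' is a cycle of the kernel, so it is the
    -- boundary of a kernel element w, and x' + w is the desired lift.
    obtain ⟨w, hw1, hw2⟩ := hq q (x - (E.dv (p, q + 1 + 1) (p, q + 1)).hom x')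
      (by rw [map_sub, f_dv_apply, hx', hxy, sub_self])
      (by rw [map_sub, hx, dv_dv_apply, sub_self])
    refine ⟨x' + w, ?_, ?_⟩
    · rw [map_add, hx', hw1, add_zero]
    · rw [map_add, hw2]
      abel

end BCh

/-! ### Elements of the total complex and descent along columns -/

namespace BCh

variable {k : Type u} [CommRing k]

lemma transport_dv (A : BCh k) (i j l : ℕ × ℤ) (h : j = l) (x : A.X i) :
    (A.transport j l).hom ((A.dv i j).hom x) = (A.dv i l).hom x := by
  subst h; simp

lemma transport_dh (A : BCh k) (i j l : ℕ × ℤ) (h : j = l) (x : A.X i) :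
    (A.transport j l).hom ((A.dh i j).hom x) = (A.dh i l).hom x := by
  subst h; simp

lemma f_transport {A B : BCh k} (φ : A ⟶ B) (i j : ℕ × ℤ) (x : A.X i) :
    (φ.f j).hom ((A.transport i j).hom x) = (B.transport i j).hom ((φ.f i).hom x) := by
  by_cases h : i = j
  · subst h; simp
  · rw [transport_ne _ h, transport_ne _ h]
    exact map_zero _

lemma transport_injective (A : BCh k) {i j : ℕ × ℤ} (h : i = j) :
    Function.Injective (A.transport i j).hom := by
  subst h
  intro x y hxy
  simpa using hxy

lemma transport_transport (A : BCh k) {i j : ℕ × ℤ} (h : i = j) (x : A.X j) :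
    (A.transport i j).hom ((A.transport j i).hom x) = x := by
  subst h; simp

section tot

/-- The inclusion of a summand in the total complex, zero in all degrees but one. -/
noncomputable def totι (A : BCh k) (a : ℕ × ℤ) (n : ℤ) : A.X a →ₗ[k]
    DirectSum ℕ (fun p => A.X (p, n - p)) :=
  (DirectSum.lof k ℕ (fun p => A.X (p, n - p)) a.1).comp (A.transport a (a.1, n - a.1)).hom

lemma totι_eq_zero (A : BCh k) (a : ℕ × ℤ) (n : ℤ) (h : (a.1 : ℤ) + a.2 ≠ n) : totι A a n = 0 := by
  obtain ⟨p, q⟩ := a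
  rw [totι, transport_ne _ (fun h' => h (by have := congr_arg Prod.snd h'; dsimp at *; lia))]
  exact LinearMap.ext (fun _ => map_zero (DirectSum.lof k ℕ (fun p => A.X (p, n - p)) p))

lemma totι_self (A : BCh k) (p : ℕ) (n : ℤ) (x : A.X (p, n - p)) :
    totι A (p, n - p) n x = DirectSum.lof k ℕ (fun p => A.X (p, n - p)) p x :=
  congr_arg (DirectSum.lof k ℕ (fun p => A.X (p, n - p)) p) (transport_self A _ x)

/-- No relation between a and n is imposed: off total degree n all terms vanish. The truncated a.1 -
1 is harmless, since d_h vanishes on column 0. -/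
lemma totD_totι (A : BCh k) (a : ℕ × ℤ) (n m : ℤ) (hm : m + 1 = n) (x : A.X a) :
    (totD A n m).hom (totι A a n x) = totι A (a.1, a.2 - 1) m ((A.dv a _).hom x) +
      totι A (a.1 - 1, a.2) m ((A.dh a _).hom x) := by
  by_cases h : (a.1 : ℤ) + a.2 = n
  · obtain ⟨p, q⟩ := a
    obtain rfl : q = n - p := by dsimp at h; lia
    subst hm
    rw [totι_self, totD_lof]
    congr 1
    · refine congr_arg _ (transport_dv A _ _ _ ?_ x).symm
      ext <;> dsimp; ring
    · rcases p with _ | p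
      · rw [dh_zero, dh_zero]
        exact (map_zero _).trans (map_zero _).symm
      · refine congr_arg _ (transport_dh A _ _ _ ?_ x).symm
        ext <;> dsimp; push_cast; ring
  · rw [totι_eq_zero _ _ _ h, totι_eq_zero A (a.1, a.2 - 1) _ (by dsimp; lia)]
    refine (map_zero (totD A n m).hom).trans (Eq.symm ((zero_add _).trans ?_))
    obtain ⟨_ | p, q⟩ := a
    · rw [dh_zero]
      exact map_zero _
    · rw [totι_eq_zero _ _ _ (by dsimp at *; push_cast at *; lia)]
      rfl

lemma totMap_totι {A B : BCh k} (φ : A ⟶ B) (a : ℕ × ℤ) (n : ℤ) (x : A.X a) :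
    (totMap φ n).hom (totι A a n x) = totι B a n ((φ.f a).hom x) := by
  refine (totMap_lof φ n a.1 _).trans ?_
  rw [f_transport]
  rfl

lemma totD_totι_zero (A : BCh k) (n m : ℤ) (h : m + 1 = n) (x : A.X (0, n)) :
    (totD A n m).hom (totι A (0, n) n x) = totι A (0, m) m ((A.dv (0, n) (0, m)).hom x) := by
  rw [totD_totι A _ _ _ h, dh_zero]
  obtain rfl : m = n - 1 := by lia
  exact (congr_arg _ (map_zero _)).trans (add_zero _)

/-- The morphism to the total complex of the column of horizontal degree zero. -/
noncomputable def colTot (A : BCh k) : (column 0).obj A ⟶ Tot.obj A where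
  f n := ModuleCat.ofHom (totι A (0, n) n)
  comm' n m h := by
    ext x
    exact totD_totι_zero A n m h x

lemma colTot_naturality {A B : BCh k} (φ : A ⟶ B) :
    colTot A ≫ Tot.map φ = (column 0).map φ ≫ colTot B := by
  ext n x
  exact totMap_totι φ (0, n) n x

lemma totι_zero_injective (A : BCh k) (n : ℤ) : Function.Injective (totι A (0, n) n) := by
  intro x y h
  exact transport_injective A (by simp)
    (DirectSum.of_injective (β := fun p : ℕ => A.X (p, n - p)) 0 h)

lemma exists_totι_zero (A : BCh k) (n : ℤ) (z : DirectSum ℕ (fun p => A.X (p, n - p)))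
    (hz : ∀ p, p ≠ 0 → z p = 0) : ∃ x : A.X (0, n), z = totι A (0, n) n x := by
  refine ⟨(A.transport (0, n - (0 : ℕ)) (0, n)).hom (z 0), ?_⟩
  refine Eq.trans ?_ (congr_arg (DirectSum.lof k ℕ (fun p => A.X (p, n - p)) 0)
    (transport_transport A (by simp) (z 0)).symm)
  apply DFinsupp.ext
  intro p
  by_cases hp : p = 0
  · subst hp
    exact (DirectSum.of_eq_same (β := fun p : ℕ => A.X (p, n - p)) 0 (z 0)).symm
  · exact (hz p hp).trans (DirectSum.of_eq_of_ne (β := fun p : ℕ => A.X (p, n - p)) 0 p _ hp).symm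

lemma totD_apply (A : BCh k) (n m : ℤ) (z : DirectSum ℕ (fun p => A.X (p, n - p))) (p : ℕ) :
    ((totD A n m).hom z : DirectSum ℕ (fun p => A.X (p, m - p))) p =
      (A.dv (p, n - p) (p, m - p)).hom (z p) +
      (A.dh (p + 1, n - (p + 1 : ℕ)) (p, m - p)).hom (z (p + 1)) := by
  induction z using DirectSum.induction_on with
  | zero =>
    refine (congr_arg (fun w : DirectSum ℕ (fun p => A.X (p, m - p)) => w p)
      (map_zero (totD A n m).hom)).trans ?_
    exact ((congr_arg₂ (· + ·) (map_zero _) (map_zero _)).trans (add_zero _)).symm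
  | add z w hz hw =>
    refine (congr_arg (fun w : DirectSum ℕ (fun p => A.X (p, m - p)) => w p)
      (map_add (totD A n m).hom z w)).trans ?_
    refine (DirectSum.add_apply _ _ _).trans ?_
    rw [hz, hw, DirectSum.add_apply, DirectSum.add_apply, map_add, map_add]
    abel
  | of i x =>
    refine (congr_arg (fun w : DirectSum ℕ (fun p => A.X (p, m - p)) => w p)
      (totD_lof A n m i x)).trans ?_
    refine (DirectSum.add_apply _ _ _).trans ?_
    congr 1
    · by_cases h : p = i
      · subst h
        rw [DirectSum.of_eq_same]
        exact DirectSum.of_eq_same (β := fun p : ℕ => A.X (p, m - p)) p _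
      · rw [DirectSum.of_eq_of_ne _ _ _ h, map_zero]
        exact DirectSum.of_eq_of_ne (β := fun p : ℕ => A.X (p, m - p)) i p _ h
    · by_cases h : p + 1 = i
      · subst h
        rw [DirectSum.of_eq_same]
        exact DirectSum.of_eq_same (β := fun p : ℕ => A.X (p, m - p)) p _
      · rw [DirectSum.of_eq_of_ne _ _ _ h, map_zero]
        rcases i with _ | i
        · rw [dh_zero]
          exact congr_arg (fun w : DirectSum ℕ (fun p => A.X (p, m - p)) => w p) (map_zero
            (DirectSum.lof k ℕ (fun p => A.X (p, m - p)) _))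
        · exact DirectSum.of_eq_of_ne (β := fun p : ℕ => A.X (p, m - p)) i p _ (by lia)

lemma ColKerAcyclic.exists {E F : BCh k} {f : E ⟶ F} {p : ℕ} (h : ColKerAcyclic f p)
    (q₀ q₁ q₂ : ℤ) (h₁ : q₁ + 1 = q₀) (h₂ : q₂ + 1 = q₁) (x : E.X (p, q₁))
    (hx : (f.f (p, q₁)).hom x = 0) (hdx : (E.dv (p, q₁) (p, q₂)).hom x = 0) :
    ∃ w : E.X (p, q₀), (f.f (p, q₀)).hom w = 0 ∧ (E.dv (p, q₀) (p, q₁)).hom w = x := by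
  subst h₂ h₁
  exact h q₂ x hx hdx

/-- Induction on a bound N for the columns supporting z. The top component of z is a vertical cycle
of the kernel, because nothing to its right contributes to the boundary in its column. If that
column is positive, it equals d_v w with w in the kernel, and subtracting the total boundary of w
leaves only columns up to N. The boundary of z is only assumed to vanish in positive columns, so the
lemma also applies to a z bounding an element of column 0. -/
lemma exists_tot_sub_mem_column {E F : BCh k} (f : E ⟶ F)
    (hf : ∀ p, p ≠ 0 → ColKerAcyclic f p) (l n m : ℤ) (hl : n + 1 = l) (hm : m + 1 = n)
    (z : DirectSum ℕ (fun p => E.X (p, n - p))) (hz : (totMap f n).hom z = 0)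
    (hdz : ∀ p, p ≠ 0 → ((totD E n m).hom z : DirectSum ℕ (fun p => E.X (p, m - p))) p = 0) :
    ∃ (v : DirectSum ℕ (fun p => E.X (p, l - p))) (y : E.X (0, n)),
      (totMap f l).hom v = 0 ∧ (f.f (0, n)).hom y = 0 ∧
      z = totι E (0, n) n y + ((totD E l n).hom v : DirectSum ℕ (fun p => E.X (p, n - p))) := by
  suffices H : ∀ (N : ℕ) (z : DirectSum ℕ (fun p => E.X (p, n - p)))
      (hz : (totMap f n).hom z = 0)
      (hdz : ∀ p, p ≠ 0 → ((totD E n m).hom z : DirectSum ℕ (fun p => E.X (p, m - p))) p = 0)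
      (hN : ∀ p, N < p → z p = 0),
      ∃ (v : DirectSum ℕ (fun p => E.X (p, l - p))) (y : E.X (0, n)),
      (totMap f l).hom v = 0 ∧ (f.f (0, n)).hom y = 0 ∧
      z = totι E (0, n) n y + ((totD E l n).hom v : DirectSum ℕ (fun p => E.X (p, n - p))) by
    classical
    -- The induction starts at the largest index in the support, which exists since the total
    -- complex is a direct sum.
    refine H ((DFinsupp.support z).sup id) z hz hdz (fun p hp => ?_)
    by_contra h
    exact absurd (Finset.le_sup (f := id) (DFinsupp.mem_support_iff.2 h)) (not_le.2 hp)
  intro N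
  induction N with
  | zero =>
    intro z hz _ hN
    obtain ⟨y, rfl⟩ := exists_totι_zero E n z (fun p hp => hN p (Nat.pos_of_ne_zero hp))
    refine ⟨0, y, map_zero _, ?_, ?_⟩
    · rw [totMap_totι] at hz
      exact totι_zero_injective F n (hz.trans (map_zero _).symm)
    · exact ((congr_arg _ (map_zero _)).trans (add_zero _)).symm
  | succ N ih =>
    intro z hz hdz hN
    have h1 : (f.f (N + 1, n - (N + 1 : ℕ))).hom (z (N + 1)) = 0 :=
      congr_arg (fun w : DirectSum ℕ (fun p => F.X (p, n - p)) => w (N + 1)) hz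
    have h2 := hdz (N + 1) (Nat.succ_ne_zero _)
    rw [totD_apply, hN (N + 1 + 1) (Nat.lt_succ_self _), map_zero, add_zero] at h2
    -- By `h2` the component z (N + 1) is a vertical cycle.
    obtain ⟨w, hw1, hw2⟩ := (hf (N + 1) (Nat.succ_ne_zero _)).exists (l - (N + 1 : ℕ))
      (n - (N + 1 : ℕ)) (m - (N + 1 : ℕ)) (by lia) (by lia) (z (N + 1)) h1 h2
    let w' : DirectSum ℕ (fun p => E.X (p, l - p)) :=
      DirectSum.lof k ℕ (fun p => E.X (p, l - p)) (N + 1) w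
    have hw' : (totMap f l).hom w' = 0 := by
      refine (totMap_lof f l (N + 1) w).trans ?_
      rw [hw1]
      exact map_zero _
    let u : DirectSum ℕ (fun p => E.X (p, n - p)) := (totD E l n).hom w'
    have hu : (totMap f n).hom u = 0 := by
      refine (congr_arg (fun g => g.hom w') (totMap_comm f l n)).symm.trans ?_
      exact (congr_arg (totD F l n).hom hw').trans (map_zero _)
    have hdu : (totD E n m).hom u = 0 := by
      subst hm hl
      exact congr_arg (fun g => g.hom w') (totD_totD E m)
    have hu' : ∀ p, u p = (E.dv (p, l - p) (p, n - p)).hom (w' p) +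
        (E.dh (p + 1, l - (p + 1 : ℕ)) (p, n - p)).hom (w' (p + 1)) := totD_apply E l n w'
    have hw'1 : w' (N + 1) = w := DirectSum.of_eq_same (β := fun p : ℕ => E.X (p, l - p)) _ _
    have hw'2 : ∀ p, p ≠ N + 1 → w' p = 0 := fun p hp =>
      DirectSum.of_eq_of_ne (β := fun p : ℕ => E.X (p, l - p)) _ _ _ hp
    obtain ⟨v, y, hv, hy, hvy⟩ := ih (z - u)
      ((map_sub (totMap f n).hom z u).trans (by
        rw [hu]
        exact (congr_arg (fun t => t - _) hz).trans (sub_zero _)))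
      (fun p hp => by
        refine (congr_arg (fun w : DirectSum ℕ (fun p => E.X (p, m - p)) => w p)
          ((map_sub (totD E n m).hom z u).trans (by rw [hdu]; exact sub_zero _))).trans (hdz p hp))
      (fun p hp => by
        refine (DirectSum.sub_apply _ _ _).trans ?_
        rw [hu', hw'2 (p + 1) (by lia), map_zero, add_zero]
        rcases Nat.lt_or_ge (N + 1) p with h | h
        · rw [hN p h, hw'2 p (by lia), map_zero, sub_zero]
        · obtain rfl : p = N + 1 := by lia
          rw [hw'1, hw2, sub_self])
    refine ⟨v + w', y, ?_, hy, ?_⟩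
    · exact (map_add (totMap f l).hom v w').trans
        ((congr_arg₂ (· + ·) hv hw').trans (add_zero _))
    · refine (sub_eq_iff_eq_add.1 hvy).trans ((add_assoc _ _ _).trans ?_)
      exact congr_arg _ (map_add (totD E l n).hom v w').symm

end tot

end BCh

/-! ### Weak equivalences detected in horizontal degree zero -/

namespace BCh

variable {k : Type u} [CommRing k]

lemma tot_map_surjective {E F : BCh k} (f : E ⟶ F)
    (hs : ∀ i, Function.Surjective (f.f i).hom) (n : ℤ) :
    Function.Surjective ((Tot.map f).f n).hom :=
  (DirectSum.lmap_surjective (fun p => (f.f (p, n - p)).hom)).2 (fun p => hs _)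

/-- Both sides say that a kernel is acyclic, that of Tot f or that of column 0. Modulo boundaries of
kernel elements, the descent replaces a cycle, or a chain bounding an element of column 0, by an
element of column 0, so the two conditions agree. -/
lemma quasiIso_tot_map_iff {E F : BCh k} (f : E ⟶ F)
    (hs : ∀ i, Function.Surjective (f.f i).hom) (hf : ∀ p, p ≠ 0 → ColKerAcyclic f p) :
    QuasiIso (Tot.map f) ↔ ColKerAcyclic f 0 := by
  rw [Ch.quasiIso_iff_kerAcyclic _ (tot_map_surjective f hs)]
  constructor
  · intro h q x hx hdx
    obtain ⟨u, hu1, hu2⟩ := h q (totι E (0, q + 1) (q + 1) x)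
      ((totMap_totι f _ _ x).trans ((congr_arg _ hx).trans (map_zero _)))
      ((totD_totι_zero E _ _ rfl x).trans ((congr_arg _ hdx).trans (map_zero _)))
    -- u is not a cycle, but its boundary is x placed in column 0, so the descent applies; its
    -- column 0 part y then satisfies d_v y = x.
    obtain ⟨v, y, hv, hy, hvy⟩ := exists_tot_sub_mem_column f hf (q + 1 + 1 + 1) (q + 1 + 1) (q + 1)
      rfl rfl u hu1 (fun p hp => by
        refine (congr_arg (fun w : DirectSum ℕ (fun p => E.X (p, (q + 1) - p)) => w p)
          hu2).trans ?_
        exact DirectSum.of_eq_of_ne (β := fun p : ℕ => E.X (p, (q + 1) - p)) _ _ _ hp)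
    refine ⟨y, hy, totι_zero_injective E _ ?_⟩
    rw [← totD_totι_zero E _ _ rfl]
    have h2 : (totD E (q + 1 + 1) (q + 1)).hom u = totι E (0, q + 1) (q + 1) x := hu2
    rw [← h2, hvy]
    refine Eq.symm ((map_add (totD E (q + 1 + 1) (q + 1)).hom _ _).trans ?_)
    have := congr_arg (fun g => g.hom v) (totD_totD E (q + 1))
    exact (congr_arg _ this).trans (add_zero _)
  · intro h n z hz hdz
    obtain ⟨v, y, hv, hy, hvy⟩ := exists_tot_sub_mem_column f hf (n + 1 + 1) (n + 1) n
      rfl rfl z hz (fun p hp => congr_arg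
        (fun w : DirectSum ℕ (fun p => E.X (p, n - p)) => w p) hdz)
    obtain ⟨w, hw1, hw2⟩ := h n y hy (totι_zero_injective E _ (by
      rw [← totD_totι_zero E _ _ rfl, map_zero]
      have h1 : (totD E (n + 1) n).hom ((totD E (n + 1 + 1) (n + 1)).hom v) = 0 :=
        congr_arg (fun g => g.hom v) (totD_totD E n)
      have h2 := congr_arg (totD E (n + 1) n).hom hvy
      refine (Eq.symm (h2.trans ((map_add (totD E (n + 1) n).hom _ _).trans
        ((congr_arg _ h1).trans (add_zero _))))).trans hdz))
    refine ⟨totι E (0, n + 1 + 1) (n + 1 + 1) w + v, ?_, ?_⟩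
    · refine (map_add (totMap f (n + 1 + 1)).hom _ _).trans ?_
      rw [totMap_totι, hw1, map_zero]
      exact (zero_add _).trans hv
    · refine (map_add (totD E (n + 1 + 1) (n + 1)).hom _ _).trans ?_
      rw [totD_totι_zero E _ _ rfl, hw2]
      exact hvy.symm

/-- The kernel of the zero endomorphism is all of A, so the hypothesis says that the columns p > 0
are acyclic, and the descent for this map pushes cycles and bounding chains of Tot A into column 0.
-/
lemma quasiIso_colTot (A : BCh k) (hA : ∀ p, p ≠ 0 → ColKerAcyclic (0 : A ⟶ A) p) :
    QuasiIso (colTot A) := by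
  rw [Ch.quasiIso_iff_elements]
  have H : ∀ (l n m : ℤ) (hl : n + 1 = l) (hm : m + 1 = n)
      (z : DirectSum ℕ (fun p => A.X (p, n - p)))
      (hdz : ∀ p, p ≠ 0 → ((totD A n m).hom z : DirectSum ℕ (fun p => A.X (p, m - p))) p = 0),
      ∃ (v : DirectSum ℕ (fun p => A.X (p, l - p))) (y : A.X (0, n)),
        z = totι A (0, n) n y + ((totD A l n).hom v : DirectSum ℕ (fun p => A.X (p, n - p))) := by
    intro l n m hl hm z hdz
    obtain ⟨v, y, -, -, h⟩ := exists_tot_sub_mem_column (0 : A ⟶ A) hA l n m hl hm z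
      (DFinsupp.ext (fun p => rfl)) hdz
    exact ⟨v, y, h⟩
  constructor
  · intro n x w hx hw
    replace hw : totι A (0, n + 1) (n + 1) x = (totD A (n + 1 + 1) (n + 1)).hom w := hw
    obtain ⟨v, y, hvy⟩ := H (n + 1 + 1 + 1) (n + 1 + 1) (n + 1) rfl rfl w (fun p hp => by
      rw [← hw]
      exact DirectSum.of_eq_of_ne (β := fun p : ℕ => A.X (p, (n + 1) - p)) _ _ _ hp)
    refine ⟨y, totι_zero_injective A _ ?_⟩
    refine (totD_totι_zero A _ _ rfl y).symm.trans ?_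
    refine Eq.trans ?_ hw.symm
    rw [hvy]
    refine Eq.symm ((map_add (totD A (n + 1 + 1) (n + 1)).hom _ _).trans ?_)
    have := congr_arg (fun g => g.hom v) (totD_totD A (n + 1))
    exact (congr_arg _ this).trans (add_zero _)
  · intro n z hz
    obtain ⟨v, y, hvy⟩ := H (n + 1 + 1) (n + 1) n rfl rfl z (fun p hp => congr_arg
        (fun w : DirectSum ℕ (fun p => A.X (p, n - p)) => w p) hz)
    refine ⟨y, v, totι_zero_injective A _ ?_, hvy⟩
    refine (totD_totι_zero A _ _ rfl y).symm.trans ((Eq.trans ?_ hz).trans (map_zero _).symm)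
    have h1 : (totD A (n + 1) n).hom ((totD A (n + 1 + 1) (n + 1)).hom v) = 0 :=
      congr_arg (fun g => g.hom v) (totD_totD A n)
    have h2 := congr_arg (totD A (n + 1) n).hom hvy
    exact (Eq.symm (h2.trans ((map_add (totD A (n + 1) n).hom _ _).trans
        ((congr_arg _ h1).trans (add_zero _)))))

/-! ### A right adjoint of the total complex -/

section coTot

open Ch

/-- The terms of the right adjoint of the total complex functor. -/
def coTotX (K : Ch k) (a : ℕ × ℤ) : Submodule k (Family K × Family K) where
  -- For u : Tot A ⟶ K, an element x of A should go to the pair (u x, u (d_v x)). In column 0 the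
  -- total differential of x is d_v x, which forces the last condition.
  carrier := { z | z.1 ∈ famAt K (a.1 + a.2) ∧ z.2 ∈ famAt K (a.1 + a.2 - 1) ∧
    (a.1 = 0 → z.2 = famD K z.1) }
  add_mem' hx hy := ⟨add_mem hx.1 hy.1, add_mem hx.2.1 hy.2.1, fun h => by
    dsimp
    rw [hx.2.2 h, hy.2.2 h, map_add]⟩
  zero_mem' := ⟨zero_mem _, zero_mem _, fun h => (map_zero _).symm⟩
  smul_mem' r x hx := ⟨Submodule.smul_mem _ _ hx.1, Submodule.smul_mem _ _ hx.2.1, fun h => by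
    dsimp
    rw [hx.2.2 h, map_smul]⟩

/-- The horizontal differential of the right adjoint of the total complex functor. -/
def coTotDh (K : Ch k) (i j : ℕ × ℤ) (h : j.1 + 1 = i.1 ∧ j.2 = i.2) :
    coTotX K i →ₗ[k] coTotX K j where
  -- Dictated by u (d_h x) = d (u x) - u (d_v x) and u (d_v d_h x) = - u (d_h d_v x) = - d (u (d_v
  -- x)).
  toFun z := ⟨(famD K z.1.1 - z.1.2, - famD K z.1.2),
    sub_mem (famD_mem z.2.1 (by lia)) (fun m hm => z.2.2.1 m (by lia)),
    neg_mem (famD_mem z.2.2.1 (by lia)), fun _ => by simp⟩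
  map_add' x y := by
    ext : 1
    simp only [Submodule.coe_add, Prod.fst_add, Prod.snd_add, map_add, Prod.mk_add_mk]
    congr 1 <;> abel
  map_smul' r x := by
    ext : 1
    simp [smul_sub]

/-- The vertical differential of the right adjoint of the total complex functor. -/
def coTotDv (K : Ch k) (i j : ℕ × ℤ) (h : j.1 = i.1 ∧ j.2 + 1 = i.2) :
    coTotX K i →ₗ[k] coTotX K j where
  toFun z := ⟨(z.1.2, 0), fun m hm => z.2.2.1 m (by lia), zero_mem _, fun hj => by
    dsimp
    rw [z.2.2.2 (h.1.symm.trans hj), famD_famD]⟩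
  map_add' x y := by
    ext : 1
    simp
  map_smul' r x := by
    ext : 1
    simp

/-- The right adjoint of the total complex functor. -/
noncomputable def coTot (K : Ch k) : BCh k where
  X a := ModuleCat.of k (coTotX K a)
  dh i j := if h : j.1 + 1 = i.1 ∧ j.2 = i.2 then ModuleCat.ofHom (coTotDh K i j h) else 0
  dv i j := if h : j.1 = i.1 ∧ j.2 + 1 = i.2 then ModuleCat.ofHom (coTotDv K i j h) else 0
  dh_shape i j h := dif_neg h
  dv_shape i j h := dif_neg h
  dh_comp_dh p q := by
    rw [dif_pos ⟨rfl, rfl⟩, dif_pos ⟨rfl, rfl⟩]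
    ext1
    refine LinearMap.ext (fun z => Subtype.ext ?_)
    change (famD K (famD K z.1.1 - z.1.2) - (- famD K z.1.2), - famD K (- famD K z.1.2)) = 0
    simp
  dv_comp_dv p q := by
    rw [dif_pos ⟨rfl, by dsimp; ring⟩, dif_pos ⟨rfl, rfl⟩]
    ext1
    exact LinearMap.ext (fun z => Subtype.ext rfl)
  anticomm p q := by
    rw [dif_pos ⟨rfl, rfl⟩, dif_pos ⟨rfl, rfl⟩, dif_pos ⟨rfl, rfl⟩, dif_pos ⟨rfl, rfl⟩]
    ext1
    refine LinearMap.ext (fun z => Subtype.ext ?_)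
    change (- famD K z.1.2, (0 : Family K)) + (famD K z.1.2 - 0, - famD K 0) = 0
    simp

lemma coTot_dh_coe (K : Ch k) (i j : ℕ × ℤ) (h : j.1 + 1 = i.1 ∧ j.2 = i.2) (z : coTotX K i) :
    (((coTot K).dh i j).hom z : coTotX K j).1 = (famD K z.1.1 - z.1.2, - famD K z.1.2) :=
  congr_arg (fun f : ModuleCat.of k (coTotX K i) ⟶ ModuleCat.of k (coTotX K j) => (f.hom z).1)
    (dif_pos h)

lemma coTot_dv_coe (K : Ch k) (i j : ℕ × ℤ) (h : j.1 = i.1 ∧ j.2 + 1 = i.2) (z : coTotX K i) :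
    (((coTot K).dv i j).hom z : coTotX K j).1 = (z.1.2, 0) :=
  congr_arg (fun f : ModuleCat.of k (coTotX K i) ⟶ ModuleCat.of k (coTotX K j) => (f.hom z).1)
    (dif_pos h)

/-- The components of the action of `coTot` on morphisms. -/
def coTotMapX {K L : Ch k} (g : K ⟶ L) (a : ℕ × ℤ) : coTotX K a →ₗ[k] coTotX L a where
  toFun z := ⟨(famMap g z.1.1, famMap g z.1.2), famMap_mem g z.2.1, famMap_mem g z.2.2.1,
    fun h => by
      dsimp only
      rw [z.2.2.2 h, famMap_famD]⟩
  map_add' x y := by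
    ext : 1
    simp
  map_smul' r x := by
    ext : 1
    simp

/-- The action of `coTot` on morphisms. -/
noncomputable def coTotMap {K L : Ch k} (g : K ⟶ L) : coTot K ⟶ coTot L where
  f a := ModuleCat.ofHom (coTotMapX g a)
  comm_h i j := by
    by_cases h : j.1 + 1 = i.1 ∧ j.2 = i.2
    · ext1
      refine LinearMap.ext (fun (z : coTotX K i) => Subtype.ext ?_)
      refine (coTot_dh_coe L i j h _).trans ?_
      refine Eq.trans ?_ (congr_arg (fun y : Family K × Family K => (famMap g y.1, famMap g y.2))
        (coTot_dh_coe K i j h z).symm)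
      change (famD L (famMap g z.1.1) - famMap g z.1.2, - famD L (famMap g z.1.2)) = 
        (famMap g (famD K z.1.1 - z.1.2), famMap g (- famD K z.1.2))
      simp only [map_sub, map_neg, famMap_famD]
    · rw [dh_shape _ _ _ h, dh_shape _ _ _ h]
      exact comp_zero.trans zero_comp.symm
  comm_v i j := by
    by_cases h : j.1 = i.1 ∧ j.2 + 1 = i.2
    · ext1
      refine LinearMap.ext (fun (z : coTotX K i) => Subtype.ext ?_)
      refine (coTot_dv_coe L i j h _).trans ?_
      refine Eq.trans ?_ (congr_arg (fun y : Family K × Family K => (famMap g y.1, famMap g y.2))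
        (coTot_dv_coe K i j h z).symm)
      exact Prod.ext rfl (map_zero (famMap g)).symm
    · rw [dv_shape _ _ _ h, dv_shape _ _ _ h]
      exact comp_zero.trans zero_comp.symm

lemma coTotMap_surjective {K L : Ch k} (g : K ⟶ L) (hg : ∀ n, Function.Surjective (g.f n).hom)
    (a : ℕ × ℤ) : Function.Surjective ((coTotMap g).f a).hom := by
  have key : ∀ (n : ℤ) (y : Family L), y ∈ famAt L n → ∃ x, x ∈ famAt K n ∧ famMap g x = y := by
    intro n y hy
    obtain ⟨x, hx⟩ := hg n (y n)
    refine ⟨famSingle K n x, famSingle_mem K n x,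
      famAt_ext (famMap_mem g (famSingle_mem K n x)) hy ?_⟩
    rw [famMap_apply, famSingle_same, hx]
  rintro ⟨⟨z1, z2⟩, h1, h2, h3⟩
  obtain ⟨x1, hx1, rfl⟩ := key _ z1 h1
  -- In column 0 the second component of a lift is determined by the first; elsewhere the components
  -- are lifted independently.
  by_cases ha : a.1 = 0
  · refine ⟨⟨(x1, famD K x1), hx1, famD_mem hx1 (by ring), fun _ => rfl⟩, Subtype.ext ?_⟩
    refine Prod.ext rfl ?_
    exact (famMap_famD g x1).trans (h3 ha).symm
  · obtain ⟨x2, hx2, rfl⟩ := key _ z2 h2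
    exact ⟨⟨(x1, x2), hx1, hx2, fun h => (ha h).elim⟩, rfl⟩

/-- For p > 0 the vertical differential is (z₁, z₂) ↦ (z₂, 0) on unconstrained pairs, so a cycle
(z₁, 0) is the boundary of (0, z₁), naturally in K. Hence `coTot` sends surjections to fibrations.
-/
lemma colKerAcyclic_coTotMap {K L : Ch k} (g : K ⟶ L) (p : ℕ) (hp : p ≠ 0) :
    ColKerAcyclic (coTotMap g) p := by
  rintro q (z : coTotX K (p, q + 1)) hz hdz
  have h1 : z.1.2 = 0 := congr_arg Prod.fst
    ((coTot_dv_coe K (p, q + 1) (p, q) ⟨rfl, rfl⟩ z).symm.trans (congr_arg Subtype.val hdz))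
  have h2 : famMap g z.1.1 = 0 := congr_arg (fun y : coTotX L (p, q + 1) => y.1.1) hz
  refine ⟨⟨(0, z.1.1), zero_mem _, fun m hm => z.2.1 m (by dsimp at *; lia), fun h => (hp h).elim⟩,
    Subtype.ext (Prod.ext (map_zero _) h2), Subtype.ext ?_⟩
  refine (coTot_dv_coe K (p, q + 1 + 1) (p, q + 1) ⟨rfl, rfl⟩ _).trans ?_
  exact Prod.ext rfl h1.symm

/-- The families attached to an element of a bicomplex and a morphism from its total complex. -/
noncomputable def totFam {A : BCh k} {K : Ch k} (u : Tot.obj A ⟶ K) (a : ℕ × ℤ) :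
    A.X a →ₗ[k] Family K :=
  LinearMap.pi (fun n => (u.f n).hom.comp (totι A a n))

lemma totFam_mem {A : BCh k} {K : Ch k} (u : Tot.obj A ⟶ K) (a : ℕ × ℤ) (n : ℤ)
    (h : (a.1 : ℤ) + a.2 = n) (x : A.X a) : totFam u a x ∈ famAt K n := fun m hm => by
  refine (congr_arg (fun f => (u.f m).hom (f x)) (totι_eq_zero A a m (by lia))).trans ?_
  exact map_zero _

lemma famD_totFam {A : BCh k} {K : Ch k} (u : Tot.obj A ⟶ K) (a : ℕ × ℤ) (x : A.X a) :
    famD K (totFam u a x) = totFam u (a.1, a.2 - 1) ((A.dv a _).hom x) +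
      totFam u (a.1 - 1, a.2) ((A.dh a _).hom x) := by
  ext m
  refine (f_d_apply u (m + 1) m (totι A a (m + 1) x)).symm.trans ?_
  refine (congr_arg (u.f m).hom (totD_totι A a (m + 1) m rfl x)).trans ?_
  exact map_add (u.f m).hom _ _

/-- The adjunct of a morphism from a total complex. -/
noncomputable def toCoTot {A : BCh k} {K : Ch k} (u : Tot.obj A ⟶ K) : A ⟶ coTot K where
  f a := ModuleCat.ofHom (LinearMap.codRestrict (coTotX K a)
    ((totFam u a).prod ((totFam u (a.1, a.2 - 1)).comp (A.dv a (a.1, a.2 - 1)).hom))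
    (fun x => ⟨totFam_mem u a _ rfl x, totFam_mem u _ _ (by dsimp; ring) _, fun h => by
      obtain ⟨p, q⟩ := a
      dsimp only at h
      subst h
      refine Eq.symm ((famD_totFam u (0, q) x).trans ?_)
      rw [dh_zero]
      exact (congr_arg _ (map_zero _)).trans (add_zero _)⟩))
  comm_h i j := by
    by_cases h : j.1 + 1 = i.1 ∧ j.2 = i.2
    · ext1
      refine LinearMap.ext (fun x => Subtype.ext ?_)
      refine (coTot_dh_coe K i j h _).trans ?_
      obtain ⟨p, q⟩ := j
      obtain ⟨p', q'⟩ := i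
      obtain ⟨h1, h2⟩ := h
      dsimp only at h1 h2
      subst h1 h2
      obtain ⟨q, rfl⟩ : ∃ q', q = q' + 1 := ⟨q - 1, by ring⟩
      have e : q + 1 - 1 = q := by ring
      have h3 : famD K (totFam u (p + 1, q + 1) x) = totFam u (p + 1, q)
          ((A.dv (p + 1, q + 1) (p + 1, q)).hom x) +
          totFam u (p, q + 1) ((A.dh (p + 1, q + 1) (p, q + 1)).hom x) := by
        have := famD_totFam u (p + 1, q + 1) x
        dsimp only at this
        rw [e] at this
        exact this
      have h4 : famD K (totFam u (p + 1, q) ((A.dv (p + 1, q + 1) (p + 1, q)).hom x)) =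
          totFam u (p, q) ((A.dh (p + 1, q) (p, q)).hom
            ((A.dv (p + 1, q + 1) (p + 1, q)).hom x)) := by
        rw [famD_totFam, dv_dv_apply, map_zero, zero_add]
        rfl
      change (famD K (totFam u (p + 1, q + 1) x) - totFam u (p + 1, q + 1 - 1)
          ((A.dv (p + 1, q + 1) (p + 1, q + 1 - 1)).hom x), - famD K (totFam u (p + 1, q + 1 - 1)
          ((A.dv (p + 1, q + 1) (p + 1, q + 1 - 1)).hom x))) =
          (totFam u (p, q + 1) ((A.dh (p + 1, q + 1) (p, q + 1)).hom x),
            totFam u (p, q + 1 - 1) ((A.dv (p, q + 1) (p, q + 1 - 1)).hom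
              ((A.dh (p + 1, q + 1) (p, q + 1)).hom x)))
      rw [e, h3, h4, dv_dh_apply _ _ _ _ _ rfl, map_neg]
      congr 1
      abel
    · rw [dh_shape _ _ _ h, dh_shape _ _ _ h]
      exact comp_zero.trans zero_comp.symm
  comm_v i j := by
    by_cases h : j.1 = i.1 ∧ j.2 + 1 = i.2
    · ext1
      refine LinearMap.ext (fun x => Subtype.ext ?_)
      refine (coTot_dv_coe K i j h _).trans ?_
      obtain ⟨p, q⟩ := j
      obtain ⟨p', q'⟩ := i
      obtain ⟨h1, h2⟩ := h
      dsimp only at h1 h2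
      subst h1 h2
      have e : q + 1 - 1 = q := by ring
      change (totFam u (p, q + 1 - 1) ((A.dv (p, q + 1) (p, q + 1 - 1)).hom x), (0 : Family K)) =
        (totFam u (p, q) ((A.dv (p, q + 1) (p, q)).hom x), totFam u (p, q - 1)
          ((A.dv (p, q) (p, q - 1)).hom ((A.dv (p, q + 1) (p, q)).hom x)))
      rw [e, dv_dv_apply, map_zero]
    · rw [dv_shape _ _ _ h, dv_shape _ _ _ h]
      exact comp_zero.trans zero_comp.symm

/-- The components of the morphism from a total complex attached to a morphism to `coTot`. -/
noncomputable def ofCoTotX {A : BCh k} {K : Ch k} (l : A ⟶ coTot K) (n : ℤ) :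
    ModuleCat.of k (DirectSum ℕ (fun p => A.X (p, n - p))) ⟶ K.X n :=
  ModuleCat.ofHom (DirectSum.toModule k ℕ _ (fun p => (((LinearMap.proj n).comp
    (LinearMap.fst k (Family K) (Family K))).comp (coTotX K (p, n - p)).subtype).comp
      (l.f (p, n - p)).hom))

lemma ofCoTotX_lof {A : BCh k} {K : Ch k} (l : A ⟶ coTot K) (n : ℤ) (p : ℕ)
    (x : A.X (p, n - p)) :
    (ofCoTotX l n).hom (DirectSum.lof k ℕ (fun p => A.X (p, n - p)) p x) =
      ((l.f (p, n - p)).hom x : coTotX K (p, n - p)).1.1 n :=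
  DirectSum.toModule_lof _ _ _

/-- The morphism from a total complex attached to a morphism to `coTot`. -/
noncomputable def ofCoTot {A : BCh k} {K : Ch k} (l : A ⟶ coTot K) : Tot.obj A ⟶ K where
  f := ofCoTotX l
  comm' := by
    rintro _ m rfl
    ext1
    apply DirectSum.linearMap_ext
    intro p
    refine LinearMap.ext (fun x => ?_)
    refine (congr_arg (K.d (m + 1) m).hom (ofCoTotX_lof l (m + 1) p x)).trans ?_
    refine Eq.trans ?_ (congr_arg (ofCoTotX l m).hom (totD_lof A (m + 1) m p x)).symm
    refine Eq.trans ?_ (map_add (ofCoTotX l m).hom _ _).symm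
    rw [ofCoTotX_lof, ofCoTotX_lof]
    let z : coTotX K (p, m + 1 - p) := (l.f _).hom x
    have h1 : ((l.f (p, m - p)).hom ((A.dv (p, m + 1 - p) (p, m - p)).hom x) :
        coTotX K (p, m - p)).1.1 = z.1.2 := by
      rw [f_dv_apply]
      exact congr_arg Prod.fst (coTot_dv_coe K (p, m + 1 - p) (p, m - p) ⟨rfl, by dsimp; ring⟩ z)
    rw [h1]
    -- In column 0 compatibility with d is the constraint defining `coTotX`; in positive columns it
    -- is the identity d z₁ = z₂ + (d z₁ - z₂).
    rcases p with _ | p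
    · rw [dh_zero]
      refine (congr_fun (z.2.2.2 rfl) m).symm.trans ((add_zero _).symm.trans ?_)
      refine congr_arg (_ + ·) ?_
      exact congr_arg (fun y : coTotX K (0 - 1, m - ((0 - 1 : ℕ) : ℤ)) => y.1.1 m)
        (map_zero (l.f (0 - 1, m - ((0 - 1 : ℕ) : ℤ))).hom).symm
    · have h2 : ((l.f (p, m - p)).hom ((A.dh (p + 1, m + 1 - (p + 1 : ℕ)) (p, m - p)).hom x) :
          coTotX K (p, m - p)).1.1 = famD K z.1.1 - z.1.2 := by
        rw [f_dh_apply]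
        exact congr_arg Prod.fst (coTot_dh_coe K (p + 1, m + 1 - (p + 1 : ℕ)) (p, m - p)
          ⟨rfl, by dsimp; push_cast; ring⟩ z)
      refine Eq.trans ?_ (congr_arg (fun y : Family K => z.1.2 m + y m) h2).symm
      exact (add_sub_cancel _ _).symm

/-- The square is transposed by `toCoTot`, and the lift is transposed back by `ofCoTot`, which reads
off first components. -/
lemma hasLiftingProperty_tot_map {A B : BCh k} {K L : Ch k} (f : A ⟶ B) (g : K ⟶ L)
    [HasLiftingProperty f (coTotMap g)] : HasLiftingProperty (Tot.map f) g where
  sq_hasLift {u v} sq := by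
    have sq' : CommSq (toCoTot u) f (coTotMap g) (toCoTot v) := ⟨by
      have h : ∀ a (x : A.X a), famMap g (totFam u a x) = totFam v a ((f.f a).hom x) := by
        intro a x
        ext n
        refine (congr_arg (fun t => (t.f n).hom (totι A a n x)) sq.w).trans ?_
        exact congr_arg (v.f n).hom (totMap_totι f a n x)
      ext a : 1
      ext1
      refine LinearMap.ext (fun x => Subtype.ext (Prod.ext (h a x) ?_))
      refine (h _ _).trans ?_
      rw [f_dv_apply]
      rfl⟩
    refine ⟨⟨⟨ofCoTot sq'.lift, ?_, ?_⟩⟩⟩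
    · ext n : 1
      ext1
      apply DirectSum.linearMap_ext
      intro p
      refine LinearMap.ext (fun x => ?_)
      refine (congr_arg (ofCoTotX sq'.lift n).hom (totMap_lof f n p x)).trans ?_
      refine (ofCoTotX_lof _ _ _ _).trans ?_
      refine (congr_arg (fun t => (((t.f (p, n - p)).hom x : coTotX K (p, n - p)).1.1 n))
        sq'.fac_left).trans ?_
      exact congr_arg (u.f n).hom (totι_self A p n x)
    · ext n : 1
      ext1
      apply DirectSum.linearMap_ext
      intro p
      refine LinearMap.ext (fun x => ?_)
      refine (congr_arg (g.f n).hom (ofCoTotX_lof sq'.lift n p x)).trans ?_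
      refine (congr_arg (fun t => (((t.f (p, n - p)).hom x : coTotX L (p, n - p)).1.1 n))
        sq'.fac_right).trans ?_
      exact congr_arg (v.f n).hom (totι_self B p n x)

end coTot

end BCh

/-! ### Recognition of cofibrantly generated model structures -/

namespace CategoryTheory.IsGrothendieckAbelian

open MorphismProperty

variable {C : Type*} [Category* C] [Abelian C] [IsGrothendieckAbelian.{u} C]

/-- A cofibrantly generated model structure on a Grothendieck abelian category. -/
@[reducible]
noncomputable def modelCategory (W I J : MorphismProperty C) [W.HasTwoOutOfThreeProperty]
    [IsSmall.{u} I] [IsSmall.{u} J] (hI : I ≤ monomorphisms C) (hJ : J ≤ monomorphisms C)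
    (hIJ : I.rlp = J.rlp ⊓ W) (hW : J.rlp.llp ≤ W) : ModelCategory C :=
  have := hasSmallObjectArgument I hI
  have := hasSmallObjectArgument J hJ
  -- Retract argument: factor f as a map in J.rlp.llp followed by p in J.rlp. If f is in W then so
  -- is p by two-out-of-three, so p lies in I.rlp and f lifts against it; thus f is a retract of the
  -- first factor.
  have h1 : J.rlp.llp = I.rlp.llp ⊓ W := by
    refine le_antisymm (le_inf (antitone_llp (hIJ.trans_le inf_le_left)) hW) ?_
    rintro A B f ⟨hf, hf'⟩
    have h := factorizationData J.rlp.llp J.rlp f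
    have hp : I.rlp h.p := by
      rw [hIJ]
      exact ⟨h.hp, W.of_precomp _ _ (hW _ h.hi) (by rw [h.fac]; exact hf')⟩
    have : HasLiftingProperty f h.p := hf _ hp
    exact of_retract (RetractArrow.ofLeftLiftingProperty h.fac) h.hi
  letI : CategoryWithFibrations C := ⟨J.rlp⟩
  letI : CategoryWithCofibrations C := ⟨I.rlp.llp⟩
  letI : CategoryWithWeakEquivalences C := ⟨W⟩
  have : (weakEquivalences C).HasTwoOutOfThreeProperty := ‹_›
  have h2 : cofibrations C = I.rlp.llp := rfl
  have h3 : trivialFibrations C = I.rlp := hIJ.symm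
  have h4 : trivialCofibrations C = J.rlp.llp := h1.symm
  have h5 : fibrations C = J.rlp := rfl
  have : IsWeakFactorizationSystem (cofibrations C) (trivialFibrations C) := by
    rw [h2, h3]
    exact IsWeakFactorizationSystem.mk' _ _ (fun i p hi hp => hi _ hp)
  have : IsWeakFactorizationSystem (trivialCofibrations C) (fibrations C) := by
    rw [h4, h5]
    exact IsWeakFactorizationSystem.mk' _ _ (fun i p hi hp => hi _ hp)
  ModelCategory.mk' C

variable (W I J : MorphismProperty C) [W.HasTwoOutOfThreeProperty]
    [IsSmall.{u} I] [IsSmall.{u} J] (hI : I ≤ monomorphisms C) (hJ : J ≤ monomorphisms C)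
    (hIJ : I.rlp = J.rlp ⊓ W) (hW : J.rlp.llp ≤ W)

lemma modelCategory_cofibration_and_weakEquivalence_iff {A B : C} (f : A ⟶ B) :
    letI := modelCategory W I J hI hJ hIJ hW
    Cofibration f ∧ WeakEquivalence f ↔ J.rlp.llp f :=
  letI := modelCategory W I J hI hJ hIJ hW
  (mem_trivialCofibrations_iff f).symm.trans
    (by rw [← llp_eq_of_wfs (trivialCofibrations C) (fibrations C)]; rfl)

end CategoryTheory.IsGrothendieckAbelian

/-! ### The total model structure -/

namespace BCh

open MorphismProperty

variable (k : Type u) [CommRing k]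

/-- The generating cofibrations. -/
noncomputable def cofGen : MorphismProperty (BCh k) :=
  ofHoms (fun i : ℕ × ℤ => cellIncl k i.1 i.2)

/-- The sources of the generating trivial cofibrations. -/
noncomputable def trivSource : ℕ → ℤ → BCh k
  | 0, _ => 0
  | p + 1, q => cell k (p + 1) q False

/-- The generating trivial cofibrations. -/
noncomputable def trivIncl : ∀ (p : ℕ) (q : ℤ), trivSource k p q ⟶ cell k p q True
  | 0, q => (0 : 0 ⟶ cell k 0 q True)
  | p + 1, q => cellIncl k (p + 1) q

/-- The set of generating trivial cofibrations. -/
noncomputable def trivGen : MorphismProperty (BCh k) :=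
  ofHoms (fun i : ℕ × ℤ => trivIncl k i.1 i.2)

instance : IsSmall.{u} (cofGen k) := isSmall_ofHoms _

instance : IsSmall.{u} (trivGen k) := isSmall_ofHoms _

lemma cofGen_le : cofGen k ≤ monomorphisms (BCh k) := by
  rintro _ _ _ ⟨i⟩
  exact monomorphisms.infer_property _

lemma trivGen_le : trivGen k ≤ monomorphisms (BCh k) := by
  rintro _ _ _ ⟨⟨_ | p, q⟩⟩
  · exact ⟨fun _ _ _ => (isZero_zero _).eq_of_tgt _ _⟩
  · exact monomorphisms.infer_property (cellIncl k (p + 1) q)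

/-- The weak equivalences of the total model structure. -/
def totWeq : MorphismProperty (BCh k) := fun _ _ f => QuasiIso (Tot.map f)

lemma totWeq_eq : totWeq k =
    (HomologicalComplex.quasiIso (ModuleCat.{u} k) (ComplexShape.down ℤ)).inverseImage Tot := rfl

instance : (totWeq k).HasTwoOutOfThreeProperty := by
  rw [totWeq_eq]
  infer_instance

variable {k}

lemma cofGen_rlp_iff {E F : BCh k} (f : E ⟶ F) :
    (cofGen k).rlp f ↔ ∀ p q, ColLift f p q := by
  constructor
  · intro h p q
    exact (hasLiftingProperty_cellIncl_iff f p q).1 (h _ ⟨(p, q)⟩)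
  · rintro h _ _ _ ⟨⟨p, q⟩⟩
    exact (hasLiftingProperty_cellIncl_iff f p q).2 (h p q)

lemma hasLiftingProperty_zero_iff {E F : BCh k} (f : E ⟶ F) (p : ℕ) (q : ℤ) :
    HasLiftingProperty (0 : 0 ⟶ cell k p q True) f ↔
      Function.Surjective (f.f (p, q + 1)).hom := by
  constructor
  · intro h y
    have sq : CommSq 0 (0 : 0 ⟶ cell k p q True) f (freeHom y) :=
      ⟨(isZero_zero _).eq_of_src _ _⟩
    refine ⟨(sq.lift.f _).hom (freeGen k p q), ?_⟩
    rw [← comp_f_apply, sq.fac_right, freeHom_gen]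
  · intro h
    refine ⟨fun {u v} sq => ?_⟩
    obtain ⟨e, he⟩ := h ((v.f _).hom (freeGen k p q))
    refine ⟨⟨⟨freeHom e, (isZero_zero _).eq_of_src _ _, free_hom_ext ?_⟩⟩⟩
    rw [comp_f_apply, freeHom_gen, he]

lemma trivGen_rlp_iff_colLift {E F : BCh k} (f : E ⟶ F) :
    (trivGen k).rlp f ↔ (∀ p q, p ≠ 0 → ColLift f p q) ∧
      ∀ q, Function.Surjective (f.f (0, q)).hom := by
  constructor
  · intro h
    constructor
    · intro p q hp
      obtain ⟨p, rfl⟩ := Nat.exists_eq_succ_of_ne_zero hp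
      exact (hasLiftingProperty_cellIncl_iff f (p + 1) q).1 (h _ ⟨(p + 1, q)⟩)
    · intro q
      obtain ⟨q, rfl⟩ : ∃ q', q = q' + 1 := ⟨q - 1, by ring⟩
      exact (hasLiftingProperty_zero_iff f 0 q).1 (h (trivIncl k 0 q) ⟨(0, q)⟩)
  · rintro ⟨h1, h2⟩ _ _ _ ⟨⟨_ | p, q⟩⟩
    · exact (hasLiftingProperty_zero_iff f 0 q).2 (h2 _)
    · exact (hasLiftingProperty_cellIncl_iff f (p + 1) q).2 (h1 _ _ (Nat.succ_ne_zero p))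

/-- In positive columns the generators are all the cell inclusions and impose a surjective
quasi-isomorphism; in column 0 the maps from zero to free cells impose surjectivity only. -/
lemma trivGen_rlp_iff {E F : BCh k} (f : E ⟶ F) :
    (trivGen k).rlp f ↔ (∀ i, Function.Surjective (f.f i).hom) ∧
      ∀ p : ℕ, 0 < p → QuasiIso ((column p).map f) := by
  rw [trivGen_rlp_iff_colLift]
  constructor
  · rintro ⟨h1, h2⟩
    refine ⟨?_, fun p hp => ((forall_colLift_iff f p).1 (fun q => h1 p q hp.ne')).2⟩
    rintro ⟨_ | p, q⟩
    · exact h2 q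
    · exact ((forall_colLift_iff f (p + 1)).1 (fun q => h1 _ q (Nat.succ_ne_zero p))).1 q
  · rintro ⟨h1, h2⟩
    exact ⟨fun p q hp => (forall_colLift_iff f p).2 ⟨fun q => h1 _, h2 p (Nat.pos_of_ne_zero hp)⟩ q,
      fun q => h1 _⟩

lemma colKerAcyclic_of_quasiIso {E F : BCh k} (f : E ⟶ F)
    (h1 : ∀ i, Function.Surjective (f.f i).hom)
    (h2 : ∀ p : ℕ, 0 < p → QuasiIso ((column p).map f)) (p : ℕ) (hp : p ≠ 0) :
    ColKerAcyclic f p :=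
  (quasiIso_column_iff f p (fun q => h1 _)).1 (h2 p (Nat.pos_of_ne_zero hp))

variable (k)

/-- The two classes differ in the condition on column 0 versus the condition on Tot, and
`quasiIso_tot_map_iff` exchanges these for a fibration. -/
lemma cofGen_rlp : (cofGen k).rlp = (trivGen k).rlp ⊓ totWeq k := by
  ext E F f
  rw [cofGen_rlp_iff]
  refine Iff.trans ?_ (and_congr_left' (trivGen_rlp_iff f)).symm
  constructor
  · intro h
    have h' := fun p => (forall_colLift_iff f p).1 (h p)
    have h1 : ∀ i, Function.Surjective (f.f i).hom := fun i => (h' i.1).1 i.2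
    have h2 : ∀ p : ℕ, 0 < p → QuasiIso ((column p).map f) := fun p _ => (h' p).2
    exact ⟨⟨h1, h2⟩, (quasiIso_tot_map_iff f h1 (colKerAcyclic_of_quasiIso f h1 h2)).2
      ((quasiIso_column_iff f 0 (fun q => h1 _)).1 (h' 0).2)⟩
  · rintro ⟨⟨h1, h2⟩, h3⟩ p
    refine (forall_colLift_iff f p).2 ⟨fun q => h1 _, ?_⟩
    rcases p with _ | p
    · exact (quasiIso_column_iff f 0 (fun q => h1 _)).2
        ((quasiIso_tot_map_iff f h1 (colKerAcyclic_of_quasiIso f h1 h2)).1 h3)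
    · exact h2 _ (Nat.succ_pos p)

lemma coTotMap_mem {K L : Ch k} (g : K ⟶ L) (hg : ∀ n, Function.Surjective (g.f n).hom) :
    (trivGen k).rlp (coTotMap g) := by
  rw [trivGen_rlp_iff]
  refine ⟨coTotMap_surjective g hg, fun p hp => ?_⟩
  rw [quasiIso_column_iff _ _ (fun q => coTotMap_surjective g hg _)]
  exact colKerAcyclic_coTotMap g p hp.ne'

/-- Such a map f lifts against `coTotMap g` for every surjection g, so Tot f lifts against every
surjection, and a chain map with that property is a quasi-isomorphism. -/
lemma trivGen_rlp_llp_le : (trivGen k).rlp.llp ≤ totWeq k := by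
  intro A B f hf
  refine Ch.quasiIso_of_llp _ (fun g hg => ?_)
  have : HasLiftingProperty f (coTotMap g) := hf _ (coTotMap_mem k g hg)
  exact hasLiftingProperty_tot_map f g

/-- The total model structure on bicomplexes. -/
@[reducible]
noncomputable def totModel : ModelCategory (BCh k) :=
  IsGrothendieckAbelian.modelCategory (totWeq k) (cofGen k) (trivGen k) (cofGen_le k)
    (trivGen_le k) (cofGen_rlp k) (trivGen_rlp_llp_le k)

lemma isTotalModelStructure_totModel : IsTotalModelStructure (totModel k) :=
  letI := totModel k
  { weakEquivalence_iff := fun f => weakEquivalence_iff f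
    fibration_iff := fun f => (fibration_iff f).trans (trivGen_rlp_iff f) }

end BCh

/-! ### The inclusion of chain complexes and its adjoint -/

namespace BCh

open MorphismProperty

section adjunction

variable {k : Type u} [CommRing k]

/-- The components of the morphism from a complex in horizontal degree zero. -/
def ofColumnX {K : Ch k} {A : BCh k} (u : K ⟶ (column 0).obj A) : ∀ i, inclX K i ⟶ A.X i
  | (0, q) => u.f q
  | (_ + 1, _) => 0

/-- The morphism from a complex in horizontal degree zero attached to a chain map. -/
def ofColumn {K : Ch k} {A : BCh k} (u : K ⟶ (column 0).obj A) : (incl k).obj K ⟶ A where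
  f := ofColumnX u
  comm_h := by
    rintro ⟨_ | p, q⟩ j
    · rw [dh_zero]
      exact comp_zero.trans zero_comp.symm
    · exact zero_comp.trans zero_comp.symm
  comm_v := by
    rintro ⟨_ | p, q⟩ ⟨_ | p', q'⟩
    · exact u.comm q q'
    · rw [dv_eq_zero A _ _ _ _ (by lia)]
      exact comp_zero.trans zero_comp.symm
    · exact zero_comp.trans zero_comp.symm
    · exact zero_comp.trans zero_comp.symm

/-- The chain map attached to a morphism from a complex in horizontal degree zero. -/
def toColumn {K : Ch k} {A : BCh k} (φ : (incl k).obj K ⟶ A) : K ⟶ (column 0).obj A where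
  f q := φ.f (0, q)
  comm' q r _ := φ.comm_v (0, q) (0, r)

lemma incl_hom_ext {K : Ch k} {A : BCh k} {φ ψ : (incl k).obj K ⟶ A}
    (h : ∀ q, φ.f (0, q) = ψ.f (0, q)) : φ = ψ := by
  ext ⟨_ | p, q⟩ x
  · exact congr_arg (fun f => f.hom x) (h q)
  · obtain rfl : x = 0 := Subsingleton.elim (α := PUnit) _ _
    exact (map_zero _).trans (map_zero _).symm

lemma hom_incl_ext {K : Ch k} {A : BCh k} {φ ψ : A ⟶ (incl k).obj K}
    (h : ∀ q, φ.f (0, q) = ψ.f (0, q)) : φ = ψ := by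
  ext ⟨_ | p, q⟩ x
  · exact congr_arg (fun f => f.hom x) (h q)
  · exact Subsingleton.elim (α := PUnit) _ _

variable (k) in
/-- The inclusion of complexes in horizontal degree zero is left adjoint to the column of
horizontal degree zero. -/
def inclAdj : incl k ⊣ column 0 :=
  Adjunction.mkOfHomEquiv
    { homEquiv := fun K A =>
        { toFun := toColumn
          invFun := ofColumn
          left_inv := fun φ => incl_hom_ext (fun q => rfl)
          right_inv := fun u => by
            ext q : 1
            rfl }
      homEquiv_naturality_left_symm := fun f g => incl_hom_ext (fun q => rfl)
      homEquiv_naturality_right := fun f g => by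
        ext q : 1
        rfl }

lemma inclAdj_homEquiv {K : Ch k} {A : BCh k} (φ : (incl k).obj K ⟶ A) :
    (inclAdj k).homEquiv K A φ = toColumn φ := by
  simp [inclAdj]

/-- The morphism to a complex in horizontal degree zero, from a bicomplex which is zero in
horizontal degree one. -/
def toInclX {K : Ch k} {A : BCh k} (u : (column 0).obj A ⟶ K) : ∀ i, A.X i ⟶ inclX K i
  | (0, q) => u.f q
  | (_ + 1, _) => 0

/-- The morphism to a complex in horizontal degree zero, from a bicomplex which is zero in
horizontal degree one. -/
def toIncl {K : Ch k} {A : BCh k} (hA : ∀ q, IsZero (A.X (1, q))) (u : (column 0).obj A ⟶ K) :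
    A ⟶ (incl k).obj K where
  f := toInclX u
  comm_h := by
    rintro ⟨p, q⟩ ⟨_ | p', q'⟩
    · refine comp_zero.trans (Eq.symm ?_)
      -- The only horizontal differentials entering column 0 start in column 1; the vanishing of
      -- that column is what allows extension by zero.
      by_cases h : p = 1
      · subst h
        exact (hA q).eq_of_src _ _
      · rw [dh_eq_zero A _ _ _ _ (by lia)]
        exact zero_comp
    · exact comp_zero.trans comp_zero.symm
  comm_v := by
    rintro ⟨_ | p, q⟩ ⟨_ | p', q'⟩
    · exact u.comm q q'
    · exact comp_zero.trans comp_zero.symm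
    · rw [dv_eq_zero A _ _ _ _ (by lia)]
      exact comp_zero.trans zero_comp.symm
    · exact comp_zero.trans comp_zero.symm

/-- On bicomplexes that vanish in horizontal degree 1, taking column 0 behaves like a left adjoint
of the inclusion. This turns lifting in Ch against column 0 of a cell into lifting already computed
for bicomplexes. -/
lemma hasLiftingProperty_column_map_iff {A B : BCh k} (i : A ⟶ B)
    (hA : ∀ q, IsZero (A.X (1, q))) (hB : ∀ q, IsZero (B.X (1, q))) {K L : Ch k} (g : K ⟶ L) :
    HasLiftingProperty ((column 0).map i) g ↔ HasLiftingProperty i ((incl k).map g) := by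
  constructor
  · intro h
    refine ⟨fun {u v} sq => ?_⟩
    have sq' : CommSq ((column 0).map u) ((column 0).map i) g ((column 0).map v) :=
      ⟨congr_arg (column 0).map sq.w⟩
    obtain ⟨⟨l, h1, h2⟩⟩ := (h.sq_hasLift sq').exists_lift
    exact ⟨⟨⟨toIncl hB l, hom_incl_ext (fun q => congr_arg (fun t => t.f q) h1),
      hom_incl_ext (fun q => congr_arg (fun t => t.f q) h2)⟩⟩⟩
  · intro h
    refine ⟨fun {u v} sq => ?_⟩
    have sq' : CommSq (toIncl hA u) i ((incl k).map g) (toIncl hB v) :=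
      ⟨hom_incl_ext (fun q => congr_arg (fun t => t.f q) sq.w)⟩
    refine ⟨⟨⟨(column 0).map sq'.lift, ?_, ?_⟩⟩⟩
    · ext q : 1
      exact congr_arg (fun t => t.f (0, q)) sq'.fac_left
    · ext q : 1
      exact congr_arg (fun t => t.f (0, q)) sq'.fac_right

lemma isZero_cell (q r : ℤ) (b : Prop) : IsZero ((cell k 0 q b).X (1, r)) := by
  have : Subsingleton ((cell k 0 q b).X (1, r)) := ⟨fun x y => by
    have h : ¬ cellSupp 0 q b (1, r) := fun h => by
      have := h.1
      dsimp only at this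
      lia
    rw [cell_elt_eq_zero _ _ _ _ h x, cell_elt_eq_zero _ _ _ _ h y]⟩
  exact ModuleCat.isZero_of_subsingleton _

lemma isZero_trivSource (q : ℤ) (i : ℕ × ℤ) : IsZero ((trivSource k 0 q).X i) := by
  have h : IsZero (trivSource k 0 q) := isZero_zero _
  rw [IsZero.iff_id_eq_zero]
  exact congr_arg (fun t => t.f i) (h.eq_of_src (𝟙 (trivSource k 0 q)) 0)

lemma colLift_incl_map {K L : Ch k} (g : K ⟶ L) (p : ℕ) (hp : p ≠ 0) (q : ℤ) :
    ColLift ((incl k).map g) p q := by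
  obtain ⟨p, rfl⟩ := Nat.exists_eq_succ_of_ne_zero hp
  exact fun _ _ _ _ => ⟨0, Subsingleton.elim (α := PUnit) _ _, Subsingleton.elim (α := PUnit) _ _⟩

lemma colLift_incl_map_zero {K L : Ch k} (g : K ⟶ L) :
    (∀ q, ColLift ((incl k).map g) 0 q) ↔
      (∀ q, Function.Surjective (g.f q).hom) ∧ QuasiIso g :=
  forall_colLift_iff ((incl k).map g) 0

lemma colKerAcyclic_incl (K : Ch k) (p : ℕ) (hp : p ≠ 0) :
    ColKerAcyclic (0 : (incl k).obj K ⟶ (incl k).obj K) p := by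
  obtain ⟨p, rfl⟩ := Nat.exists_eq_succ_of_ne_zero hp
  exact fun _ _ _ _ => ⟨0, Subsingleton.elim (α := PUnit) _ _, Subsingleton.elim (α := PUnit) _ _⟩

/-- Naturality of `colTot`, which is a quasi-isomorphism at both ends, and two-out-of-three. -/
lemma quasiIso_tot_map_iff_column {A B : BCh k} (φ : A ⟶ B)
    (hA : ∀ p, p ≠ 0 → ColKerAcyclic (0 : A ⟶ A) p)
    (hB : ∀ p, p ≠ 0 → ColKerAcyclic (0 : B ⟶ B) p) :
    QuasiIso (Tot.map φ) ↔ QuasiIso ((column 0).map φ) := by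
  have := quasiIso_colTot A hA
  have := quasiIso_colTot B hB
  rw [← quasiIso_iff_comp_left (colTot A) (Tot.map φ), colTot_naturality,
    quasiIso_iff_comp_right]

lemma quasiIso_tot_incl_map_iff {K L : Ch k} (g : K ⟶ L) :
    QuasiIso (Tot.map ((incl k).map g)) ↔ QuasiIso g :=
  quasiIso_tot_map_iff_column _ (colKerAcyclic_incl K) (colKerAcyclic_incl L)

end adjunction

end BCh

/-! ### The projective model structure -/

namespace Ch

open MorphismProperty BCh

variable (k : Type u) [CommRing k]

/-- The generating cofibrations. -/
noncomputable def cofGen : MorphismProperty (Ch k) :=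
  ofHoms (fun q : ℤ => (column 0).map (cellIncl k 0 q))

/-- The set of generating trivial cofibrations. -/
noncomputable def trivGen : MorphismProperty (Ch k) :=
  ofHoms (fun q : ℤ => (column 0).map (trivIncl k 0 q))

instance : IsSmall.{u} (cofGen k) := isSmall_ofHoms _

instance : IsSmall.{u} (trivGen k) := isSmall_ofHoms _

lemma mono_column_map {A B : BCh k} (φ : A ⟶ B) [Mono φ] : Mono ((column 0).map φ) := by
  have : (column 0 : BCh k ⥤ Ch k).IsRightAdjoint := (inclAdj k).isRightAdjoint
  infer_instance

lemma cofGen_le : cofGen k ≤ monomorphisms (Ch k) := by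
  rintro _ _ _ ⟨q⟩
  exact mono_column_map k _

lemma trivGen_le : trivGen k ≤ monomorphisms (Ch k) := by
  rintro _ _ _ ⟨q⟩
  have : Mono (trivIncl k 0 q) := BCh.trivGen_le k _ ⟨(0, q)⟩
  exact mono_column_map k _

variable {k}

/-- The generators come from cells with p = 0, which vanish in horizontal degree 1, so the question
reduces to the map `incl` g and its column 0. -/
lemma cofGen_rlp_iff {K L : Ch k} (g : K ⟶ L) :
    (cofGen k).rlp g ↔ (∀ q, Function.Surjective (g.f q).hom) ∧ QuasiIso g := by
  rw [← colLift_incl_map_zero]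
  constructor
  · intro h q
    rw [← hasLiftingProperty_cellIncl_iff, ← hasLiftingProperty_column_map_iff _
      (fun r => isZero_cell q r _) (fun r => isZero_cell q r _)]
    exact h _ ⟨q⟩
  · rintro h _ _ _ ⟨q⟩
    rw [hasLiftingProperty_column_map_iff _ (fun r => isZero_cell q r _)
      (fun r => isZero_cell q r _), hasLiftingProperty_cellIncl_iff]
    exact h q

lemma trivGen_rlp_iff {K L : Ch k} (g : K ⟶ L) :
    (trivGen k).rlp g ↔ ∀ q, Function.Surjective (g.f q).hom := by
  have key : ∀ q, HasLiftingProperty ((column 0).map (trivIncl k 0 q)) g ↔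
      Function.Surjective (g.f (q + 1)).hom := fun q => by
    rw [hasLiftingProperty_column_map_iff _ (fun r => isZero_trivSource q _)
      (fun r => isZero_cell q r _)]
    exact hasLiftingProperty_zero_iff ((incl k).map g) 0 q
  constructor
  · intro h q
    obtain ⟨q, rfl⟩ : ∃ q', q = q' + 1 := ⟨q - 1, by ring⟩
    exact (key q).1 (h _ ⟨q⟩)
  · rintro h _ _ _ ⟨q⟩
    exact (key q).2 (h _)

variable (k)

lemma cofGen_rlp : (cofGen k).rlp = (trivGen k).rlp ⊓
    HomologicalComplex.quasiIso (ModuleCat.{u} k) (ComplexShape.down ℤ) := by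
  ext K L g
  rw [cofGen_rlp_iff]
  exact (and_congr_left' (trivGen_rlp_iff g)).symm

lemma trivGen_rlp_llp_le : (trivGen k).rlp.llp ≤
    HomologicalComplex.quasiIso (ModuleCat.{u} k) (ComplexShape.down ℤ) := fun A B f hf =>
  quasiIso_of_llp f (fun g hg => hf _ ((trivGen_rlp_iff g).2 hg))

/-- The projective model structure on chain complexes. -/
@[reducible]
noncomputable def projModel : ModelCategory (Ch k) :=
  IsGrothendieckAbelian.modelCategory
    (HomologicalComplex.quasiIso (ModuleCat.{u} k) (ComplexShape.down ℤ)) (cofGen k) (trivGen k)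
    (cofGen_le k) (trivGen_le k) (cofGen_rlp k) (trivGen_rlp_llp_le k)

lemma isProjectiveModelStructure_projModel : IsProjectiveModelStructure (projModel k) :=
  letI := projModel k
  { weakEquivalence_iff := fun f => weakEquivalence_iff f
    fibration_iff := fun f => (fibration_iff f).trans (trivGen_rlp_iff f) }

end Ch

/-! ### The Quillen equivalence -/

namespace BCh

open MorphismProperty

variable (k : Type u) [CommRing k]

/-- By adjunction it suffices that column 0 of a trivial fibration is a surjective
quasi-isomorphism. -/
lemma cofGen_rlp_llp_incl_map {K L : Ch k} (f : K ⟶ L) (hf : (Ch.cofGen k).rlp.llp f) :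
    (cofGen k).rlp.llp ((incl k).map f) := by
  intro A B g hg
  rw [(inclAdj k).hasLiftingProperty_iff]
  refine hf _ ((Ch.cofGen_rlp_iff _).2 ?_)
  exact (forall_colLift_iff g 0).1 ((cofGen_rlp_iff g).1 hg 0)

lemma trivGen_rlp_llp_incl_map {K L : Ch k} (f : K ⟶ L) (hf : (Ch.trivGen k).rlp.llp f) :
    (trivGen k).rlp.llp ((incl k).map f) := by
  intro A B g hg
  rw [(inclAdj k).hasLiftingProperty_iff]
  exact hf _ ((Ch.trivGen_rlp_iff _).2 (fun q => ((trivGen_rlp_iff g).1 hg).1 (0, q)))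

/-- The map to the terminal object is zero, so its kernel is A: fibrancy makes the columns p > 0
acyclic. -/
lemma colKerAcyclic_of_isFibrant (A : BCh k) (hA : (trivGen k).rlp (terminal.from A)) (p : ℕ)
    (hp : p ≠ 0) : ColKerAcyclic (0 : A ⟶ A) p := by
  have h := (trivGen_rlp_iff (terminal.from A)).1 hA
  have h' := colKerAcyclic_of_quasiIso _ h.1 h.2 p hp
  have e : terminal.from A = 0 := Subsingleton.elim _ _
  intro q x _ hx
  obtain ⟨w, -, hw⟩ := h' q x (by rw [e]; rfl) hx
  exact ⟨w, rfl, hw⟩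

lemma isQuillenEquivalence_inclAdj :
    letI := totModel k
    letI := Ch.projModel k
    IsQuillenEquivalence (inclAdj k) :=
  letI := totModel k
  letI := Ch.projModel k
  { cofibration_map := fun f hf => (cofibration_iff _).2
      (cofGen_rlp_llp_incl_map k f ((cofibration_iff f).1 hf))
    weakEquivalence_map := fun f _ hf => (weakEquivalence_iff _).2
      ((quasiIso_tot_incl_map_iff f).2 ((weakEquivalence_iff f).1 hf))
    -- Source and target have acyclic positive columns, so Tot f and column 0 of f, which is the
    -- adjunct, are quasi-isomorphisms simultaneously.
    weakEquivalence_iff := fun {K A} _ hA f => by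
      rw [weakEquivalence_iff, weakEquivalence_iff, inclAdj_homEquiv]
      exact quasiIso_tot_map_iff_column f (colKerAcyclic_incl K)
        (colKerAcyclic_of_isFibrant k A ((fibration_iff _).1 ((isFibrant_iff A).1 hA))) }

end BCh

/-! ### Maps out of a tensor product as bilinear pairings -/

namespace BCh

open scoped TensorProduct

variable {k : Type u} [CommRing k]

/-- The sign `(-1)^(p + q)` attached to a bidegree `a = (p, q)`. -/
abbrev sgn (a : ℕ × ℤ) : ℤˣ := totalSign (.ofAdd a)

/-- The target of the horizontal differential. -/
abbrev hdeg (a : ℕ × ℤ) : ℕ × ℤ := (a.1 - 1, a.2)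

/-- The target of the vertical differential. -/
abbrev vdeg (a : ℕ × ℤ) : ℕ × ℤ := (a.1, a.2 - 1)

lemma next_hdeg (a : ℕ × ℤ) : horizontalShape.next a = hdeg a := by
  obtain ⟨_ | p, q⟩ := a
  · exact next_h_zero q
  · exact next_h_succ p q

lemma next_vdeg (a : ℕ × ℤ) : verticalShape.next a = vdeg a := by
  obtain ⟨p, q⟩ := a
  obtain ⟨q, rfl⟩ : ∃ q', q = q' + 1 := ⟨q - 1, by ring⟩
  refine (next_v p q).trans ?_
  simp [vdeg]

lemma sgn_h (a : ℕ × ℤ) : sgn (a.1 + 1, a.2) = - sgn a := totalSign_h a.1 a.2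

lemma sgn_v (a : ℕ × ℤ) : sgn (a.1, a.2 + 1) = - sgn a := totalSign_v a.1 a.2

lemma units_smul_map {M N : Type*} [AddCommGroup M] [AddCommGroup N] [Module k M] [Module k N]
    (f : M →ₗ[k] N) (s : ℤˣ) (x : M) : f (s • x) = s • f x := by
  rcases Int.units_eq_one_or s with rfl | rfl <;> simp

lemma dh_eq_zero_of_fst (A : BCh k) (a : ℕ × ℤ) (j : ℕ × ℤ) (h : a.1 = 0) : A.dh a j = 0 := by
  obtain ⟨p, q⟩ := a
  subst h
  exact dh_zero A q j

/-- The bilinear maps corresponding to morphisms from a tensor product of bicomplexes. -/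
@[ext]
structure Pairing (W Y E : BCh k) where
  m : ∀ a b c, W.X a →ₗ[k] Y.X b →ₗ[k] E.X c
  m_zero : ∀ a b c, a + b ≠ c → m a b c = 0
  m_dh : ∀ a b c w y, (E.dh (c.1 + 1, c.2) c).hom (m a b (c.1 + 1, c.2) w y) =
    m (hdeg a) b c ((W.dh a (hdeg a)).hom w) y +
      sgn a • m a (hdeg b) c w ((Y.dh b (hdeg b)).hom y)
  m_dv : ∀ a b c w y, (E.dv (c.1, c.2 + 1) c).hom (m a b (c.1, c.2 + 1) w y) =
    m (vdeg a) b c ((W.dv a (vdeg a)).hom w) y +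
      sgn a • m a (vdeg b) c w ((Y.dv b (vdeg b)).hom y)

namespace Pairing

variable {W Y E : BCh k}

/-- The bilinear map with values in a summand of a tensor product, zero unless the bidegrees
match. -/
noncomputable def univ (W Y : BCh k) (a b c : ℕ × ℤ) : W.X a →ₗ[k] Y.X b →ₗ[k] (W ⊗ Y).X c :=
  TensorProduct.curry (tensorι W Y a b c).hom

lemma univ_apply (a b c : ℕ × ℤ) (w : W.X a) (y : Y.X b) :
    univ W Y a b c w y = (tensorι W Y a b c).hom (w ⊗ₜ y) := rfl

lemma univ_zero (a b c : ℕ × ℤ) (h : a + b ≠ c) : univ W Y a b c = 0 := by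
  rw [univ, tensorι_eq_zero W Y a b c h]
  rfl

lemma hdeg_add {a b c : ℕ × ℤ} (h : a + b ≠ (c.1 + 1, c.2)) (ha : a.1 ≠ 0) : hdeg a + b ≠ c :=
  fun h' => h (by
    have h1 := congr_arg Prod.fst h'
    have h2 := congr_arg Prod.snd h'
    ext
    · dsimp at *; lia
    · exact h2)

lemma vdeg_add {a b c : ℕ × ℤ} (h : a + b ≠ (c.1, c.2 + 1)) : vdeg a + b ≠ c :=
  fun h' => h (by
    have h1 := congr_arg Prod.fst h'
    have h2 := congr_arg Prod.snd h'
    ext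
    · exact h1
    · dsimp at *; lia)

/-- The Leibniz rule for all indices. When a + b does not match, every term vanishes; in column 0,
where `hdeg` is truncated and the degree argument fails, this is because d_h is zero there. -/
lemma univ_dh (a b c : ℕ × ℤ) (w : W.X a) (y : Y.X b) :
    ((W ⊗ Y).dh (c.1 + 1, c.2) c).hom (univ W Y a b (c.1 + 1, c.2) w y) =
    univ W Y (hdeg a) b c ((W.dh a (hdeg a)).hom w) y +
      sgn a • univ W Y a (hdeg b) c w ((Y.dh b (hdeg b)).hom y) := by
  by_cases h : a + b = (c.1 + 1, c.2)
  · exact congr_arg (fun f => f.hom (w ⊗ₜ y)) (tensorι_dh W Y a b (hdeg a) (hdeg b)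
      (c.1 + 1, c.2) c h (next_hdeg a) (next_hdeg b))
  · rw [univ_zero _ _ _ h]
    refine (map_zero _).trans (Eq.symm ((congr_arg₂ (· + ·) ?_ ?_).trans (add_zero _)))
    · by_cases ha : a.1 = 0
      · rw [dh_eq_zero_of_fst W a _ ha]
        exact congr_arg (fun f => f y) (map_zero (univ W Y (hdeg a) b c))
      · rw [univ_zero _ _ _ (hdeg_add h ha)]
        rfl
    · by_cases hb : b.1 = 0
      · rw [dh_eq_zero_of_fst Y b _ hb]
        exact (congr_arg _ (map_zero (univ W Y a (hdeg b) c w))).trans (smul_zero _)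
      · rw [univ_zero _ _ _ (fun h' => hdeg_add (by rwa [add_comm]) hb
          ((add_comm _ _).trans h'))]
        exact smul_zero _

lemma univ_dv (a b c : ℕ × ℤ) (w : W.X a) (y : Y.X b) :
    ((W ⊗ Y).dv (c.1, c.2 + 1) c).hom (univ W Y a b (c.1, c.2 + 1) w y) =
    univ W Y (vdeg a) b c ((W.dv a (vdeg a)).hom w) y +
      sgn a • univ W Y a (vdeg b) c w ((Y.dv b (vdeg b)).hom y) := by
  by_cases h : a + b = (c.1, c.2 + 1)
  · exact congr_arg (fun f => f.hom (w ⊗ₜ y)) (tensorι_dv W Y a b (vdeg a) (vdeg b)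
      (c.1, c.2 + 1) c h (next_vdeg a) (next_vdeg b))
  · rw [univ_zero _ _ _ h]
    refine (map_zero _).trans (Eq.symm ((congr_arg₂ (· + ·) ?_ ?_).trans (add_zero _)))
    · rw [univ_zero _ _ _ (vdeg_add h)]
      rfl
    · rw [univ_zero _ _ _ (fun h' => vdeg_add (by rwa [add_comm])
          ((add_comm _ _).trans h'))]
      exact smul_zero _

/-- The pairing attached to a morphism from a tensor product. -/
noncomputable def ofHom (h : W ⊗ Y ⟶ E) : Pairing W Y E where
  m a b c := (univ W Y a b c).compr₂ (h.f c).hom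
  m_zero a b c hc := by
    rw [univ_zero _ _ _ hc]
    exact LinearMap.ext (fun w => LinearMap.ext (fun y => map_zero (h.f c).hom))
  m_dh a b c w y := by
    refine (f_dh_apply h _ _ _).symm.trans ?_
    rw [univ_dh, map_add, units_smul_map]
    rfl
  m_dv a b c w y := by
    refine (f_dv_apply h _ _ _).symm.trans ?_
    rw [univ_dv, map_add, units_smul_map]
    rfl

/-- The components of the morphism from the tensor product attached to a pairing. -/
noncomputable def toHomX (P : Pairing W Y E) (c : ℕ × ℤ) : (W ⊗ Y).X c ⟶ E.X c :=
  GradedObject.Monoidal.tensorObjDesc (A := E.X c) (fun a b _ =>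
    ModuleCat.ofHom (TensorProduct.lift (P.m a b c)))

lemma toHomX_univ (P : Pairing W Y E) (a b c : ℕ × ℤ) (w : W.X a) (y : Y.X b) :
    (P.toHomX c).hom (univ W Y a b c w y) = P.m a b c w y := by
  by_cases h : a + b = c
  · refine (congr_arg (fun f => (f ≫ P.toHomX c).hom (w ⊗ₜ y)) (tensorι_eq W Y a b c h)).trans ?_
    have h' : GradedObject.Monoidal.ιTensorObj W.X Y.X a b c h ≫ P.toHomX c =
        ModuleCat.ofHom (TensorProduct.lift (P.m a b c)) :=
      GradedObject.Monoidal.ι_tensorObjDesc _ _ _ _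
    exact (congr_arg (fun f => f.hom (w ⊗ₜ y)) h').trans (TensorProduct.lift.tmul _ _)
  · rw [univ_zero _ _ _ h, P.m_zero _ _ _ h]
    exact map_zero _

lemma tensor_hom_ext {c : ℕ × ℤ} {M : ModuleCat.{u} k} {f g : (W ⊗ Y).X c ⟶ M}
    (h : ∀ a b, a + b = c → ∀ w y, f.hom (univ W Y a b c w y) = g.hom (univ W Y a b c w y)) :
    f = g := by
  apply tensorX_hom_ext
  intro a b hab
  ext1
  apply TensorProduct.ext'
  intro w y
  exact h a b hab w y

/-- The morphism from the tensor product attached to a pairing. -/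
noncomputable def toHom (P : Pairing W Y E) : W ⊗ Y ⟶ E where
  f := P.toHomX
  comm_h i j := by
    by_cases h : j.1 + 1 = i.1 ∧ j.2 = i.2
    · obtain rfl : i = (j.1 + 1, j.2) := Prod.ext h.1.symm h.2.symm
      apply tensor_hom_ext
      intro a b hab w y
      change (E.dh _ _).hom ((P.toHomX _).hom (univ W Y a b _ w y)) =
        (P.toHomX _).hom (((W ⊗ Y).dh _ _).hom (univ W Y a b _ w y))
      rw [toHomX_univ, univ_dh, map_add, units_smul_map, toHomX_univ, toHomX_univ, P.m_dh]
    · rw [dh_shape _ _ _ h, dh_shape _ _ _ h, comp_zero, zero_comp]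
  comm_v i j := by
    by_cases h : j.1 = i.1 ∧ j.2 + 1 = i.2
    · obtain rfl : i = (j.1, j.2 + 1) := Prod.ext h.1.symm h.2.symm
      apply tensor_hom_ext
      intro a b hab w y
      change (E.dv _ _).hom ((P.toHomX _).hom (univ W Y a b _ w y)) =
        (P.toHomX _).hom (((W ⊗ Y).dv _ _).hom (univ W Y a b _ w y))
      rw [toHomX_univ, univ_dv, map_add, units_smul_map, toHomX_univ, toHomX_univ, P.m_dv]
    · rw [dv_shape _ _ _ h, dv_shape _ _ _ h, comp_zero, zero_comp]

/-- Morphisms from a tensor product correspond to pairings. -/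
noncomputable def homEquiv : (W ⊗ Y ⟶ E) ≃ Pairing W Y E where
  toFun := ofHom
  invFun := toHom
  left_inv h := by
    ext c : 1
    apply tensor_hom_ext
    intro a b hab w y
    exact toHomX_univ _ _ _ _ _ _
  right_inv P := by
    ext a b c w y
    exact toHomX_univ _ _ _ _ _ _

end Pairing

end BCh

/-! ### The internal hom of bicomplexes -/

namespace BCh

open scoped TensorProduct

variable {k : Type u} [CommRing k]

/-- Anticommutativity with truncated indices: in column 0 both sides vanish. -/
lemma dv_dh_hdeg (A : BCh k) (a : ℕ × ℤ) (x : A.X a) :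
    (A.dv (hdeg a) (vdeg (hdeg a))).hom ((A.dh a (hdeg a)).hom x) =
      - (A.dh (vdeg a) (vdeg (hdeg a))).hom ((A.dv a (vdeg a)).hom x) := by
  by_cases h : a.1 = 0
  · rw [dh_eq_zero_of_fst A a _ h, dh_eq_zero_of_fst A (vdeg a) _ h]
    exact (map_zero _).trans neg_zero.symm
  · exact eq_neg_of_add_eq_zero_left (anticomm_apply A a (hdeg a) (vdeg a) (vdeg (hdeg a))
      (by dsimp; lia) rfl rfl (by dsimp; ring) rfl rfl x)

lemma dv_dh_succ (A : BCh k) (c : ℕ × ℤ) (x : A.X (c.1 + 1, c.2 + 1)) :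
    (A.dv (c.1, c.2 + 1) c).hom ((A.dh (c.1 + 1, c.2 + 1) (c.1, c.2 + 1)).hom x) =
      - (A.dh (c.1 + 1, c.2) c).hom ((A.dv (c.1 + 1, c.2 + 1) (c.1 + 1, c.2)).hom x) :=
  dv_dh_apply A (c.1 + 1) c.1 c.2 x rfl

/-- Families of linear maps between the terms of two bicomplexes. -/
abbrev HomFam (Y E : BCh k) := ∀ b c, Y.X b →ₗ[k] E.X c

/-- The horizontal differential of a family of linear maps, with a sign. -/
def homDh (Y E : BCh k) (s : ℤˣ) : HomFam Y E →ₗ[k] HomFam Y E where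
  toFun φ b c := (E.dh (c.1 + 1, c.2) c).hom.comp (φ b (c.1 + 1, c.2)) -
    s • (φ (hdeg b) c).comp (Y.dh b (hdeg b)).hom
  map_add' φ ψ := by
    ext b c y
    simp [smul_add]
    abel
  map_smul' r φ := by
    ext b c y
    rcases Int.units_eq_one_or s with rfl | rfl <;> simp [smul_sub]

/-- The vertical differential of a family of linear maps, with a sign. -/
def homDv (Y E : BCh k) (s : ℤˣ) : HomFam Y E →ₗ[k] HomFam Y E where
  toFun φ b c := (E.dv (c.1, c.2 + 1) c).hom.comp (φ b (c.1, c.2 + 1)) -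
    s • (φ (vdeg b) c).comp (Y.dv b (vdeg b)).hom
  map_add' φ ψ := by
    ext b c y
    simp [smul_add]
    abel
  map_smul' r φ := by
    ext b c y
    rcases Int.units_eq_one_or s with rfl | rfl <;> simp [smul_sub]

variable {Y E : BCh k}

lemma homDh_apply (s : ℤˣ) (φ : HomFam Y E) (b c : ℕ × ℤ) (y : Y.X b) :
    homDh Y E s φ b c y = (E.dh (c.1 + 1, c.2) c).hom (φ b (c.1 + 1, c.2) y) -
      s • φ (hdeg b) c ((Y.dh b (hdeg b)).hom y) := rfl

lemma homDv_apply (s : ℤˣ) (φ : HomFam Y E) (b c : ℕ × ℤ) (y : Y.X b) :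
    homDv Y E s φ b c y = (E.dv (c.1, c.2 + 1) c).hom (φ b (c.1, c.2 + 1) y) -
      s • φ (vdeg b) c ((Y.dv b (vdeg b)).hom y) := rfl

/-- The sign s stands for (-1)^|φ|, and it flips because the differential lowers the degree by one;
the two mixed terms then cancel. -/
lemma homDh_homDh (s : ℤˣ) (φ : HomFam Y E) : homDh Y E (-s) (homDh Y E s φ) = 0 := by
  ext b c y
  simp only [homDh_apply, map_sub, dh_dh_apply, map_zero, smul_zero, units_smul_map,
    Units.neg_smul, sub_zero, zero_sub, sub_neg_eq_add]
  exact neg_add_cancel _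

lemma homDv_homDv (s : ℤˣ) (φ : HomFam Y E) : homDv Y E (-s) (homDv Y E s φ) = 0 := by
  ext b c y
  simp only [homDv_apply, map_sub, dv_dv_apply, map_zero, smul_zero, units_smul_map,
    Units.neg_smul, sub_zero, zero_sub, sub_neg_eq_add]
  exact neg_add_cancel _

lemma homDh_homDv (s : ℤˣ) (φ : HomFam Y E) :
    homDh Y E (-s) (homDv Y E s φ) = - homDv Y E (-s) (homDh Y E s φ) := by
  ext b c y
  change homDh Y E (-s) (homDv Y E s φ) b c y = - homDv Y E (-s) (homDh Y E s φ) b c y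
  simp only [homDh_apply, homDv_apply, map_sub, units_smul_map, Units.neg_smul, sub_neg_eq_add,
    smul_sub, smul_smul, neg_mul, Int.units_mul_self, one_smul, dv_dh_succ, dv_dh_hdeg, map_neg]
  dsimp only [hdeg, vdeg]
  abel

lemma add_hdeg_ne {a b c j : ℕ × ℤ} (h : j.1 + 1 = a.1 ∧ j.2 = a.2) (hc : j + b ≠ c)
    (hb : b.1 ≠ 0) : a + hdeg b ≠ c := fun h' => hc (by
  have h1 := congr_arg Prod.fst h'
  have h2 := congr_arg Prod.snd h'
  ext <;> dsimp at * <;> lia)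

lemma add_vdeg_ne {a b c j : ℕ × ℤ} (h : j.1 = a.1 ∧ j.2 + 1 = a.2) (hc : j + b ≠ c) :
    a + vdeg b ≠ c := fun h' => hc (by
  have h1 := congr_arg Prod.fst h'
  have h2 := congr_arg Prod.snd h'
  ext <;> dsimp at * <;> lia)

lemma homDh_eq_zero (s : ℤˣ) (φ : HomFam Y E) (a j : ℕ × ℤ) (h : j.1 + 1 = a.1 ∧ j.2 = a.2)
    (hφ : ∀ b c, a + b ≠ c → φ b c = 0) (b c : ℕ × ℤ) (hc : j + b ≠ c) :
    homDh Y E s φ b c = 0 := by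
  ext y
  rw [homDh_apply, hφ b _ (fun h' => hc (by
    have h1 := congr_arg Prod.fst h'
    have h2 := congr_arg Prod.snd h'
    ext <;> dsimp at * <;> lia))]
  refine (congr_arg₂ (· - ·) (map_zero _) ?_).trans (sub_zero _)
  by_cases hb : b.1 = 0
  · rw [dh_eq_zero_of_fst Y b _ hb]
    exact (congr_arg _ (map_zero (φ (hdeg b) c))).trans (smul_zero _)
  · rw [hφ _ _ (add_hdeg_ne h hc hb)]
    exact smul_zero _

lemma homDv_eq_zero (s : ℤˣ) (φ : HomFam Y E) (a j : ℕ × ℤ) (h : j.1 = a.1 ∧ j.2 + 1 = a.2)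
    (hφ : ∀ b c, a + b ≠ c → φ b c = 0) (b c : ℕ × ℤ) (hc : j + b ≠ c) :
    homDv Y E s φ b c = 0 := by
  ext y
  rw [homDv_apply, hφ b _ (fun h' => hc (by
    have h1 := congr_arg Prod.fst h'
    have h2 := congr_arg Prod.snd h'
    ext <;> dsimp at * <;> lia))]
  refine (congr_arg₂ (· - ·) (map_zero _) ?_).trans (sub_zero _)
  rw [hφ _ _ (add_vdeg_ne h hc)]
  exact smul_zero _

variable (Y E) in
/-- The terms of the internal hom of bicomplexes. -/
def ihomX (a : ℕ × ℤ) : Submodule k (HomFam Y E) where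
  -- Column -1 is absent, so families of horizontal degree 0 must be horizontal cycles in order to
  -- commute with d_h; d_v preserves this by anticommutativity.
  carrier := { φ | (∀ b c, a + b ≠ c → φ b c = 0) ∧ (a.1 = 0 → homDh Y E (sgn a) φ = 0) }
  add_mem' {φ ψ} hx hy := ⟨fun b c h => by
    change φ b c + ψ b c = 0
    rw [hx.1 b c h, hy.1 b c h, add_zero], fun h => by rw [map_add, hx.2 h, hy.2 h, add_zero]⟩
  zero_mem' := ⟨fun b c h => rfl, fun h => map_zero _⟩
  smul_mem' r φ hx := ⟨fun b c h => by
    change r • φ b c = 0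
    rw [hx.1 b c h, smul_zero], fun h => by rw [map_smul, hx.2 h, smul_zero]⟩

lemma sgn_of_h {i j : ℕ × ℤ} (h : j.1 + 1 = i.1 ∧ j.2 = i.2) : sgn j = - sgn i := by
  obtain rfl : i = (j.1 + 1, j.2) := Prod.ext h.1.symm h.2.symm
  rw [sgn_h, neg_neg]

lemma sgn_of_v {i j : ℕ × ℤ} (h : j.1 = i.1 ∧ j.2 + 1 = i.2) : sgn j = - sgn i := by
  obtain rfl : i = (j.1, j.2 + 1) := Prod.ext h.1.symm h.2.symm
  rw [sgn_v, neg_neg]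

variable (Y E) in
/-- The horizontal differential of the internal hom. -/
def ihomDh (i j : ℕ × ℤ) (h : j.1 + 1 = i.1 ∧ j.2 = i.2) : ihomX Y E i →ₗ[k] ihomX Y E j :=
  LinearMap.restrict (homDh Y E (sgn i)) (fun φ hφ => ⟨homDh_eq_zero _ _ i j h hφ.1, fun _ => by
    rw [sgn_of_h h, homDh_homDh]⟩)

variable (Y E) in
/-- The vertical differential of the internal hom. -/
def ihomDv (i j : ℕ × ℤ) (h : j.1 = i.1 ∧ j.2 + 1 = i.2) : ihomX Y E i →ₗ[k] ihomX Y E j :=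
  LinearMap.restrict (homDv Y E (sgn i)) (fun φ hφ => ⟨homDv_eq_zero _ _ i j h hφ.1, fun hj => by
    rw [sgn_of_v h, homDh_homDv, hφ.2 (h.1.symm.trans hj), map_zero, neg_zero]⟩)

variable (Y E) in
/-- The internal hom of bicomplexes. -/
noncomputable def ihomObj : BCh k where
  X a := ModuleCat.of k (ihomX Y E a)
  dh i j := if h : j.1 + 1 = i.1 ∧ j.2 = i.2 then ModuleCat.ofHom (ihomDh Y E i j h) else 0
  dv i j := if h : j.1 = i.1 ∧ j.2 + 1 = i.2 then ModuleCat.ofHom (ihomDv Y E i j h) else 0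
  dh_shape i j h := dif_neg h
  dv_shape i j h := dif_neg h
  dh_comp_dh p q := by
    rw [dif_pos ⟨rfl, rfl⟩, dif_pos ⟨rfl, rfl⟩]
    ext1
    refine LinearMap.ext (fun z => Subtype.ext ?_)
    change homDh Y E (sgn (p + 1, q)) (homDh Y E (sgn (p + 2, q)) z.1) = 0
    rw [sgn_of_h (i := (p + 2, q)) (j := (p + 1, q)) ⟨rfl, rfl⟩, homDh_homDh]
  dv_comp_dv p q := by
    rw [dif_pos ⟨rfl, by dsimp; ring⟩, dif_pos ⟨rfl, rfl⟩]
    ext1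
    refine LinearMap.ext (fun z => Subtype.ext ?_)
    change homDv Y E (sgn (p, q + 1)) (homDv Y E (sgn (p, q + 2)) z.1) = 0
    rw [sgn_of_v (i := (p, q + 2)) (j := (p, q + 1)) ⟨rfl, by dsimp; ring⟩, homDv_homDv]
  anticomm p q := by
    rw [dif_pos ⟨rfl, rfl⟩, dif_pos ⟨rfl, rfl⟩, dif_pos ⟨rfl, rfl⟩, dif_pos ⟨rfl, rfl⟩]
    ext1
    refine LinearMap.ext (fun z => Subtype.ext ?_)
    change homDv Y E (sgn (p, q + 1)) (homDh Y E (sgn (p + 1, q + 1)) z.1) +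
      homDh Y E (sgn (p + 1, q)) (homDv Y E (sgn (p + 1, q + 1)) z.1) = 0
    rw [sgn_of_h (i := (p + 1, q + 1)) (j := (p, q + 1)) ⟨rfl, rfl⟩,
      sgn_of_v (i := (p + 1, q + 1)) (j := (p + 1, q)) ⟨rfl, rfl⟩, homDh_homDv, add_neg_cancel]

lemma ihom_dh_coe (i j : ℕ × ℤ) (h : j.1 + 1 = i.1 ∧ j.2 = i.2) (z : ihomX Y E i) :
    (((ihomObj Y E).dh i j).hom z : ihomX Y E j).1 = homDh Y E (sgn i) z.1 :=
  congr_arg (fun f : ModuleCat.of k (ihomX Y E i) ⟶ ModuleCat.of k (ihomX Y E j) => (f.hom z).1)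
    (dif_pos h)

lemma ihom_dv_coe (i j : ℕ × ℤ) (h : j.1 = i.1 ∧ j.2 + 1 = i.2) (z : ihomX Y E i) :
    (((ihomObj Y E).dv i j).hom z : ihomX Y E j).1 = homDv Y E (sgn i) z.1 :=
  congr_arg (fun f : ModuleCat.of k (ihomX Y E i) ⟶ ModuleCat.of k (ihomX Y E j) => (f.hom z).1)
    (dif_pos h)

namespace Pairing

variable {W : BCh k}

lemma homDh_m (P : Pairing W Y E) (a : ℕ × ℤ) (w : W.X a) :
    homDh Y E (sgn a) (fun b c => P.m a b c w) =
      fun b c => P.m (hdeg a) b c ((W.dh a (hdeg a)).hom w) := by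
  ext b c y
  rw [homDh_apply, P.m_dh, add_sub_cancel_right]

lemma homDv_m (P : Pairing W Y E) (a : ℕ × ℤ) (w : W.X a) :
    homDv Y E (sgn a) (fun b c => P.m a b c w) =
      fun b c => P.m (vdeg a) b c ((W.dv a (vdeg a)).hom w) := by
  ext b c y
  rw [homDv_apply, P.m_dv, add_sub_cancel_right]

/-- The components of the morphism to the internal hom attached to a pairing. -/
noncomputable def toIhomX (P : Pairing W Y E) (a : ℕ × ℤ) : W.X a →ₗ[k] ihomX Y E a :=
  LinearMap.codRestrict _ (LinearMap.pi (fun b => LinearMap.pi (fun c => P.m a b c)))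
    (fun w => ⟨fun b c h => congr_arg (fun f => f w) (P.m_zero a b c h), fun h => by
      refine (homDh_m P a w).trans ?_
      rw [dh_eq_zero_of_fst W a _ h]
      ext b c y
      exact congr_arg (fun f => f y) (map_zero (P.m (hdeg a) b c))⟩)

/-- The morphism to the internal hom attached to a pairing. -/
noncomputable def toIhom (P : Pairing W Y E) : W ⟶ ihomObj Y E where
  f a := ModuleCat.ofHom (P.toIhomX a)
  comm_h i j := by
    by_cases h : j.1 + 1 = i.1 ∧ j.2 = i.2
    · ext1
      refine LinearMap.ext (fun w => Subtype.ext ?_)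
      refine (ihom_dh_coe i j h (P.toIhomX i w)).trans ((homDh_m P i w).trans ?_)
      obtain rfl : j = hdeg i := Prod.ext (by dsimp; lia) h.2
      rfl
    · rw [dh_shape _ _ _ h, dh_shape _ _ _ h]
      exact comp_zero.trans zero_comp.symm
  comm_v i j := by
    by_cases h : j.1 = i.1 ∧ j.2 + 1 = i.2
    · ext1
      refine LinearMap.ext (fun w => Subtype.ext ?_)
      refine (ihom_dv_coe i j h (P.toIhomX i w)).trans ((homDv_m P i w).trans ?_)
      obtain rfl : j = vdeg i := Prod.ext h.1 (by dsimp; lia)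
      rfl
    · rw [dv_shape _ _ _ h, dv_shape _ _ _ h]
      exact comp_zero.trans zero_comp.symm

/-- The value of a morphism to the internal hom. -/
noncomputable def ihomVal (g : W ⟶ ihomObj Y E) (a : ℕ × ℤ) : W.X a →ₗ[k] HomFam Y E :=
  (ihomX Y E a).subtype.comp (g.f a).hom

lemma ihomVal_dh (g : W ⟶ ihomObj Y E) (a : ℕ × ℤ) (w : W.X a) :
    ihomVal g (hdeg a) ((W.dh a (hdeg a)).hom w) = homDh Y E (sgn a) (ihomVal g a w) := by
  by_cases h : a.1 = 0
  · rw [dh_eq_zero_of_fst W a _ h]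
    exact (map_zero (ihomVal g (hdeg a))).trans (((g.f a).hom w : ihomX Y E a).2.2 h).symm
  · refine (congr_arg (fun z : ihomX Y E (hdeg a) => z.1) (f_dh_apply g a (hdeg a) w)).trans ?_
    exact ihom_dh_coe a (hdeg a) ⟨by dsimp; lia, rfl⟩ _

lemma ihomVal_dv (g : W ⟶ ihomObj Y E) (a : ℕ × ℤ) (w : W.X a) :
    ihomVal g (vdeg a) ((W.dv a (vdeg a)).hom w) = homDv Y E (sgn a) (ihomVal g a w) := by
  refine (congr_arg (fun z : ihomX Y E (vdeg a) => z.1) (f_dv_apply g a (vdeg a) w)).trans ?_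
  exact ihom_dv_coe a (vdeg a) ⟨rfl, by dsimp; ring⟩ _

/-- The pairing attached to a morphism to the internal hom. -/
noncomputable def ofIhom (g : W ⟶ ihomObj Y E) : Pairing W Y E where
  m a b c := ((LinearMap.proj c).comp (LinearMap.proj (φ := fun b => ∀ c, Y.X b →ₗ[k] E.X c)
    b)).comp (ihomVal g a)
  m_zero a b c h := LinearMap.ext (fun w => ((g.f a).hom w : ihomX Y E a).2.1 b c h)
  m_dh a b c w y := by
    change (E.dh (c.1 + 1, c.2) c).hom (ihomVal g a w b (c.1 + 1, c.2) y) =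
      ihomVal g (hdeg a) ((W.dh a (hdeg a)).hom w) b c y +
        sgn a • ihomVal g a w (hdeg b) c ((Y.dh b (hdeg b)).hom y)
    rw [ihomVal_dh, homDh_apply, sub_add_cancel]
  m_dv a b c w y := by
    change (E.dv (c.1, c.2 + 1) c).hom (ihomVal g a w b (c.1, c.2 + 1) y) =
      ihomVal g (vdeg a) ((W.dv a (vdeg a)).hom w) b c y +
        sgn a • ihomVal g a w (vdeg b) c ((Y.dv b (vdeg b)).hom y)
    rw [ihomVal_dv, homDv_apply, sub_add_cancel]

/-- Pairings correspond to morphisms to the internal hom. -/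
noncomputable def ihomEquiv : Pairing W Y E ≃ (W ⟶ ihomObj Y E) where
  toFun := toIhom
  invFun := ofIhom
  left_inv P := rfl
  right_inv g := rfl

end Pairing

lemma univ_whiskerRight {W W' : BCh k} (g : W ⟶ W') (Y : BCh k) (a b c : ℕ × ℤ) (w : W.X a)
    (y : Y.X b) : ((g ▷ Y).f c).hom (Pairing.univ W Y a b c w y) =
      Pairing.univ W' Y a b c ((g.f a).hom w) y := by
  by_cases h : a + b = c
  · rw [Pairing.univ_apply, Pairing.univ_apply, tensorι_eq W Y a b c h, tensorι_eq W' Y a b c h]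
    have := GradedObject.Monoidal.ι_tensorHom g.f (𝟙 Y.X) a b c h
    refine (congr_arg (fun t => t.hom (w ⊗ₜ y)) this).trans ?_
    rfl
  · rw [Pairing.univ_zero _ _ _ h, Pairing.univ_zero _ _ _ h]
    exact map_zero _

lemma univ_whiskerLeft {Y Y' : BCh k} (W : BCh k) (g : Y ⟶ Y') (a b c : ℕ × ℤ) (w : W.X a)
    (y : Y.X b) : ((W ◁ g).f c).hom (Pairing.univ W Y a b c w y) =
      Pairing.univ W Y' a b c w ((g.f b).hom y) := by
  by_cases h : a + b = c
  · rw [Pairing.univ_apply, Pairing.univ_apply, tensorι_eq W Y a b c h, tensorι_eq W Y' a b c h]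
    have := GradedObject.Monoidal.ι_tensorHom (𝟙 W.X) g.f a b c h
    refine (congr_arg (fun t => t.hom (w ⊗ₜ y)) this).trans ?_
    rfl
  · rw [Pairing.univ_zero _ _ _ h, Pairing.univ_zero _ _ _ h]
    exact map_zero _

/-- The adjunction between the tensor product and the internal hom. -/
noncomputable def tensorHomEquiv (Y W E : BCh k) :
    ((tensorRight Y).obj W ⟶ E) ≃ (W ⟶ ihomObj Y E) :=
  Pairing.homEquiv.trans Pairing.ihomEquiv

lemma tensorHomEquiv_naturality (Y W' W E : BCh k) (f : W' ⟶ W) (g : (tensorRight Y).obj W ⟶ E) :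
    tensorHomEquiv Y W' E ((tensorRight Y).map f ≫ g) = f ≫ tensorHomEquiv Y W E g := by
  ext a : 1
  ext1
  refine LinearMap.ext (fun w => Subtype.ext ?_)
  funext b c
  ext y
  exact congr_arg (g.f c).hom (univ_whiskerRight f Y a b c w y)

/-- Closedness allows lifting problems for pushout-products to be moved from one factor to another,
and makes tensoring preserve initial objects. The adjunction is built for right tensoring and
transferred by the symmetry. -/
noncomputable instance : MonoidalClosed (BCh k) where
  closed Y :=
    { rightAdj := Adjunction.rightAdjointOfEquiv _ (tensorHomEquiv_naturality Y)
      adj := (Adjunction.adjunctionOfEquivRight _ (tensorHomEquiv_naturality Y)).ofNatIsoLeft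
        (BraidedCategory.tensorLeftIsoTensorRight Y).symm }

end BCh

/-! ### Lifting properties of pushout-products -/

namespace CategoryTheory.MonoidalCategory

variable {C : Type*} [Category* C] [MonoidalCategory C] [HasPushouts C]

/-- Maps out of the pushout are unpacked into compatible pairs; the resulting condition mentions
only tensor products. -/
lemma hasLiftingProperty_pushoutProduct_iff {A B X Y E F : C} (f : A ⟶ B) (g : X ⟶ Y)
    (π : E ⟶ F) :
    HasLiftingProperty ((Arrow.pushoutProduct.obj (Arrow.mk f)).obj (Arrow.mk g)).hom π ↔
      ∀ (α : B ⊗ X ⟶ E) (β : A ⊗ Y ⟶ E) (ψ : B ⊗ Y ⟶ F), f ▷ X ≫ α = A ◁ g ≫ β →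
        α ≫ π = B ◁ g ≫ ψ → β ≫ π = f ▷ Y ≫ ψ →
        ∃ h : B ⊗ Y ⟶ E, B ◁ g ≫ h = α ∧ f ▷ Y ≫ h = β ∧ h ≫ π = ψ := by
  let P := Functor.PushoutObjObj.ofHasPushout (curriedTensor C) f g
  have hl : P.inl ≫ P.ι = B ◁ g := P.inl_ι
  have hr : P.inr ≫ P.ι = f ▷ Y := P.inr_ι
  have hP : IsPushout (f ▷ X) (A ◁ g) P.inl P.inr := P.isPushout
  change HasLiftingProperty P.ι π ↔ _
  constructor
  · intro h α β ψ h1 h2 h3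
    have sq : CommSq (hP.desc α β h1) P.ι π ψ := ⟨hP.hom_ext
      (by rw [hP.inl_desc_assoc, ← Category.assoc, hl, h2])
      (by rw [hP.inr_desc_assoc, ← Category.assoc, hr, h3])⟩
    refine ⟨sq.lift, ?_, ?_, sq.fac_right⟩
    · rw [← hl, Category.assoc, sq.fac_left, hP.inl_desc]
    · rw [← hr, Category.assoc, sq.fac_left, hP.inr_desc]
  · intro H
    refine ⟨fun {u v} sq => ?_⟩
    obtain ⟨h, h1, h2, h3⟩ := H (P.inl ≫ u) (P.inr ≫ u) v
      (by rw [← Category.assoc, ← Category.assoc, hP.w])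
      (by rw [Category.assoc, sq.w, ← Category.assoc, hl])
      (by rw [Category.assoc, sq.w, ← Category.assoc, hr])
    exact ⟨⟨⟨h, hP.hom_ext (by rw [← Category.assoc, hl, h1])
      (by rw [← Category.assoc, hr, h2]), h3⟩⟩⟩

/-- Pushout-products of relative cell complexes have a left lifting property if the pushout-products
of the generators do. -/
lemma hasLiftingProperty_pushoutProduct_of_llp_rlp [HasPullbacks C] [BraidedCategory C]
    [MonoidalClosed C] (I J T : MorphismProperty C)
    (H : ∀ {A B X Y E F : C} (i : A ⟶ B) (j : X ⟶ Y) (π : E ⟶ F), I i → J j → T π →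
      HasLiftingProperty ((Arrow.pushoutProduct.obj (Arrow.mk i)).obj (Arrow.mk j)).hom π)
    {A B X Y E F : C} (f : A ⟶ B) (g : X ⟶ Y) (π : E ⟶ F) (hf : I.rlp.llp f) (hg : J.rlp.llp g)
    (hπ : T π) :
    HasLiftingProperty ((Arrow.pushoutProduct.obj (Arrow.mk f)).obj (Arrow.mk g)).hom π := by
  -- The problem is transposed to one for g against a pullback-hom, which may be tested on J;
  -- transposing again to isolate f reduces it to I.
  rw [Arrow.PushoutProduct.hasLiftingProperty_mk_iff]
  refine hg _ (fun X' Y' j hj => ?_)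
  rw [← Arrow.PushoutProduct.hasLiftingProperty_mk_iff,
    Arrow.PushoutProduct.hasLiftingProperty_mk_iff']
  refine hf _ (fun A' B' i hi => ?_)
  rw [← Arrow.PushoutProduct.hasLiftingProperty_mk_iff']
  exact H i j π hi hj hπ

end CategoryTheory.MonoidalCategory

/-! ### Pushout-products with a cell inclusion as extension problems -/

namespace BCh

variable {k : Type u} [CommRing k]

section

variable {Y E F X W : BCh k}

/-- The value on an element of a morphism from a tensor product. -/
noncomputable def tval (h : W ⊗ Y ⟶ E) (a : ℕ × ℤ) (w : W.X a) : ihomX Y E a :=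
  ((tensorHomEquiv Y W E h).f a).hom w

lemma tval_dv (h : W ⊗ Y ⟶ E) (p : ℕ) (q : ℤ) (w : W.X (p, q + 1)) :
    (tval h (p, q) ((W.dv (p, q + 1) (p, q)).hom w)).1 =
      homDv Y E (sgn (p, q + 1)) (tval h (p, q + 1) w).1 := by
  have := f_dv_apply (tensorHomEquiv Y W E h) (p, q + 1) (p, q) w
  exact (congr_arg (fun z : ihomX Y E (p, q) => z.1) this).trans
    (ihom_dv_coe (p, q + 1) (p, q) ⟨rfl, rfl⟩ _)

lemma tval_whiskerRight {W' : BCh k} (f : W' ⟶ W) (h : W ⊗ Y ⟶ E) (a : ℕ × ℤ) (w : W'.X a) :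
    tval (f ▷ Y ≫ h) a w = tval h a ((f.f a).hom w) :=
  congr_arg (fun t => (t.f a).hom w) (tensorHomEquiv_naturality Y W' W E f h)

lemma tval_whiskerLeft (g : X ⟶ Y) (h : W ⊗ Y ⟶ E) (a b c : ℕ × ℤ) (w : W.X a) (x : X.X b) :
    (tval (W ◁ g ≫ h) a w).1 b c x = (tval h a w).1 b c ((g.f b).hom x) :=
  congr_arg (h.f c).hom (univ_whiskerLeft W g a b c w x)

lemma tval_comp (h : W ⊗ Y ⟶ E) (π : E ⟶ F) (a b c : ℕ × ℤ) (w : W.X a) (y : Y.X b) :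
    (tval (h ≫ π) a w).1 b c y = (π.f c).hom ((tval h a w).1 b c y) := rfl

/-- A map from a free cell tensored with Y is one element of the internal hom in bidegree (p, q +
1). -/
lemma free_tensor_hom_ext {p : ℕ} {q : ℤ} {h h' : cell k p q True ⊗ Y ⟶ E}
    (H : ∀ b c y, (tval h _ (freeGen k p q)).1 b c y = (tval h' _ (freeGen k p q)).1 b c y) :
    h = h' := by
  apply (tensorHomEquiv Y _ E).injective
  apply free_hom_ext
  apply Subtype.ext
  funext b c
  exact LinearMap.ext (H b c)

lemma exists_free_tensor_hom {p : ℕ} {q : ℤ} (φ : ihomX Y E (p, q + 1)) :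
    ∃ h : cell k p q True ⊗ Y ⟶ E, tval h _ (freeGen k p q) = φ :=
  ⟨(tensorHomEquiv Y _ E).symm (freeHom (A := ihomObj Y E) φ), by
    refine (congr_arg (fun t => (t.f (p, q + 1)).hom (freeGen k p q))
      ((tensorHomEquiv Y _ E).apply_symm_apply _)).trans ?_
    exact freeHom_gen (A := ihomObj Y E) φ⟩

/-- Evaluated at the cell generators, the data of the square are a vertical cycle χ on Y, a family
φ' on X and a family ψ with values in F; the compatibilities are those of the square. A lift is a
family φ extending φ', lifting ψ, and with vertical differential χ. -/
lemma hasLiftingProperty_cellIncl_pushoutProduct (g : X ⟶ Y) (π : E ⟶ F) (p : ℕ) (q : ℤ)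
    (H : ∀ (χ : ihomX Y E (p, q)) (φ' : ihomX X E (p, q + 1)) (ψ : ihomX Y F (p, q + 1)),
      homDv Y E (sgn (p, q)) χ.1 = 0 →
      (∀ b c x, χ.1 b c ((g.f b).hom x) = homDv X E (sgn (p, q + 1)) φ'.1 b c x) →
      (∀ b c x, (π.f c).hom (φ'.1 b c x) = ψ.1 b c ((g.f b).hom x)) →
      (∀ b c y, (π.f c).hom (χ.1 b c y) = homDv Y F (sgn (p, q + 1)) ψ.1 b c y) →
      ∃ φ : ihomX Y E (p, q + 1), (∀ b c x, φ.1 b c ((g.f b).hom x) = φ'.1 b c x) ∧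
        (∀ b c y, (π.f c).hom (φ.1 b c y) = ψ.1 b c y) ∧
        homDv Y E (sgn (p, q + 1)) φ.1 = χ.1) :
    HasLiftingProperty
      ((Arrow.pushoutProduct.obj (Arrow.mk (cellIncl k p q))).obj (Arrow.mk g)).hom π := by
  rw [hasLiftingProperty_pushoutProduct_iff]
  intro α β ψ h1 h2 h3
  have H1 : homDv Y E (sgn (p, q)) (tval β _ (cycGen k p q)).1 = 0 := by
    obtain ⟨q, rfl⟩ : ∃ q', q = q' + 1 := ⟨q - 1, by ring⟩
    rw [← tval_dv, cycGen_dv]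
    exact congr_arg Subtype.val (map_zero ((tensorHomEquiv Y _ E β).f (p, q)).hom)
  have H2 : ∀ b c x, (tval β _ (cycGen k p q)).1 b c ((g.f b).hom x) =
      homDv X E (sgn (p, q + 1)) (tval α _ (freeGen k p q)).1 b c x := by
    intro b c x
    rw [← tval_whiskerLeft, ← h1, tval_whiskerRight, cellIncl_cycGen, tval_dv]
  have H3 : ∀ b c x, (π.f c).hom ((tval α _ (freeGen k p q)).1 b c x) =
      (tval ψ _ (freeGen k p q)).1 b c ((g.f b).hom x) := by
    intro b c x
    rw [← tval_comp, h2, tval_whiskerLeft]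
  have H4 : ∀ b c y, (π.f c).hom ((tval β _ (cycGen k p q)).1 b c y) =
      homDv Y F (sgn (p, q + 1)) (tval ψ _ (freeGen k p q)).1 b c y := by
    intro b c y
    rw [← tval_comp, h3, tval_whiskerRight, cellIncl_cycGen, tval_dv]
  obtain ⟨φ, hφ1, hφ2, hφ3⟩ := H _ _ _ H1 H2 H3 H4
  obtain ⟨h, rfl⟩ := exists_free_tensor_hom φ
  refine ⟨h, free_tensor_hom_ext fun b c x => ?_, ?_, free_tensor_hom_ext fun b c y => hφ2 b c y⟩
  · rw [tval_whiskerLeft, hφ1]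
  · apply (tensorHomEquiv Y _ E).injective
    apply cyc_hom_ext
    apply Subtype.ext
    refine Eq.trans ?_ hφ3
    refine (congr_arg Subtype.val (tval_whiskerRight (cellIncl k p q) h _ (cycGen k p q))).trans ?_
    rw [cellIncl_cycGen, tval_dv]

lemma isZero_zero_tensor (Y : BCh k) {Z : BCh k} (hZ : IsZero Z) : IsZero (Z ⊗ Y) := by
  rw [IsZero.iff_id_eq_zero]
  apply (tensorHomEquiv Y Z _).injective
  exact hZ.eq_of_src _ _

/-- With zero source there is no χ, so the condition on the vertical differential of φ disappears.
-/
lemma hasLiftingProperty_zero_pushoutProduct {Z : BCh k} (hZ : IsZero Z) (p : ℕ) (q : ℤ)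
    (f : Z ⟶ cell k p q True) (g : X ⟶ Y) (π : E ⟶ F)
    (H : ∀ (φ' : ihomX X E (p, q + 1)) (ψ : ihomX Y F (p, q + 1)),
      (∀ b c x, (π.f c).hom (φ'.1 b c x) = ψ.1 b c ((g.f b).hom x)) →
      ∃ φ : ihomX Y E (p, q + 1), (∀ b c x, φ.1 b c ((g.f b).hom x) = φ'.1 b c x) ∧
        (∀ b c y, (π.f c).hom (φ.1 b c y) = ψ.1 b c y)) :
    HasLiftingProperty ((Arrow.pushoutProduct.obj (Arrow.mk f)).obj (Arrow.mk g)).hom π := by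
  rw [hasLiftingProperty_pushoutProduct_iff]
  intro α β ψ h1 h2 h3
  obtain ⟨φ, hφ1, hφ2⟩ := H (tval α _ (freeGen k p q)) (tval ψ _ (freeGen k p q)) (fun b c x => by
    rw [← tval_comp, h2, tval_whiskerLeft])
  obtain ⟨h, rfl⟩ := exists_free_tensor_hom φ
  refine ⟨h, free_tensor_hom_ext fun b c x => ?_, (isZero_zero_tensor Y hZ).eq_of_src _ _,
    free_tensor_hom_ext fun b c y => hφ2 b c y⟩
  rw [tval_whiskerLeft, hφ1]

end

end BCh

/-! ### Families of linear maps on a free cell -/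

namespace BCh

variable {k : Type u} [CommRing k]

lemma cyc_cell_dv (m : ℕ) (n : ℤ) (i j : ℕ × ℤ) (x : (cell k m n False).X i) :
    ((cell k m n False).dv i j).hom x = 0 := by
  by_cases h : i.2 = n + 1
  · rw [cell_elt_eq_zero m n False i (fun h' => by
      rcases h'.2 with h' | h'
      · lia
      · exact h'.1) x, map_zero]
  · exact cell_dv_eq_zero m n False i j x h

/-- The linear projection of a free bicomplex to the free bicomplex on a vertical cycle. -/
noncomputable def cellProj (m : ℕ) (n : ℤ) (b : ℕ × ℤ) :
    (cell k m n True).X b →ₗ[k] (cell k m n False).X b := pieceMap k _ _ 1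

lemma cellProj_cellIncl (m : ℕ) (n : ℤ) (b : ℕ × ℤ) (x : (cell k m n False).X b) :
    cellProj m n b (((cellIncl k m n).f b).hom x) = x := by
  apply Subtype.ext
  refine (pieceMap_coe _ _ _ _).trans ?_
  split_ifs with h
  · exact one_mul _
  · exact (x.2 h).symm

lemma cellIncl_cellProj (m : ℕ) (n : ℤ) (b : ℕ × ℤ) (hb : b.2 = n) (y : (cell k m n True).X b) :
    ((cellIncl k m n).f b).hom (cellProj m n b y) = y := by
  apply Subtype.ext
  refine (pieceMap_coe _ _ _ _).trans ?_
  split_ifs with h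
  · exact one_mul _
  · exact (y.2 (fun h' => h ⟨h'.1, Or.inl hb⟩)).symm

lemma freeGen_dh_coe (m' : ℕ) (n : ℤ) :
    (((cell k (m' + 1) n True).dh (m' + 1, n + 1) (m', n + 1)).hom
      (freeGen k (m' + 1) n)).1 = 1 :=
  cell_dh_coe _ _ _ _ _ _ ⟨rfl, rfl⟩ rfl

/-- Row n of the free cell is the image of `cellIncl`; row n + 1 is spanned by the generator and its
horizontal boundary. -/
lemma free_cell_induction {m : ℕ} {n : ℤ} {P : ∀ b, (cell k m n True).X b → Prop}
    (h1 : ∀ b x, P b (((cellIncl k m n).f b).hom x))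
    (h2 : ∀ r : k, P (m, n + 1) (r • freeGen k m n))
    (h3 : ∀ (m' : ℕ) (r : k), m' + 1 = m →
      P (m', n + 1) (r • ((cell k m n True).dh (m, n + 1) (m', n + 1)).hom (freeGen k m n)))
    (b : ℕ × ℤ) (y : (cell k m n True).X b) : P b y := by
  by_cases hs : cellSupp m n True b
  · by_cases hn : b.2 = n
    · rw [← cellIncl_cellProj m n b hn y]
      exact h1 _ _
    · obtain ⟨b1, b2⟩ := b
      obtain rfl : b2 = n + 1 := (hs.2.resolve_left hn).2
      rcases hs.1 with h | h
      · dsimp only at h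
        subst h
        rw [show y = y.1 • freeGen k b1 n from Subtype.ext (mul_one _).symm]
        exact h2 _
      · dsimp only at h
        subst h
        have := h3 b1 y.1 rfl
        rwa [← show y = y.1 • ((cell k (b1 + 1) n True).dh (b1 + 1, n + 1) (b1, n + 1)).hom
          (freeGen k (b1 + 1) n) from Subtype.ext
          ((mul_one _).symm.trans (congr_arg (y.1 * ·) (freeGen_dh_coe b1 n).symm))] at this
  · rw [cell_elt_eq_zero _ _ _ _ hs y, ← map_zero ((cellIncl k m n).f b).hom]
    exact h1 _ _

section

variable {E F : BCh k} {m : ℕ} {n : ℤ}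

/-- A horizontal cycle of horizontal degree zero is determined by its values on the generator. -/
lemma ihom_free_ext {a : ℕ × ℤ} (φ₁ φ₂ : ihomX (cell k m n True) E a)
    (h1 : ∀ b c x, φ₁.1 b c (((cellIncl k m n).f b).hom x) =
      φ₂.1 b c (((cellIncl k m n).f b).hom x))
    (h2 : ∀ c, a + (m, n + 1) = c → φ₁.1 _ c (freeGen k m n) = φ₂.1 _ c (freeGen k m n))
    (h3 : a.1 ≠ 0 → ∀ m', m' + 1 = m → ∀ c, a + (m', n + 1) = c →
      φ₁.1 (m', n + 1) c (((cell k m n True).dh (m, n + 1) (m', n + 1)).hom (freeGen k m n)) =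
      φ₂.1 (m', n + 1) c (((cell k m n True).dh (m, n + 1) (m', n + 1)).hom (freeGen k m n))) :
    φ₁ = φ₂ := by
  rw [← sub_eq_zero]
  set δ := φ₁ - φ₂ with hδ
  have hd : ∀ b c y, δ.1 b c y = φ₁.1 b c y - φ₂.1 b c y := fun _ _ _ => rfl
  have g2 : ∀ c, δ.1 _ c (freeGen k m n) = 0 := fun c => by
    by_cases hc : a + (m, n + 1) = c
    · rw [hd, h2 c hc, sub_self]
    · rw [δ.2.1 _ _ hc]
      rfl
  apply Subtype.ext
  funext b c
  refine LinearMap.ext (fun y => ?_)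
  change δ.1 b c y = 0
  revert c
  revert b y
  apply free_cell_induction
  · intro b x c
    rw [hd, h1, sub_self]
  · intro r c
    rw [map_smul, g2, smul_zero]
  · intro m' r hm c
    rw [map_smul]
    refine (congr_arg (r • ·) ?_).trans (smul_zero _)
    -- In horizontal degree 0, an element of the internal hom is a horizontal cycle, so its value on
    -- d_h of the generator is up to sign d_h of its value on the generator.
    by_cases ha : a.1 = 0
    · have := congr_arg (fun φ : HomFam (cell k m n True) E => φ (m, n + 1) c (freeGen k m n))
        (δ.2.2 ha)
      subst hm
      change homDh _ E (sgn a) δ.1 (m' + 1, n + 1) c (freeGen k (m' + 1) n) = 0 at this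
      rw [homDh_apply, g2, map_zero, zero_sub, neg_eq_zero] at this
      exact (smul_eq_zero_iff_eq _).1 this
    · by_cases hc : a + (m', n + 1) = c
      · rw [hd, h3 ha m' hm c hc, sub_self]
      · rw [δ.2.1 _ _ hc]
        rfl

variable (m n) in
/-- The family of linear maps on a free bicomplex given by its restriction to the subobject
generated by the vertical differential of the generator, and by two more values. -/
noncomputable def glueFam (φ' : HomFam (cell k m n False) E) {c₁ c₂ : ℕ × ℤ} (e₁ : E.X c₁)
    (e₂ : E.X c₂) : HomFam (cell k m n True) E := fun b c =>
  if b.2 = n then (φ' b c).comp (cellProj m n b) else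
    (LinearMap.toSpanSingleton k (E.X c) (if b.1 = m then (E.transport c₁ c).hom e₁ else
      (E.transport c₂ c).hom e₂)).comp (piece k (cellSupp m n True b)).subtype

lemma glueFam_incl (φ' : HomFam (cell k m n False) E) {c₁ c₂ : ℕ × ℤ} (e₁ : E.X c₁)
    (e₂ : E.X c₂) (b c : ℕ × ℤ) (x : (cell k m n False).X b) :
    glueFam m n φ' e₁ e₂ b c (((cellIncl k m n).f b).hom x) = φ' b c x := by
  unfold glueFam
  split_ifs with h h'
  · exact congr_arg _ (cellProj_cellIncl m n b x)
  all_goals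
    rw [cell_elt_eq_zero m n False b (fun h' => by
      rcases h'.2 with h' | h'
      · lia
      · exact h'.1) x, map_zero, map_zero, map_zero]

lemma glueFam_gen (φ' : HomFam (cell k m n False) E) {c₁ c₂ : ℕ × ℤ} (e₁ : E.X c₁)
    (e₂ : E.X c₂) (c : ℕ × ℤ) :
    glueFam m n φ' e₁ e₂ (m, n + 1) c (freeGen k m n) = (E.transport c₁ c).hom e₁ := by
  unfold glueFam
  rw [if_neg (by simp), if_pos rfl]
  exact one_smul _ _

lemma glueFam_gen_dh (φ' : HomFam (cell k m n False) E) {c₁ c₂ : ℕ × ℤ} (e₁ : E.X c₁)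
    (e₂ : E.X c₂) (c : ℕ × ℤ) (m' : ℕ) (hm : m' + 1 = m) :
    glueFam m n φ' e₁ e₂ (m', n + 1) c
      (((cell k m n True).dh (m, n + 1) (m', n + 1)).hom (freeGen k m n)) =
        (E.transport c₂ c).hom e₂ := by
  subst hm
  unfold glueFam
  rw [if_neg (by simp), if_neg (by simp)]
  refine (congr_arg (fun r : k => r • (E.transport c₂ c).hom e₂) (freeGen_dh_coe m' n)).trans ?_
  exact one_smul _ _

/-- As graded modules the free cell is the smaller cell plus two further basis elements, so an
extension is given by two values. For a.1 = 0 the horizontal cycle condition forces the second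
value. If m = 0, no basis element carries e₂. -/
lemma exists_ihom_free {a : ℕ × ℤ} (φ' : ihomX (cell k m n False) E a)
    (e₁ : E.X (a + (m, n + 1))) (e₂ : E.X (a + (m - 1, n + 1)))
    (he : a.1 = 0 → e₂ = sgn a • (E.dh (a + (m, n + 1)) (a + (m - 1, n + 1))).hom e₁) :
    ∃ φ : ihomX (cell k m n True) E a,
      (∀ b c x, φ.1 b c (((cellIncl k m n).f b).hom x) = φ'.1 b c x) ∧
      φ.1 _ _ (freeGen k m n) = e₁ ∧ (∀ m', m' + 1 = m →
        φ.1 (m', n + 1) (a + (m - 1, n + 1))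
          (((cell k m n True).dh (m, n + 1) (m', n + 1)).hom (freeGen k m n)) = e₂) := by
  refine ⟨⟨glueFam m n φ'.1 e₁ e₂, fun b c hc => ?_, fun ha => ?_⟩, fun b c x => ?_, ?_,
    fun m' hm => ?_⟩
  · refine LinearMap.ext (fun y => ?_)
    change glueFam m n φ'.1 e₁ e₂ b c y = 0
    revert hc
    revert b y
    apply free_cell_induction
    · intro b x hc
      rw [glueFam_incl, φ'.2.1 b c hc]
      rfl
    · intro r hc
      rw [map_smul, glueFam_gen, transport_ne _ hc]
      exact smul_zero _
    · intro m' r hm hc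
      rw [map_smul]
      refine (congr_arg (r • ·) (glueFam_gen_dh _ _ _ _ m' hm)).trans ?_
      subst hm
      rw [transport_ne _ (i := a + (m' + 1 - 1, n + 1)) hc]
      exact smul_zero _
  · funext b c
    refine LinearMap.ext (fun y => ?_)
    change homDh _ E (sgn a) (glueFam m n φ'.1 e₁ e₂) b c y = 0
    revert b y
    apply free_cell_induction
    · intro b x
      rw [homDh_apply, ← f_dh_apply, glueFam_incl, glueFam_incl]
      exact congr_arg (fun φ : HomFam (cell k m n False) E => φ b c x) (φ'.2.2 ha)
    · intro r
      rw [map_smul]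
      refine (congr_arg (r • ·) ?_).trans (smul_zero _)
      rw [homDh_apply, glueFam_gen, sub_eq_zero]
      -- For m = 0 the boundary of the generator is zero, and its value lies in column 0, never in
      -- column c.1 + 1.
      rcases m with _ | m
      · rw [dh_eq_zero_of_fst (cell k 0 n True) _ _ rfl, transport_ne _ (fun h => by
          have := congr_arg Prod.fst h
          dsimp at this
          lia)]
        refine (map_zero _).trans (Eq.symm ?_)
        refine (congr_arg _ (map_zero (glueFam 0 n φ'.1 e₁ e₂ _ c))).trans (smul_zero _)
      · refine Eq.trans ?_ (congr_arg (sgn a • ·) (glueFam_gen_dh _ _ _ c m rfl).symm)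
        by_cases hc : a + (m, n + 1) = c
        · subst hc
          rw [he ha]
          have hc' : ((a + (m, n + 1)).1 + 1, (a + (m, n + 1)).2) = a + (m + 1, n + 1) := by
            ext
            · dsimp; ring
            · rfl
          rw [hc', transport_self]
          refine Eq.trans ?_ (congr_arg (sgn a • ·) (transport_self E _ _).symm)
          rw [smul_smul, Int.units_mul_self, one_smul]
          rfl
        · rw [transport_ne _ (fun h => hc ?_), transport_ne _ (i := a + (m + 1 - 1, n + 1)) hc]
          · exact (map_zero _).trans (smul_zero _).symm
          · have h1 := congr_arg Prod.fst h
            have h2 := congr_arg Prod.snd h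
            ext <;> dsimp at * <;> lia
    · intro m' r hm
      rw [map_smul]
      refine (congr_arg (r • ·) ?_).trans (smul_zero _)
      rw [homDh_apply, dh_dh_apply, map_zero, smul_zero, sub_zero, glueFam_gen_dh _ _ _ _ m' hm,
        he ha]
      by_cases hc : a + (m - 1, n + 1) = (c.1 + 1, c.2)
      · rw [hc, transport_self, units_smul_map, dh_dh_apply, smul_zero]
      · rw [transport_ne _ hc]
        exact map_zero _
  · exact glueFam_incl _ _ _ _ _ _
  · refine (glueFam_gen _ _ _ _).trans (transport_self _ _ _)
  · refine (glueFam_gen_dh _ _ _ _ _ hm).trans (transport_self _ _ _)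

end

end BCh

/-! ### Pushout-products of generating cofibrations -/

namespace BCh

variable {k : Type u} [CommRing k] {E F : BCh k}

/-- If d_v y = g x, then an extension φ of φ' with vertical differential χ must satisfy d_v (φ y) =
χ y + s φ' x. The compatibilities make the right side a vertical cycle lying over d_v (ψ y), so the
value e of φ at y is supplied by lifting in column c.1. -/
lemma exists_lift_step (π : E ⟶ F) {X Y : BCh k} (g : X ⟶ Y) (s : ℤˣ) (χ : HomFam Y E)
    (φ' : HomFam X E) (ψ : HomFam Y F)
    (h1 : homDv Y E (-s) χ = 0)
    (h2 : ∀ b c x, χ b c ((g.f b).hom x) = homDv X E s φ' b c x)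
    (h3 : ∀ b c x, (π.f c).hom (φ' b c x) = ψ b c ((g.f b).hom x))
    (h4 : ∀ b c y, (π.f c).hom (χ b c y) = homDv Y F s ψ b c y)
    (b c : ℕ × ℤ) (hc : ColLift π c.1 c.2) (y : Y.X b) (x : X.X (vdeg b))
    (hx : ∀ j, (X.dv (vdeg b) j).hom x = 0)
    (hxy : (g.f (vdeg b)).hom x = (Y.dv b (vdeg b)).hom y) :
    ∃ e : E.X (c.1, c.2 + 1), (π.f _).hom e = ψ b _ y ∧
      (E.dv (c.1, c.2 + 1) c).hom e = χ b c y + s • φ' (vdeg b) c x := by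
  refine hc (χ b c y + s • φ' (vdeg b) c x) (ψ b _ y) (fun j => ?_) ?_
  · by_cases h : j.1 = c.1 ∧ j.2 + 1 = c.2
    · obtain rfl : c = (j.1, j.2 + 1) := Prod.ext h.1.symm h.2.symm
      have e1 : homDv Y E (-s) χ b j y = 0 := by rw [h1]; rfl
      have e2 := h2 (vdeg b) j x
      rw [homDv_apply, ← hxy, e2, homDv_apply, hx, map_zero, smul_zero, sub_zero, Units.neg_smul,
        sub_neg_eq_add] at e1
      rw [map_add, units_smul_map]
      exact e1
    · rw [E.dv_shape _ _ h]
      rfl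
  · have e := h4 b c y
    rw [homDv_apply, ← hxy, ← h3] at e
    refine (map_add _ _ _).trans ?_
    rw [units_smul_map]
    exact eq_sub_iff_add_eq.1 e

lemma homDh_comp (π : E ⟶ F) {Y : BCh k} (s : ℤˣ) (φ : HomFam Y E) :
    homDh Y F s (fun b c => (π.f c).hom.comp (φ b c)) =
      fun b c => (π.f c).hom.comp (homDh Y E s φ b c) := by
  funext b c
  refine LinearMap.ext (fun y => ?_)
  change _ = (π.f c).hom (homDh Y E s φ b c y)
  rw [homDh_apply, homDh_apply, map_sub, units_smul_map, f_dh_apply]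
  rfl

/-- Postcomposition on the internal hom. -/
def ihomComp (π : E ⟶ F) {Y : BCh k} {a : ℕ × ℤ} (φ : ihomX Y E a) : ihomX Y F a :=
  ⟨fun b c => (π.f c).hom.comp (φ.1 b c), fun b c h =>
    (congr_arg (LinearMap.comp (π.f c).hom) (φ.2.1 b c h)).trans (LinearMap.comp_zero _), fun h => by
    rw [homDh_comp, φ.2.2 h]
    funext b c
    exact LinearMap.comp_zero _⟩

/-- φ is determined by its values at the generator and at its horizontal boundary, each obtained
from `exists_lift_step`. The values lie in columns p + m', so lifting is only needed in columns at
least p; hence one lemma serves trivial fibrations, and fibrations when p > 0. -/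
lemma hasLiftingProperty_pushoutProduct_cellIncl (π : E ⟶ F) (p m : ℕ) (q n : ℤ)
    (hπ : ∀ p', p ≤ p' → ∀ q', ColLift π p' q') :
    HasLiftingProperty ((Arrow.pushoutProduct.obj (Arrow.mk (cellIncl k p q))).obj
      (Arrow.mk (cellIncl k m n))).hom π := by
  apply hasLiftingProperty_cellIncl_pushoutProduct
  intro χ φ' ψ h1 h2 h3 h4
  have hs : sgn (p, q) = - sgn (p, q + 1) := sgn_of_v (i := (p, q + 1)) (j := (p, q)) ⟨rfl, rfl⟩
  rw [hs] at h1
  have step := exists_lift_step π (cellIncl k m n) (sgn (p, q + 1)) χ.1 φ'.1 ψ.1 h1 h2 h3 h4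
  have hx : ∀ b (hb : b.2 = n + 1) (y : (cell k m n True).X b),
      ((cellIncl k m n).f (vdeg b)).hom
        (cellProj m n (vdeg b) (((cell k m n True).dv b (vdeg b)).hom y)) =
      ((cell k m n True).dv b (vdeg b)).hom y := fun b hb y =>
    cellIncl_cellProj m n _ (by dsimp; lia) _
  have deg : ∀ m' : ℕ, ((((p, q) + (m', n + 1) : ℕ × ℤ)).1, (((p, q) + (m', n + 1) : ℕ × ℤ)).2 + 1) =
      (p, q + 1) + (m', n + 1) := fun m' => by
    ext
    · rfl
    · dsimp; ring
  have key : ∀ (m' : ℕ) (y : (cell k m n True).X (m', n + 1)),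
      ∃ e : E.X ((p, q + 1) + (m', n + 1)), (π.f _).hom e = ψ.1 _ _ y ∧
      (E.dv ((p, q + 1) + (m', n + 1)) ((p, q) + (m', n + 1))).hom e = χ.1 _ _ y +
        sgn (p, q + 1) • φ'.1 (vdeg (m', n + 1)) _
          (cellProj m n _ (((cell k m n True).dv (m', n + 1) (vdeg (m', n + 1))).hom y)) := by
    intro m' y
    have := step (m', n + 1) ((p, q) + (m', n + 1)) (hπ _ (by dsimp; lia) _) y _
      (fun j => cyc_cell_dv m n _ j _) (hx _ rfl y)
    rw [deg] at this
    exact this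
  obtain ⟨e₁, he₁, he₁'⟩ := key m (freeGen k m n)
  -- For p = 0 the value e₂ is forced by e₁ and needs no verification, since `ihom_free_ext` does
  -- not test it in horizontal degree 0; for p > 0 it is chosen by a second lifting.
  obtain ⟨e₂, he₂, he₂', he⟩ : ∃ e₂ : E.X ((p, q + 1) + (m - 1, n + 1)),
      (p ≠ 0 → (π.f _).hom e₂ = ψ.1 _ _
        (((cell k m n True).dh (m, n + 1) (m - 1, n + 1)).hom (freeGen k m n))) ∧
      (p ≠ 0 → (E.dv ((p, q + 1) + (m - 1, n + 1)) ((p, q) + (m - 1, n + 1))).hom e₂ =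
        χ.1 _ _ (((cell k m n True).dh (m, n + 1) (m - 1, n + 1)).hom (freeGen k m n)) +
        sgn (p, q + 1) • φ'.1 (vdeg (m - 1, n + 1)) _
          (cellProj m n _ (((cell k m n True).dv (m - 1, n + 1) (vdeg (m - 1, n + 1))).hom
            (((cell k m n True).dh (m, n + 1) (m - 1, n + 1)).hom (freeGen k m n))))) ∧
      (p = 0 → e₂ = sgn (p, q + 1) • (E.dh _ _).hom e₁) := by
    by_cases hp : p = 0
    · exact ⟨_, fun h => (h hp).elim, fun h => (h hp).elim, fun _ => rfl⟩
    · obtain ⟨e₂, h, h'⟩ := key (m - 1)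
        (((cell k m n True).dh (m, n + 1) (m - 1, n + 1)).hom (freeGen k m n))
      exact ⟨e₂, fun _ => h, fun _ => h', fun h => (hp h).elim⟩
  obtain ⟨φ, hφ, hφ₁, hφ₂⟩ := exists_ihom_free φ' e₁ e₂ he
  have final : ∀ (m' : ℕ) (y : (cell k m n True).X (m', n + 1)) (c : ℕ × ℤ),
      (p, q) + (m', n + 1) = c → 
      (E.dv ((p, q + 1) + (m', n + 1)) ((p, q) + (m', n + 1))).hom (φ.1 _ _ y) = χ.1 _ _ y +
        sgn (p, q + 1) • φ'.1 (vdeg (m', n + 1)) _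
          (cellProj m n _ (((cell k m n True).dv (m', n + 1) (vdeg (m', n + 1))).hom y)) →
      homDv _ E (sgn (p, q + 1)) φ.1 (m', n + 1) c y = χ.1 (m', n + 1) c y := by
    rintro m' y _ rfl h
    rw [homDv_apply, ← hx (m', n + 1) rfl y, hφ, deg, h, add_sub_cancel_right]
  refine ⟨φ, hφ, fun b c y => ?_, ?_⟩
  · have : ihomComp π φ = ψ := by
      apply ihom_free_ext
      · intro b c x
        refine (congr_arg (π.f c).hom (hφ b c x)).trans (h3 b c x)
      · rintro _ rfl
        exact (congr_arg (π.f _).hom hφ₁).trans he₁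
      · rintro hp m' rfl _ rfl
        exact (congr_arg (π.f _).hom (hφ₂ m' rfl)).trans (he₂ hp)
    exact congr_arg (fun z => z.1 b c y) this
  · have : ihomDv _ E (p, q + 1) (p, q) ⟨rfl, rfl⟩ φ = χ := by
      apply ihom_free_ext
      · intro b c x
        rw [h2]
        change homDv _ E (sgn (p, q + 1)) φ.1 b c _ = _
        rw [homDv_apply, homDv_apply, hφ, ← f_dv_apply, hφ]
      · intro c hc
        exact final m _ c hc (by rw [hφ₁, he₁'])
      · rintro hp m' rfl c hc
        exact final m' _ c hc ((congr_arg _ (hφ₂ m' rfl)).trans (he₂' hp))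
    exact congr_arg Subtype.val this

/-- Only a preimage of ψ at the generator has to be chosen; in horizontal degree 0 the other value
follows, so surjectivity suffices. -/
lemma hasLiftingProperty_pushoutProduct_zero {Z : BCh k} (hZ : IsZero Z) (π : E ⟶ F) (m : ℕ)
    (q n : ℤ) (f : Z ⟶ cell k 0 q True) (hπ : ∀ i, Function.Surjective (π.f i).hom) :
    HasLiftingProperty ((Arrow.pushoutProduct.obj (Arrow.mk f)).obj
      (Arrow.mk (cellIncl k m n))).hom π := by
  apply hasLiftingProperty_zero_pushoutProduct hZ
  intro φ' ψ h
  obtain ⟨e₁, he₁⟩ := hπ _ (ψ.1 (m, n + 1) ((0, q + 1) + (m, n + 1)) (freeGen k m n))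
  obtain ⟨φ, hφ, hφ₁, -⟩ := exists_ihom_free φ' e₁ _ (fun _ => rfl)
  refine ⟨φ, hφ, fun b c y => ?_⟩
  have : ihomComp π φ = ψ := by
    apply ihom_free_ext
    · intro b c x
      refine (congr_arg (π.f c).hom (hφ b c x)).trans (h b c x)
    · rintro _ rfl
      exact (congr_arg (π.f _).hom hφ₁).trans he₁
    · exact fun hp => (hp rfl).elim
  exact congr_arg (fun z => z.1 b c y) this

end BCh

/-! ### Reflecting pushout-product lifting along a fully faithful monoidal functor -/

namespace CategoryTheory.MonoidalCategory

variable {C D : Type*} [Category* C] [Category* D] [MonoidalCategory C] [MonoidalCategory D]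
  [HasPushouts C] [HasPushouts D]

/-- The explicit form of the lifting property involves only tensor products, so it can be
transported along the structure maps of F, without comparing pushouts in C and D. -/
lemma hasLiftingProperty_pushoutProduct_of_map (F : C ⥤ D) [F.Monoidal] [F.Full] [F.Faithful]
    {A B X Y E E' : C} (f : A ⟶ B) (g : X ⟶ Y) (π : E ⟶ E')
    (h : HasLiftingProperty ((Arrow.pushoutProduct.obj (Arrow.mk (F.map f))).obj
      (Arrow.mk (F.map g))).hom (F.map π)) :
    HasLiftingProperty ((Arrow.pushoutProduct.obj (Arrow.mk f)).obj (Arrow.mk g)).hom π := by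
  rw [hasLiftingProperty_pushoutProduct_iff] at h ⊢
  intro α β ψ h1 h2 h3
  obtain ⟨l, l1, l2, l3⟩ := h (Functor.LaxMonoidal.μ F B X ≫ F.map α)
    (Functor.LaxMonoidal.μ F A Y ≫ F.map β) (Functor.LaxMonoidal.μ F B Y ≫ F.map ψ)
    (by
      rw [Functor.LaxMonoidal.μ_natural_left_assoc, Functor.LaxMonoidal.μ_natural_right_assoc,
        ← F.map_comp, ← F.map_comp, h1])
    (by
      rw [Functor.LaxMonoidal.μ_natural_right_assoc, Category.assoc, ← F.map_comp, ← F.map_comp,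
        h2])
    (by
      rw [Functor.LaxMonoidal.μ_natural_left_assoc, Category.assoc, ← F.map_comp, ← F.map_comp,
        h3])
  refine ⟨F.preimage (Functor.OplaxMonoidal.δ F B Y ≫ l), F.map_injective ?_, F.map_injective ?_,
    F.map_injective ?_⟩
  · rw [F.map_comp, F.map_preimage, ← cancel_epi (Functor.LaxMonoidal.μ F B X),
      ← Functor.LaxMonoidal.μ_natural_right_assoc, Functor.Monoidal.μ_δ_assoc, l1]
  · rw [F.map_comp, F.map_preimage, ← cancel_epi (Functor.LaxMonoidal.μ F A Y),
      ← Functor.LaxMonoidal.μ_natural_left_assoc, Functor.Monoidal.μ_δ_assoc, l2]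
  · rw [F.map_comp, F.map_preimage, Category.assoc, l3, Functor.Monoidal.δ_μ_assoc]

end CategoryTheory.MonoidalCategory

/-! ### Monoidal model axioms from lifting properties -/

namespace HomotopicalAlgebra

variable {C : Type*} [Category* C] [ModelCategory C] [MonoidalCategory C] [BraidedCategory C]

/-- Since tensoring with the initial object gives an initial object, the pushout-product of f with ⊥
→ X is essentially f ▷ X. -/
lemma weakEquivalence_whiskerRight_of_cofibration
    (h : ∀ {A B X Y E F : C} (f : A ⟶ B) (g : X ⟶ Y) (π : E ⟶ F) [Cofibration f]
      [WeakEquivalence f] [Cofibration g] [Fibration π], HasLiftingProperty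
        ((MonoidalCategory.Arrow.pushoutProduct.obj (Arrow.mk f)).obj (Arrow.mk g)).hom π)
    (hz : ∀ A : C, Nonempty (IsInitial (A ⊗ ⊥_ C))) {A B : C} (f : A ⟶ B) (X : C)
    [Cofibration f] [WeakEquivalence f] [IsCofibrant X] : WeakEquivalence (f ▷ X) := by
  have : trivialCofibrations C (f ▷ X) := by
    rw [← MorphismProperty.llp_eq_of_wfs (trivialCofibrations C) (fibrations C)]
    intro E F π hπ
    have : Fibration π := (fibration_iff π).2 hπ
    have hl := h f (initial.to X) π
    rw [hasLiftingProperty_pushoutProduct_iff] at hl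
    refine ⟨fun {u v} sq => ?_⟩
    obtain ⟨iA⟩ := hz A
    obtain ⟨iB⟩ := hz B
    obtain ⟨l, -, h2, h3⟩ := hl (iB.to _) u v (iA.hom_ext _ _) (iB.hom_ext _ _) sq.w
    exact ⟨⟨⟨l, h2, h3⟩⟩⟩
  exact ((mem_trivialCofibrations_iff _).1 this).2

/-- The pushout-product and unit axioms follow from lifting properties, for a cofibrant unit. -/
lemma isMonoidalModelCategory_of_hasLiftingProperty
    (h : ∀ {A B X Y E F : C} (f : A ⟶ B) (g : X ⟶ Y) (π : E ⟶ F) [Cofibration f]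
      [Cofibration g] [Fibration π] [WeakEquivalence π], HasLiftingProperty
        ((MonoidalCategory.Arrow.pushoutProduct.obj (Arrow.mk f)).obj (Arrow.mk g)).hom π)
    (h' : ∀ {A B X Y E F : C} (f : A ⟶ B) (g : X ⟶ Y) (π : E ⟶ F) [Cofibration f]
      [WeakEquivalence f] [Cofibration g] [Fibration π], HasLiftingProperty
        ((MonoidalCategory.Arrow.pushoutProduct.obj (Arrow.mk f)).obj (Arrow.mk g)).hom π)
    (hu : IsCofibrant (𝟙_ C)) (hz : ∀ A : C, Nonempty (IsInitial (A ⊗ ⊥_ C))) :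
    IsMonoidalModelCategory C := by
  have hr : ∀ {A B : C} (f : A ⟶ B) (X : C) [Cofibration f] [WeakEquivalence f] [IsCofibrant X],
      WeakEquivalence (f ▷ X) := weakEquivalence_whiskerRight_of_cofibration h' hz
  have hur : ∀ {Q : C} (q : Q ⟶ 𝟙_ C) (X : C) [IsCofibrant Q] [WeakEquivalence q]
      [IsCofibrant X], WeakEquivalence (q ▷ X) := by
    intro Q q X _ _ _
    -- Ken Brown's argument: as Q and the unit are cofibrant, q is a cofibration `b.i` followed by a
    -- retraction `b.p` of a trivial cofibration `b.s`. Tensoring with X keeps `b.i` and `b.s` weak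
    -- equivalences, hence also `b.p`.
    obtain ⟨b⟩ : Nonempty (CofibrantBrownFactorization q) := inferInstance
    have : Cofibration b.i := (cofibration_iff _).2 b.hi
    have h1 := hr b.i X
    have h2 := hr b.s X
    have h3 : WeakEquivalence (b.p ▷ X) :=
      weakEquivalence_of_precomp_of_fac (f := b.s ▷ X) (fg := 𝟙 _)
        (by rw [← comp_whiskerRight, b.s_p, id_whiskerRight])
    rw [← b.fac, comp_whiskerRight]
    infer_instance
  refine ⟨fun f g _ _ => ?_, fun f g _ _ hfg => ?_, hur, fun {Q} q X _ _ _ => ?_⟩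
  · rw [cofibration_iff, ← MorphismProperty.llp_eq_of_wfs (cofibrations C) (trivialFibrations C)]
    intro E F π hπ
    obtain ⟨_, _⟩ := (mem_trivialFibrations_iff π).1 hπ
    exact h f g π
  · refine ((mem_trivialCofibrations_iff _).1 ?_).2
    rw [← MorphismProperty.llp_eq_of_wfs (trivialCofibrations C) (fibrations C)]
    intro E F π hπ
    have : Fibration π := (fibration_iff π).2 hπ
    rcases hfg with hf | hg
    · exact h' f g π
    -- The symmetry exchanges the two factors of the pushout-product.
    · have := h' g f π
      exact (HasLiftingProperty.iff_of_arrow_iso_left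
        (MonoidalCategory.Arrow.PushoutProduct.braiding (Arrow.mk g) (Arrow.mk f)) π).1 this
  · have := hur q X
    have e : X ◁ q = (β_ X Q).hom ≫ q ▷ X ≫ (β_ X (𝟙_ C)).inv := by
      rw [← Category.assoc, ← BraidedCategory.braiding_naturality_right, Category.assoc,
        Iso.hom_inv_id, Category.comp_id]
    rw [e]
    infer_instance

end HomotopicalAlgebra

/-! ### Pure tensors of graded modules -/

namespace GradedKoszul

open scoped TensorProduct

variable {k : Type u} [CommRing k] {I : Type} [AddCommMonoid I] [DecidableEq I]

local notation X " ⊠ " Y => GradedObject.Monoidal.tensorObj X Y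

open GradedObject.Monoidal

/-- The pure tensors in a tensor product of graded modules, in degree `c`, zero unless the degrees
add up to `c`. -/
noncomputable def tmk (X Y : GradedObject I (ModuleCat.{u} k)) (a b c : I) :
    X a →ₗ[k] Y b →ₗ[k] (X ⊠ Y) c :=
  TensorProduct.curry (if h : a + b = c then ιTensorObj X Y a b c h else 0 :
    X a ⊗ Y b ⟶ (X ⊠ Y) c).hom

variable {X Y Z : GradedObject I (ModuleCat.{u} k)}

lemma tmk_eq {a b c : I} (h : a + b = c) (x : X a) (y : Y b) :
    tmk X Y a b c x y = (ιTensorObj X Y a b c h).hom (x ⊗ₜ[k] y) :=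
  congr_arg (fun f : X a ⊗ Y b ⟶ (X ⊠ Y) c => f.hom (x ⊗ₜ[k] y)) (dif_pos h)

lemma tmk_eq_zero {a b c : I} (h : a + b ≠ c) : tmk X Y a b c = 0 := by
  rw [tmk, dif_neg h]
  rfl

lemma tensorObj_hom_ext {c : I} {M : ModuleCat.{u} k} {f g : (X ⊠ Y) c ⟶ M}
    (h : ∀ a b, a + b = c → ∀ x y, f.hom (tmk X Y a b c x y) = g.hom (tmk X Y a b c x y)) :
    f = g := by
  apply tensorObj_ext
  intro a b hab
  ext1
  apply TensorProduct.ext'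
  intro x y
  have := h a b hab x y
  rwa [tmk_eq hab] at this

lemma tensorObjDesc_tmk {c : I} {M : ModuleCat.{u} k} (m : ∀ a b, X a →ₗ[k] Y b →ₗ[k] M)
    {a b : I} (h : a + b = c) (x : X a) (y : Y b) :
    (tensorObjDesc (A := M) (fun a b (_ : a + b = c) =>
      ModuleCat.ofHom (TensorProduct.lift (m a b)))).hom (tmk X Y a b c x y) = m a b x y := by
  rw [tmk_eq h]
  refine (congr_arg (fun f : X a ⊗ Y b ⟶ M => f.hom (x ⊗ₜ[k] y))
    (ι_tensorObjDesc (A := M) _ a b h)).trans ?_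
  exact TensorProduct.lift.tmul _ _

lemma tensorHom_tmk {X' Y' : GradedObject I (ModuleCat.{u} k)} (f : X ⟶ X') (g : Y ⟶ Y')
    (a b c : I) (x : X a) (y : Y b) :
    (GradedObject.Monoidal.tensorHom f g c).hom (tmk X Y a b c x y) =
      tmk X' Y' a b c ((f a).hom x) ((g b).hom y) := by
  by_cases h : a + b = c
  · rw [tmk_eq h, tmk_eq h]
    exact congr_arg (fun t => t.hom (x ⊗ₜ[k] y)) (ι_tensorHom f g a b c h)
  · rw [tmk_eq_zero h, tmk_eq_zero h]
    exact map_zero _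

/-- The intermediate degrees are free variables, so the formula applies to degrees that are equal
only propositionally. -/
lemma associator_tmk {a b c ab bc j : I} (h : a + b = ab) (h' : b + c = bc) (x : X a) (y : Y b)
    (z : Z c) :
    ((GradedObject.Monoidal.associator X Y Z).hom j).hom
      (tmk (X ⊠ Y) Z ab c j (tmk X Y a b ab x y) z) =
      tmk X (Y ⊠ Z) a bc j x (tmk Y Z b c bc y z) := by
  by_cases hj : a + b + c = j
  · have hj' : a + bc = j := by rw [← h', ← add_assoc, hj]
    have hj'' : ab + c = j := by rw [← h, hj]
    rw [tmk_eq hj'', tmk_eq hj', tmk_eq h, tmk_eq h']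
    have e := ιTensorObj₃'_associator_hom X Y Z a b c j hj
    rw [ιTensorObj₃'_eq X Y Z a b c j hj ab h, ιTensorObj₃_eq X Y Z a b c j hj bc h'] at e
    exact congr_arg (fun t => t.hom ((x ⊗ₜ[k] y) ⊗ₜ[k] z)) e
  · rw [tmk_eq_zero (X := X ⊠ Y) (Y := Z) (fun h'' => hj (by rw [h, h''])),
      tmk_eq_zero (X := X) (Y := Y ⊠ Z) (fun h'' => hj (by rw [add_assoc, h', h'']))]
    exact map_zero _

lemma braidingHom_tmk (ε : Multiplicative I →* ℤˣ) (a b j : I) (x : X a) (y : Y b) :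
    (braidingHom ε X Y j).hom (tmk X Y a b j x y) =
      koszul (ε (.ofAdd a)) (ε (.ofAdd b)) • tmk Y X b a j y x := by
  by_cases h : a + b = j
  · have h' : b + a = j := by rw [add_comm, h]
    rw [tmk_eq h, tmk_eq h']
    refine (congr_arg (fun t => t.hom (x ⊗ₜ[k] y)) (ι_braidingHom ε X Y a b j h)).trans ?_
    generalize koszul (ε (.ofAdd a)) (ε (.ofAdd b)) = s
    rcases Int.units_eq_one_or s with rfl | rfl
    · rw [one_smul, one_smul]
      rfl
    · rw [Units.neg_smul, one_smul, Units.neg_smul, one_smul]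
      rfl
  · have h' : b + a ≠ j := by rwa [add_comm]
    rw [tmk_eq_zero h, tmk_eq_zero h']
    exact (map_zero _).trans (smul_zero _).symm

open HomologicalComplex

variable (k I) in
/-- The identification of the unit in degree zero with the base ring. -/
noncomputable def gradedUnitZeroIso : gradedUnit k I 0 ≅ 𝟙_ (ModuleCat.{u} k) :=
  ((GradedObject.eval 0).mapIso (gradedUnitIso k I)).symm ≪≫ tensorUnit₀

variable (k I) in
/-- The generator of the unit. -/
noncomputable def unitElt : gradedUnit k I 0 :=
  (gradedUnitZeroIso k I).inv.hom (1 : k)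

/-- The inverse unitor is x ↦ 1 ⊗ x; the unitality of the comparison is checked after composing with
it. -/
lemma gradedLeftUnitor_inv_apply (i : I) (x : X i) :
    ((gradedLeftUnitor X).inv i).hom x = tmk (gradedUnit k I) X 0 i i (unitElt k I) x := by
  refine Eq.trans ?_ (tensorHom_tmk (gradedUnitIso k I).hom (𝟙 X) 0 i i
    ((tensorUnit₀ (C := ModuleCat.{u} k) (I := I)).inv.hom (1 : k)) x)
  exact congr_arg (GradedObject.Monoidal.tensorHom (gradedUnitIso k I).hom (𝟙 X) i).hom
    (tmk_eq (X := (GradedObject.single₀ I).obj (𝟙_ (ModuleCat.{u} k))) (zero_add i) _ x).symm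

lemma gradedRightUnitor_inv_apply (i : I) (x : X i) :
    ((gradedRightUnitor X).inv i).hom x = tmk X (gradedUnit k I) i 0 i x (unitElt k I) := by
  refine Eq.trans ?_ (tensorHom_tmk (𝟙 X) (gradedUnitIso k I).hom i 0 i x
    ((tensorUnit₀ (C := ModuleCat.{u} k) (I := I)).inv.hom (1 : k)))
  exact congr_arg (GradedObject.Monoidal.tensorHom (𝟙 X) (gradedUnitIso k I).hom i).hom
    (tmk_eq (Y := (GradedObject.single₀ I).obj (𝟙_ (ModuleCat.{u} k))) (add_zero i) x _).symm

/-- The map from the unit attached to an element in degree zero. -/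
noncomputable def ofUnit (e : X 0) (a : I) : gradedUnit k I a ⟶ X a :=
  if h : a = 0 then eqToHom (congr_arg (gradedUnit k I) h) ≫ (gradedUnitZeroIso k I).hom ≫
    ModuleCat.ofHom (LinearMap.toSpanSingleton k (X 0) e) ≫ eqToHom (congr_arg X h.symm) else 0

lemma ofUnit_zero (e : X 0) : (ofUnit e 0).hom (unitElt k I) = e := by
  rw [ofUnit, dif_pos rfl, eqToHom_refl, eqToHom_refl, Category.id_comp, Category.comp_id]
  have := congr_arg (fun f : 𝟙_ (ModuleCat.{u} k) ⟶ 𝟙_ (ModuleCat.{u} k) => f.hom (1 : k))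
    (gradedUnitZeroIso k I).inv_hom_id
  refine (congr_arg (LinearMap.toSpanSingleton k (X 0) e) this).trans ?_
  exact one_smul _ _

lemma ofUnit_ne (e : X 0) (a : I) (h : a ≠ 0) : ofUnit e a = 0 := dif_neg h

lemma gradedUnit_hom_ext {M : ModuleCat.{u} k} {f g : gradedUnit k I 0 ⟶ M}
    (h : f.hom (unitElt k I) = g.hom (unitElt k I)) : f = g := by
  rw [← cancel_epi (gradedUnitZeroIso k I).inv]
  ext1
  exact LinearMap.ext_ring h

end GradedKoszul

/-! ### Cofibrancy of the unit bicomplex -/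

namespace BCh

open GradedKoszul

variable {k : Type u} [CommRing k]

lemma colLift_cycle {E F : BCh k} (π : E ⟶ F) (p : ℕ) (h : ∀ q, ColLift π p q) (q : ℤ)
    (y : F.X (p, q)) (hy : ∀ j, (F.dv (p, q) j).hom y = 0) :
    ∃ x : E.X (p, q), (π.f (p, q)).hom x = y ∧ ∀ j, (E.dv (p, q) j).hom x = 0 := by
  obtain ⟨q, rfl⟩ : ∃ q', q = q' + 1 := ⟨q - 1, by ring⟩
  obtain ⟨x, h1, h2⟩ := h q 0 y (by simp) (by rw [map_zero, hy])
  exact ⟨x, h1, dv_apply_eq_zero E p q x h2⟩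

/-- The morphism from the unit attached to a vertical cycle. -/
noncomputable def unitHom {A : BCh k} (e : A.X (0, 0)) (he : ∀ j, (A.dv (0, 0) j).hom e = 0) :
    𝟙_ (BCh k) ⟶ A where
  f := ofUnit (X := A.X) e
  comm_h i j := by
    refine Eq.trans ?_ (zero_comp (f := ofUnit (X := A.X) e j)).symm
    by_cases h : i = 0
    · subst h
      exact (congr_arg _ (dh_zero A 0 j)).trans comp_zero
    · rw [ofUnit_ne _ _ h]
      exact zero_comp
  comm_v i j := by
    refine Eq.trans ?_ (zero_comp (f := ofUnit (X := A.X) e j)).symm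
    by_cases h : i = 0
    · subst h
      refine gradedUnit_hom_ext (k := k) (I := ℕ × ℤ) (M := A.X j)
        (f := ofUnit (X := A.X) e 0 ≫ A.dv 0 j) (g := 0) ?_
      exact (congr_arg (A.dv (0, 0) j).hom (ofUnit_zero (X := A.X) e)).trans (he j)
    · rw [ofUnit_ne _ _ h]
      exact zero_comp

lemma unitHom_apply {A : BCh k} (e : A.X (0, 0)) (he : ∀ j, (A.dv (0, 0) j).hom e = 0) :
    ((unitHom e he).f 0).hom (unitElt k (ℕ × ℤ)) = e := ofUnit_zero (X := A.X) e

lemma unit_hom_ext {A : BCh k} {φ ψ : 𝟙_ (BCh k) ⟶ A}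
    (h : (φ.f 0).hom (unitElt k (ℕ × ℤ)) = (ψ.f 0).hom (unitElt k (ℕ × ℤ))) : φ = ψ := by
  ext a : 1
  by_cases ha : a = 0
  · subst ha
    exact gradedUnit_hom_ext (k := k) (I := ℕ × ℤ) (M := A.X 0) (f := φ.f 0) (g := ψ.f 0) h
  · exact (HomologicalComplex.isZero_gradedUnit a ha).eq_of_src _ _

/-- Maps from the unit are vertical cycles in bidegree (0, 0), and lifting in column 0 with x = 0
lifts cycles to cycles. -/
lemma hasLiftingProperty_unit {Z E F : BCh k} (hZ : IsZero Z) (i : Z ⟶ 𝟙_ (BCh k)) (π : E ⟶ F)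
    (h : ∀ q, ColLift π 0 q) : HasLiftingProperty i π := by
  refine ⟨fun {u v} sq => ?_⟩
  obtain ⟨x, hx, hx'⟩ := colLift_cycle π 0 h 0 ((v.f 0).hom (unitElt k (ℕ × ℤ)))
    (fun j => (f_dv_apply v 0 j _).symm.trans (map_zero (v.f j).hom))
  refine ⟨⟨⟨unitHom x hx', hZ.eq_of_src _ _, unit_hom_ext ?_⟩⟩⟩
  exact (congr_arg (π.f 0).hom (unitHom_apply x hx')).trans hx

end BCh

/-! ### The total model structure is monoidal -/

namespace BCh

open MorphismProperty

variable (k : Type u) [CommRing k]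

lemma hasLiftingProperty_pushoutProduct_of_cofGen {A B X Y E F : BCh k} (f : A ⟶ B) (g : X ⟶ Y)
    (π : E ⟶ F) (hf : (cofGen k).rlp.llp f) (hg : (cofGen k).rlp.llp g) (hπ : (cofGen k).rlp π) :
    HasLiftingProperty ((Arrow.pushoutProduct.obj (Arrow.mk f)).obj (Arrow.mk g)).hom π := by
  refine hasLiftingProperty_pushoutProduct_of_llp_rlp (cofGen k) (cofGen k) (cofGen k).rlp ?_
    f g π hf hg hπ
  rintro _ _ _ _ E F _ _ π ⟨⟨p, q⟩⟩ ⟨⟨m, n⟩⟩ hπ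
  exact hasLiftingProperty_pushoutProduct_cellIncl π p m q n
    (fun p' _ => (cofGen_rlp_iff π).1 hπ p')

/-- On generators, horizontal degree 0 uses only the surjectivity of π, and horizontal degree p + 1
uses only its lifting in columns at least p + 1. -/
lemma hasLiftingProperty_pushoutProduct_of_trivGen {A B X Y E F : BCh k} (f : A ⟶ B) (g : X ⟶ Y)
    (π : E ⟶ F) (hf : (trivGen k).rlp.llp f) (hg : (cofGen k).rlp.llp g)
    (hπ : (trivGen k).rlp π) :
    HasLiftingProperty ((Arrow.pushoutProduct.obj (Arrow.mk f)).obj (Arrow.mk g)).hom π := by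
  refine hasLiftingProperty_pushoutProduct_of_llp_rlp (trivGen k) (cofGen k) (trivGen k).rlp ?_
    f g π hf hg hπ
  rintro _ _ _ _ E F _ _ π ⟨⟨_ | p, q⟩⟩ ⟨⟨m, n⟩⟩ hπ
  · exact hasLiftingProperty_pushoutProduct_zero (isZero_zero _) π m q n (trivIncl k 0 q)
      ((trivGen_rlp_iff π).1 hπ).1
  · exact hasLiftingProperty_pushoutProduct_cellIncl π (p + 1) m q n
      (fun p' hp q' => ((trivGen_rlp_iff_colLift π).1 hπ).1 p' q' (by lia))

lemma isMonoidalModelCategory_totModel :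
    letI := totModel k
    IsMonoidalModelCategory (BCh k) :=
  letI := totModel k
  isMonoidalModelCategory_of_hasLiftingProperty
    (fun f g π hf hg h h' => hasLiftingProperty_pushoutProduct_of_cofGen k f g π
      ((cofibration_iff f).1 hf) ((cofibration_iff g).1 hg)
      ((cofGen_rlp k).symm.le π ⟨(fibration_iff π).1 h, (weakEquivalence_iff π).1 h'⟩))
    (fun f g π hf hf' hg h => hasLiftingProperty_pushoutProduct_of_trivGen k f g π
      ((IsGrothendieckAbelian.modelCategory_cofibration_and_weakEquivalence_iff _ _ _ (cofGen_le k)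
        (trivGen_le k) (cofGen_rlp k) (trivGen_rlp_llp_le k) f).1 ⟨hf, hf'⟩)
      ((cofibration_iff g).1 hg) ((fibration_iff π).1 h))
    ((cofibration_iff _).2 (fun E F π hπ => hasLiftingProperty_unit
      ((isZero_zero (BCh k)).of_iso (initialIsInitial.uniqueUpToIso HasZeroObject.zeroIsInitial)) _ _
      ((cofGen_rlp_iff π).1 hπ 0)))
    (fun A => ⟨initialIsInitial.isInitialObj (tensorLeft A) _⟩)

end BCh

/-! ### The Leibniz rule on pure tensors of chain complexes -/

namespace Ch

open GradedKoszul
open scoped TensorProduct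

variable {k : Type u} [CommRing k]

lemma tensor_d_tmk (K L : Ch k) (a b c : ℤ) (x : K.X a) (y : L.X b) :
    ((HomologicalComplex.tensorObj K L).d (c + 1) c).hom (tmk K.X L.X a b (c + 1) x y) =
      tmk K.X L.X (a - 1) b c ((K.d a (a - 1)).hom x) y +
        a.negOnePow • tmk K.X L.X a (b - 1) c x ((L.d b (b - 1)).hom y) := by
  by_cases h : a + b = c + 1
  · have ha : (ComplexShape.down ℤ).next a = a - 1 :=
      (ComplexShape.down ℤ).next_eq' (show a - 1 + 1 = a by ring)
    have hb : (ComplexShape.down ℤ).next b = b - 1 :=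
      (ComplexShape.down ℤ).next_eq' (show b - 1 + 1 = b by ring)
    have e := HomologicalComplex.ι_tensor_d K L a b (c + 1) c h
    rw [ha, hb, HomologicalComplex.ιMapBifunctorOrZero_eq _ _ _ _ _ _ _
        (show a - 1 + b = c by lia),
      HomologicalComplex.ιMapBifunctorOrZero_eq _ _ _ _ _ _ _ (show a + (b - 1) = c by lia)] at e
    rw [tmk_eq h, tmk_eq (show a - 1 + b = c by lia), tmk_eq (show a + (b - 1) = c by lia)]
    exact congr_arg (fun t => t.hom (x ⊗ₜ[k] y)) e
  · rw [tmk_eq_zero h, tmk_eq_zero (show a - 1 + b ≠ c by lia),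
      tmk_eq_zero (show a + (b - 1) ≠ c by lia)]
    refine (map_zero _).trans (Eq.symm ((zero_add _).trans
      (smul_zero (A := (HomologicalComplex.tensorObj K L).X c) a.negOnePow)))

end Ch

/-! ### Comparison of the tensor products of complexes and bicomplexes -/

namespace BCh

open GradedKoszul
open scoped TensorProduct

variable {k : Type u} [CommRing k]

lemma associator_univ {A B C : BCh k} {a b c ab bc j : ℕ × ℤ} (h : a + b = ab) (h' : b + c = bc)
    (x : A.X a) (y : B.X b) (z : C.X c) :
    ((α_ A B C).hom.f j).hom
      (Pairing.univ (A ⊗ B) C ab c j (Pairing.univ A B a b ab x y) z) =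
      Pairing.univ A (B ⊗ C) a bc j x (Pairing.univ B C b c bc y z) :=
  associator_tmk (X := A.X) (Y := B.X) (Z := C.X) h h' x y z

lemma leftUnitor_inv_univ (A : BCh k) (a : ℕ × ℤ) (x : A.X a) :
    ((λ_ A).inv.f a).hom x = Pairing.univ (𝟙_ (BCh k)) A 0 a a (unitElt k (ℕ × ℤ)) x :=
  gradedLeftUnitor_inv_apply (X := A.X) a x

lemma rightUnitor_inv_univ (A : BCh k) (a : ℕ × ℤ) (x : A.X a) :
    ((ρ_ A).inv.f a).hom x = Pairing.univ A (𝟙_ (BCh k)) a 0 a x (unitElt k (ℕ × ℤ)) :=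
  gradedRightUnitor_inv_apply (X := A.X) a x

lemma braiding_univ (A B : BCh k) (a b c : ℕ × ℤ) (x : A.X a) (y : B.X b) :
    ((β_ A B).hom.f c).hom (Pairing.univ A B a b c x y) =
      koszul (sgn a) (sgn b) • Pairing.univ B A b a c y x :=
  braidingHom_tmk (X := A.X) (Y := B.X) totalSign a b c x y

lemma tensor₃_hom_ext {A B C : BCh k} {j : ℕ × ℤ} {M : ModuleCat.{u} k}
    {f g : ((A ⊗ B) ⊗ C).X j ⟶ M}
    (h : ∀ a b c, a + b + c = j → ∀ x y z,
      f.hom (Pairing.univ (A ⊗ B) C (a + b) c j (Pairing.univ A B a b (a + b) x y) z) =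
      g.hom (Pairing.univ (A ⊗ B) C (a + b) c j (Pairing.univ A B a b (a + b) x y) z)) :
    f = g := by
  apply Pairing.tensor_hom_ext
  intro ab c hc w z
  have : ModuleCat.ofHom (f.hom.comp ((Pairing.univ (A ⊗ B) C ab c j).flip z)) =
      ModuleCat.ofHom (g.hom.comp ((Pairing.univ (A ⊗ B) C ab c j).flip z)) := by
    apply Pairing.tensor_hom_ext
    rintro a b rfl x y
    exact h a b c hc x y z
  exact congr_arg (fun t : (A ⊗ B).X ab ⟶ M => t.hom w) this

section inclTensor

variable (K L : Ch k)

/-- The bilinear maps which correspond to the comparison of the tensor products of complexes and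
of bicomplexes. -/
noncomputable def inclTmk : ∀ a b c : ℕ × ℤ,
    inclX K a →ₗ[k] inclX L b →ₗ[k] inclX (K ⊗ L) c
  | (0, a), (0, b), (0, c) => tmk K.X L.X a b c
  | (0, _), (0, _), (_ + 1, _) => 0
  | (0, _), (_ + 1, _), _ => 0
  | (_ + 1, _), _, _ => 0

/-- The pairing which corresponds to the comparison of the tensor products of complexes and
of bicomplexes. -/
noncomputable def inclPairing : Pairing ((incl k).obj K) ((incl k).obj L) ((incl k).obj (K ⊗ L)) where
  m := inclTmk K L
  m_zero := by
    rintro ⟨_ | p, a⟩ ⟨_ | p', b⟩ ⟨_ | p'', c⟩ h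
    · exact tmk_eq_zero (X := K.X) (Y := L.X) (fun h' => h (by rw [← h']; rfl))
    all_goals rfl
  m_dh a b c w y := by
    refine Eq.symm ((congr_arg₂ (· + ·) ?_ ?_).trans (add_zero (0 : inclX (K ⊗ L) c)))
    · exact congr_arg (fun t => t y) (map_zero (inclTmk K L (hdeg a) b c))
    · exact (congr_arg (sgn a • ·) (map_zero (inclTmk K L a (hdeg b) c w))).trans
        (smul_zero (A := inclX (K ⊗ L) c) (sgn a))
  m_dv := by
    rintro ⟨_ | p, a⟩ ⟨_ | p', b⟩ ⟨_ | p'', c⟩ w y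
    · refine (Ch.tensor_d_tmk K L a b c w y).trans ?_
      -- The total degree of (0, a) is a, so the two Leibniz rules carry the same sign.
      have : sgn (0, a) = a.negOnePow := congr_arg Int.negOnePow (zero_add a)
      rw [this]
      rfl
    · exact Subsingleton.elim (α := PUnit) _ _
    · refine (map_zero _).trans (Eq.symm ((congr_arg (0 + ·) (smul_zero _)).trans (add_zero _)))
    · exact Subsingleton.elim (α := PUnit) _ _
    · refine (map_zero _).trans (Eq.symm ((congr_arg (0 + ·) (smul_zero _)).trans (add_zero _)))
    · exact Subsingleton.elim (α := PUnit) _ _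
    · refine (map_zero _).trans (Eq.symm ((congr_arg (0 + ·) (smul_zero _)).trans (add_zero _)))
    · exact Subsingleton.elim (α := PUnit) _ _

/-- If two horizontal degrees add up to p + 1, one of them is positive, and that factor is zero. -/
lemma isZero_incl_tensor (p : ℕ) (q : ℤ) :
    IsZero (((incl k).obj K ⊗ (incl k).obj L).X (p + 1, q)) := by
  rw [IsZero.iff_id_eq_zero]
  apply Pairing.tensor_hom_ext
  rintro ⟨_ | a1, a⟩ ⟨_ | b1, b⟩ h x y
  · have := congr_arg Prod.fst h
    dsimp at this
    lia
  · obtain rfl : y = 0 := Subsingleton.elim (α := PUnit) _ _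
    rw [map_zero, map_zero, map_zero]
  all_goals
    obtain rfl : x = 0 := Subsingleton.elim (α := PUnit) _ _
    rw [map_zero, LinearMap.zero_apply, map_zero, map_zero]

/-- The components of the inverse of the comparison of tensor products. -/
noncomputable def inclTensorInv (c : ℤ) :
    (K ⊗ L).X c ⟶ ((incl k).obj K ⊗ (incl k).obj L).X (0, c) :=
  GradedObject.Monoidal.tensorObjDesc (X₁ := K.X) (X₂ := L.X)
    (A := ((incl k).obj K ⊗ (incl k).obj L).X (0, c)) (fun a b (_ : a + b = c) =>
      ModuleCat.ofHom (TensorProduct.lift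
        (Pairing.univ ((incl k).obj K) ((incl k).obj L) (0, a) (0, b) (0, c))))

lemma inclTensorInv_tmk {a b c : ℤ} (h : a + b = c) (x : K.X a) (y : L.X b) :
    (inclTensorInv K L c).hom (tmk K.X L.X a b c x y) =
      Pairing.univ ((incl k).obj K) ((incl k).obj L) (0, a) (0, b) (0, c) x y :=
  tensorObjDesc_tmk (X := K.X) (Y := L.X)
    (M := ((incl k).obj K ⊗ (incl k).obj L).X (0, c))
    (fun a b => Pairing.univ ((incl k).obj K) ((incl k).obj L) (0, a) (0, b) (0, c)) h x y

lemma inclPairing_toHom_univ (a b c : ℤ) (x : K.X a) (y : L.X b) :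
    ((inclPairing K L).toHom.f (0, c)).hom
      (Pairing.univ ((incl k).obj K) ((incl k).obj L) (0, a) (0, b) (0, c) x y) =
        tmk K.X L.X a b c x y :=
  Pairing.toHomX_univ (inclPairing K L) (0, a) (0, b) (0, c) x y

/-- Extensionality for maps from the tensor product of two complexes in horizontal degree
zero. -/
lemma incl_tensor_hom_ext {K L : Ch k} {c : ℤ} {M : ModuleCat.{u} k}
    {f g : ((incl k).obj K ⊗ (incl k).obj L).X (0, c) ⟶ M}
    (h : ∀ a b, a + b = c → ∀ (x : K.X a) (y : L.X b),
      f.hom (Pairing.univ ((incl k).obj K) ((incl k).obj L) (0, a) (0, b) (0, c) x y) =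
      g.hom (Pairing.univ ((incl k).obj K) ((incl k).obj L) (0, a) (0, b) (0, c) x y)) :
    f = g := by
  apply Pairing.tensor_hom_ext
  rintro ⟨a1, a⟩ ⟨b1, b⟩ hab x y
  have h1 := congr_arg Prod.fst hab
  have h2 := congr_arg Prod.snd hab
  dsimp at h1 h2
  obtain rfl : a1 = 0 := by lia
  obtain rfl : b1 = 0 := by lia
  exact h a b h2 x y

/-- The components of the comparison of the tensor products of complexes and of bicomplexes. -/
noncomputable def inclTensorIsoX : ∀ i : ℕ × ℤ,
    ((incl k).obj K ⊗ (incl k).obj L).X i ≅ ((incl k).obj (K ⊗ L)).X i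
  | (0, c) =>
    { hom := (inclPairing K L).toHom.f (0, c)
      inv := inclTensorInv K L c
      hom_inv_id := by
        apply incl_tensor_hom_ext
        intro a b h x y
        refine (congr_arg (inclTensorInv K L c).hom (inclPairing_toHom_univ K L a b c x y)).trans ?_
        exact inclTensorInv_tmk K L h x y
      inv_hom_id := by
        refine tensorObj_hom_ext (X := K.X) (Y := L.X) (c := c) (M := (K ⊗ L).X c)
          (f := inclTensorInv K L c ≫ (inclPairing K L).toHom.f (0, c)) (g := 𝟙 ((K ⊗ L).X c)) ?_
        intro a b h x y
        refine (congr_arg ((inclPairing K L).toHom.f (0, c)).hom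
          (inclTensorInv_tmk K L h x y)).trans ?_
        exact inclPairing_toHom_univ K L a b c x y }
  | (p + 1, c) =>
    { hom := (inclPairing K L).toHom.f (p + 1, c)
      inv := 0
      hom_inv_id := (isZero_incl_tensor K L p c).eq_of_src _ _
      inv_hom_id := by
        ext x
        exact Subsingleton.elim (α := PUnit) _ _ }

lemma inclTensorIsoX_hom (i : ℕ × ℤ) :
    (inclTensorIsoX K L i).hom = (inclPairing K L).toHom.f i := by
  obtain ⟨_ | p, c⟩ := i <;> rfl

/-- The comparison of the tensor products of complexes and of bicomplexes. -/
noncomputable def inclTensorIso :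
    (incl k).obj K ⊗ (incl k).obj L ≅ (incl k).obj (K ⊗ L) :=
  isoOfComponents (inclTensorIsoX K L)
    (fun i j => by
      rw [inclTensorIsoX_hom, inclTensorIsoX_hom]
      exact (inclPairing K L).toHom.comm_h i j)
    (fun i j => by
      rw [inclTensorIsoX_hom, inclTensorIsoX_hom]
      exact (inclPairing K L).toHom.comm_v i j)

lemma inclTensorIso_univ (a b c : ℤ) (x : K.X a) (y : L.X b) :
    ((inclTensorIso K L).hom.f (0, c)).hom
      (Pairing.univ ((incl k).obj K) ((incl k).obj L) (0, a) (0, b) (0, c) x y) =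
        tmk K.X L.X a b c x y :=
  inclPairing_toHom_univ K L a b c x y

end inclTensor

end BCh

/-! ### The inclusion is strong symmetric monoidal -/

namespace BCh

open GradedKoszul

variable {k : Type u} [CommRing k]

variable (k) in
/-- The morphism from the unit bicomplex to the unit complex in horizontal degree zero. -/
noncomputable def inclUnitHom : 𝟙_ (BCh k) ⟶ (incl k).obj (𝟙_ (Ch k)) :=
  unitHom (A := (incl k).obj (𝟙_ (Ch k))) (unitElt k ℤ) (by
    rintro ⟨_ | p, q⟩ <;> rfl)

lemma inclUnitHom_apply :
    ((inclUnitHom k).f 0).hom (unitElt k (ℕ × ℤ)) = unitElt k ℤ :=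
  unitHom_apply (A := (incl k).obj (𝟙_ (Ch k))) (unitElt k ℤ) _

/-- The generator of the unit complex, in horizontal degree zero. -/
noncomputable def inclUnitElt : ((incl k).obj (𝟙_ (Ch k))).X (0, 0) := unitElt k ℤ

lemma incl_unit_hom_ext {M : ModuleCat.{u} k} {f g : ((incl k).obj (𝟙_ (Ch k))).X (0, 0) ⟶ M}
    (h : f.hom inclUnitElt = g.hom inclUnitElt) : f = g := by
  have key : ∀ f g : HomologicalComplex.gradedUnit k ℤ 0 ⟶ M,
    f.hom (unitElt k ℤ) = g.hom (unitElt k ℤ) → f = g := fun _ _ => gradedUnit_hom_ext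
  exact key f g h

lemma isZero_incl_unit (q : ℤ) (h : q ≠ 0) : IsZero (((incl k).obj (𝟙_ (Ch k))).X (0, q)) :=
  HomologicalComplex.isZero_gradedUnit (k := k) (I := ℤ) q h

variable (k) in
/-- The components of the inverse of the comparison of units. -/
noncomputable def inclUnitInv (q : ℤ) :
    ((incl k).obj (𝟙_ (Ch k))).X (0, q) ⟶ (𝟙_ (BCh k)).X (0, q) :=
  ofUnit (k := k) (X := fun q => (𝟙_ (BCh k)).X (0, q)) (unitElt k (ℕ × ℤ)) q

lemma inclUnitInv_apply : (inclUnitInv k 0).hom inclUnitElt = unitElt k (ℕ × ℤ) :=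
  ofUnit_zero (k := k) (X := fun q => (𝟙_ (BCh k)).X (0, q)) (unitElt k (ℕ × ℤ))

variable (k) in
/-- The components of the comparison of units. -/
noncomputable def inclUnitIsoX : ∀ i : ℕ × ℤ,
    (𝟙_ (BCh k)).X i ≅ ((incl k).obj (𝟙_ (Ch k))).X i
  | (0, q) =>
    { hom := (inclUnitHom k).f (0, q)
      inv := inclUnitInv k q
      hom_inv_id := by
        by_cases h : q = 0
        · subst h
          refine gradedUnit_hom_ext (k := k) (I := ℕ × ℤ) (M := (𝟙_ (BCh k)).X (0, 0))
            (f := (inclUnitHom k).f (0, 0) ≫ inclUnitInv k 0) (g := 𝟙 _) ?_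
          exact (congr_arg (inclUnitInv k 0).hom inclUnitHom_apply).trans inclUnitInv_apply
        · exact (HomologicalComplex.isZero_gradedUnit (k := k) (I := ℕ × ℤ) (0, q)
            (fun h' => h (congr_arg Prod.snd h'))).eq_of_src _ _
      inv_hom_id := by
        by_cases h : q = 0
        · subst h
          apply incl_unit_hom_ext
          exact (congr_arg ((inclUnitHom k).f (0, 0)).hom inclUnitInv_apply).trans inclUnitHom_apply
        · exact (isZero_incl_unit q h).eq_of_src _ _ }
  | (p + 1, q) =>
    { hom := (inclUnitHom k).f (p + 1, q)
      inv := 0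
      hom_inv_id := (HomologicalComplex.isZero_gradedUnit (k := k) (I := ℕ × ℤ) (p + 1, q)
        (fun h' => Nat.succ_ne_zero p (congr_arg Prod.fst h'))).eq_of_src _ _
      inv_hom_id := by
        ext x
        exact Subsingleton.elim (α := PUnit) _ _ }

lemma inclUnitIsoX_hom (i : ℕ × ℤ) : (inclUnitIsoX k i).hom = (inclUnitHom k).f i := by
  obtain ⟨_ | p, c⟩ := i <;> rfl

variable (k) in
/-- The comparison of units. -/
noncomputable def inclUnitIso : 𝟙_ (BCh k) ≅ (incl k).obj (𝟙_ (Ch k)) :=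
  isoOfComponents (inclUnitIsoX k)
    (fun i j => by
      rw [inclUnitIsoX_hom, inclUnitIsoX_hom]
      exact (inclUnitHom k).comm_h i j)
    (fun i j => by
      rw [inclUnitIsoX_hom, inclUnitIsoX_hom]
      exact (inclUnitHom k).comm_v i j)

lemma inclUnitIso_apply :
    ((inclUnitIso k).hom.f 0).hom (unitElt k (ℕ × ℤ)) = unitElt k ℤ :=
  inclUnitHom_apply

lemma inclTensorIso_natural_left {K K' : Ch k} (f : K ⟶ K') (L : Ch k) :
    (incl k).map f ▷ (incl k).obj L ≫ (inclTensorIso K' L).hom =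
      (inclTensorIso K L).hom ≫ (incl k).map (f ▷ L) := by
  apply hom_incl_ext
  intro q
  apply incl_tensor_hom_ext
  intro a b h x y
  refine (congr_arg ((inclTensorIso K' L).hom.f (0, q)).hom
    (univ_whiskerRight ((incl k).map f) ((incl k).obj L) (0, a) (0, b) (0, q) x y)).trans ?_
  refine (inclTensorIso_univ K' L a b q ((f.f a).hom x) y).trans ?_
  refine Eq.symm ((congr_arg ((f ▷ L).f q).hom (inclTensorIso_univ K L a b q x y)).trans ?_)
  exact tensorHom_tmk f.f (𝟙 L.X) a b q x y

lemma inclTensorIso_natural_right {L L' : Ch k} (K : Ch k) (f : L ⟶ L') :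
    (incl k).obj K ◁ (incl k).map f ≫ (inclTensorIso K L').hom =
      (inclTensorIso K L).hom ≫ (incl k).map (K ◁ f) := by
  apply hom_incl_ext
  intro q
  apply incl_tensor_hom_ext
  intro a b h x y
  refine (congr_arg ((inclTensorIso K L').hom.f (0, q)).hom
    (univ_whiskerLeft ((incl k).obj K) ((incl k).map f) (0, a) (0, b) (0, q) x y)).trans ?_
  refine (inclTensorIso_univ K L' a b q x ((f.f b).hom y)).trans ?_
  refine Eq.symm ((congr_arg ((K ◁ f).f q).hom (inclTensorIso_univ K L a b q x y)).trans ?_)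
  exact tensorHom_tmk (𝟙 K.X) f.f a b q x y

/-- Both composites send (x ⊗ y) ⊗ z to x ⊗ (y ⊗ z); only pure tensors in horizontal degree 0 have
to be compared. -/
lemma inclTensorIso_associativity (K L M : Ch k) :
    (inclTensorIso K L).hom ▷ (incl k).obj M ≫ (inclTensorIso (K ⊗ L) M).hom ≫
        (incl k).map (α_ K L M).hom =
      (α_ ((incl k).obj K) ((incl k).obj L) ((incl k).obj M)).hom ≫
        (incl k).obj K ◁ (inclTensorIso L M).hom ≫ (inclTensorIso K (L ⊗ M)).hom := by
  apply hom_incl_ext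
  intro q
  apply tensor₃_hom_ext
  rintro ⟨a1, a⟩ ⟨b1, b⟩ ⟨c1, c⟩ h x y z
  have h1 := congr_arg Prod.fst h
  have h2 := congr_arg Prod.snd h
  dsimp at h1 h2
  obtain rfl : a1 = 0 := by lia
  obtain rfl : b1 = 0 := by lia
  obtain rfl : c1 = 0 := by lia
  have e1 : (((inclTensorIso K L).hom ▷ (incl k).obj M).f (0, q)).hom
      (Pairing.univ ((incl k).obj K ⊗ (incl k).obj L) ((incl k).obj M) (0, a + b) (0, c) (0, q)
        (Pairing.univ ((incl k).obj K) ((incl k).obj L) (0, a) (0, b) (0, a + b) x y) z) =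
      Pairing.univ ((incl k).obj (K ⊗ L)) ((incl k).obj M) (0, a + b) (0, c) (0, q)
        (tmk K.X L.X a b (a + b) x y) z :=
    (univ_whiskerRight (inclTensorIso K L).hom ((incl k).obj M) (0, a + b) (0, c) (0, q) _ z).trans
      (congr_arg (fun t => Pairing.univ ((incl k).obj (K ⊗ L)) ((incl k).obj M) (0, a + b) (0, c)
        (0, q) t z) (inclTensorIso_univ K L a b (a + b) x y))
  have e2 := inclTensorIso_univ (K ⊗ L) M (a + b) c q (tmk K.X L.X a b (a + b) x y) z
  have e3 := associator_tmk (X := K.X) (Y := L.X) (Z := M.X) (j := q) (rfl : a + b = a + b)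
    (rfl : b + c = b + c) x y z
  have f1 := associator_univ (A := (incl k).obj K) (B := (incl k).obj L) (C := (incl k).obj M)
    (a := (0, a)) (b := (0, b)) (c := (0, c)) (ab := (0, a + b)) (bc := (0, b + c)) (j := (0, q))
    rfl rfl x y z
  have f2 : (((incl k).obj K ◁ (inclTensorIso L M).hom).f (0, q)).hom
      (Pairing.univ ((incl k).obj K) ((incl k).obj L ⊗ (incl k).obj M) (0, a) (0, b + c) (0, q) x
        (Pairing.univ ((incl k).obj L) ((incl k).obj M) (0, b) (0, c) (0, b + c) y z)) =
      Pairing.univ ((incl k).obj K) ((incl k).obj (L ⊗ M)) (0, a) (0, b + c) (0, q) x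
        (tmk L.X M.X b c (b + c) y z) :=
    (univ_whiskerLeft ((incl k).obj K) (inclTensorIso L M).hom (0, a) (0, b + c) (0, q) x _).trans
      (congr_arg (Pairing.univ ((incl k).obj K) ((incl k).obj (L ⊗ M)) (0, a) (0, b + c) (0, q) x)
        (inclTensorIso_univ L M b c (b + c) y z))
  have f3 := inclTensorIso_univ K (L ⊗ M) a (b + c) q x (tmk L.X M.X b c (b + c) y z)
  refine (congr_arg ((α_ K L M).hom.f q).hom
    ((congr_arg ((inclTensorIso (K ⊗ L) M).hom.f (0, q)).hom e1).trans e2)).trans ?_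
  refine Eq.trans e3 (Eq.symm ?_)
  exact (congr_arg ((inclTensorIso K (L ⊗ M)).hom.f (0, q)).hom
    ((congr_arg (((incl k).obj K ◁ (inclTensorIso L M).hom).f (0, q)).hom f1).trans f2)).trans f3

lemma inclTensorIso_left_unitality (K : Ch k) :
    (λ_ ((incl k).obj K)).hom = (inclUnitIso k).hom ▷ (incl k).obj K ≫
      (inclTensorIso (𝟙_ (Ch k)) K).hom ≫ (incl k).map (λ_ K).hom := by
  rw [← cancel_epi (λ_ ((incl k).obj K)).inv, Iso.inv_hom_id]
  apply incl_hom_ext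
  intro q
  ext x
  symm
  have e1 := leftUnitor_inv_univ ((incl k).obj K) (0, q) x
  have e2 := (univ_whiskerRight (inclUnitIso k).hom ((incl k).obj K) 0 (0, q) (0, q)
    (unitElt k (ℕ × ℤ)) x).trans (congr_arg (fun t => Pairing.univ ((incl k).obj (𝟙_ (Ch k)))
      ((incl k).obj K) 0 (0, q) (0, q) t x) inclUnitIso_apply)
  have e3 := inclTensorIso_univ (𝟙_ (Ch k)) K 0 q q (unitElt k ℤ) x
  have e4 := gradedLeftUnitor_inv_apply (X := K.X) q x
  have e5 : ((λ_ K).hom.f q).hom (((HomologicalComplex.gradedLeftUnitor K.X).inv q).hom x) = x :=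
    congr_arg (fun t => (t.f q).hom x) (λ_ K).inv_hom_id
  refine Eq.trans ?_ e5
  refine congr_arg ((λ_ K).hom.f q).hom (Eq.trans ?_ e4.symm)
  exact (congr_arg ((inclTensorIso (𝟙_ (Ch k)) K).hom.f (0, q)).hom
    ((congr_arg (((inclUnitIso k).hom ▷ (incl k).obj K).f (0, q)).hom e1).trans e2)).trans e3

lemma inclTensorIso_right_unitality (K : Ch k) :
    (ρ_ ((incl k).obj K)).hom = (incl k).obj K ◁ (inclUnitIso k).hom ≫
      (inclTensorIso K (𝟙_ (Ch k))).hom ≫ (incl k).map (ρ_ K).hom := by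
  rw [← cancel_epi (ρ_ ((incl k).obj K)).inv, Iso.inv_hom_id]
  apply incl_hom_ext
  intro q
  ext x
  symm
  have e1 := rightUnitor_inv_univ ((incl k).obj K) (0, q) x
  have e2 := (univ_whiskerLeft ((incl k).obj K) (inclUnitIso k).hom (0, q) 0 (0, q) x
    (unitElt k (ℕ × ℤ))).trans (congr_arg (Pairing.univ ((incl k).obj K)
      ((incl k).obj (𝟙_ (Ch k))) (0, q) 0 (0, q) x) inclUnitIso_apply)
  have e3 := inclTensorIso_univ K (𝟙_ (Ch k)) q 0 q x (unitElt k ℤ)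
  have e4 := gradedRightUnitor_inv_apply (X := K.X) q x
  have e5 : ((ρ_ K).hom.f q).hom (((HomologicalComplex.gradedRightUnitor K.X).inv q).hom x) = x :=
    congr_arg (fun t => (t.f q).hom x) (ρ_ K).inv_hom_id
  refine Eq.trans ?_ e5
  refine congr_arg ((ρ_ K).hom.f q).hom (Eq.trans ?_ e4.symm)
  exact (congr_arg ((inclTensorIso K (𝟙_ (Ch k))).hom.f (0, q)).hom
    ((congr_arg (((incl k).obj K ◁ (inclUnitIso k).hom).f (0, q)).hom e1).trans e2)).trans e3

/-- On horizontal degree 0 the Koszul sign of the total degree is that of the degree in Ch. -/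
lemma inclTensorIso_braided (K L : Ch k) :
    (inclTensorIso K L).hom ≫ (incl k).map (β_ K L).hom =
      (β_ ((incl k).obj K) ((incl k).obj L)).hom ≫ (inclTensorIso L K).hom := by
  apply hom_incl_ext
  intro q
  apply incl_tensor_hom_ext
  intro a b h x y
  refine (congr_arg ((β_ K L).hom.f q).hom (inclTensorIso_univ K L a b q x y)).trans ?_
  refine (braidingHom_tmk (X := K.X) (Y := L.X) (ComplexShape.TensorSigns.ε' (ComplexShape.down ℤ))
    a b q x y).trans ?_
  refine Eq.symm ((congr_arg ((inclTensorIso L K).hom.f (0, q)).hom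
    (braiding_univ ((incl k).obj K) ((incl k).obj L) (0, a) (0, b) (0, q) x y)).trans ?_)
  refine (units_smul_map ((inclTensorIso L K).hom.f (0, q)).hom _ _).trans ?_
  have ha : ∀ a : ℤ, sgn (0, a) = a.negOnePow := fun a => congr_arg Int.negOnePow (zero_add a)
  rw [ha, ha]
  exact congr_arg (_ • ·) (inclTensorIso_univ L K b a q y x)

/-- The inclusion of complexes as bicomplexes in horizontal degree zero is strong monoidal. -/
noncomputable instance : (incl k).Monoidal :=
  Functor.CoreMonoidal.toMonoidal
    { εIso := inclUnitIso k
      μIso := inclTensorIso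
      μIso_hom_natural_left := inclTensorIso_natural_left
      μIso_hom_natural_right := inclTensorIso_natural_right
      associativity := inclTensorIso_associativity
      left_unitality := inclTensorIso_left_unitality
      right_unitality := inclTensorIso_right_unitality }

noncomputable instance : (incl k).Braided where
  braided := inclTensorIso_braided

end BCh

/-! ### The projective model structure is monoidal -/

namespace BCh

variable (k : Type u) [CommRing k]

instance : (incl k).Faithful where
  map_injective {K L f g} h := by
    ext q : 1
    exact congr_arg (fun φ => φ.f (0, q)) h

instance : (incl k).Full where
  map_surjective {K L} φ := ⟨(column 0).map φ, hom_incl_ext (fun q => rfl)⟩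

end BCh

namespace Ch

open BCh MorphismProperty

variable (k : Type u) [CommRing k]

/-- In positive columns `incl` π is a map between zero complexes, so lifting is automatic there. -/
lemma cofGen_rlp_incl_map {K L : Ch k} (π : K ⟶ L) (hπ : (cofGen k).rlp π) :
    (BCh.cofGen k).rlp ((incl k).map π) := by
  rw [BCh.cofGen_rlp_iff]
  intro p
  by_cases hp : p = 0
  · subst hp
    exact (colLift_incl_map_zero π).2 ((cofGen_rlp_iff π).1 hπ)
  · exact colLift_incl_map π p hp

lemma trivGen_rlp_incl_map {K L : Ch k} (π : K ⟶ L) (hπ : (trivGen k).rlp π) :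
    (BCh.trivGen k).rlp ((incl k).map π) :=
  (BCh.trivGen_rlp_iff_colLift _).2 ⟨fun p q hp => colLift_incl_map π p hp q,
    (trivGen_rlp_iff π).1 hπ⟩

lemma isZero_incl_obj {Z : Ch k} (hZ : IsInitial Z) : IsZero ((incl k).obj Z) :=
  have := (inclAdj k).isLeftAdjoint
  (isZero_zero (BCh k)).of_iso
    ((hZ.isInitialObj (incl k) Z).uniqueUpToIso HasZeroObject.zeroIsInitial)

lemma isZero_of_incl_obj {Z : Ch k} (hZ : IsZero ((incl k).obj Z)) : IsZero Z := by
  rw [IsZero.iff_id_eq_zero]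
  exact (incl k).map_injective (hZ.eq_of_src _ _)

/-- Checked after the faithful inclusion, where tensoring is a left adjoint. -/
lemma isZero_tensor_initial (A : Ch k) {Z : Ch k} (hZ : IsInitial Z) : IsZero (A ⊗ Z) := by
  apply isZero_of_incl_obj
  have h : IsInitial ((incl k).obj A ⊗ (incl k).obj Z) :=
    ((isZero_incl_obj k hZ).isInitial).isInitialObj (tensorLeft ((incl k).obj A)) _
  exact ((isZero_zero (BCh k)).of_iso (h.uniqueUpToIso HasZeroObject.zeroIsInitial)).of_iso
    (inclTensorIso A Z).symm

lemma hasLiftingProperty_unit {Z E F : Ch k} (hZ : IsInitial Z) (i : Z ⟶ 𝟙_ (Ch k)) (π : E ⟶ F)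
    (hπ : (cofGen k).rlp π) : HasLiftingProperty i π := by
  have h1 : HasLiftingProperty ((incl k).map i ≫ (inclUnitIso k).inv) ((incl k).map π) :=
    BCh.hasLiftingProperty_unit (isZero_incl_obj k hZ) _ _
      ((BCh.cofGen_rlp_iff _).1 (cofGen_rlp_incl_map k π hπ) 0)
  refine ⟨fun {u v} sq => ?_⟩
  have sq' : CommSq ((incl k).map u) ((incl k).map i ≫ (inclUnitIso k).inv) ((incl k).map π)
      ((inclUnitIso k).hom ≫ (incl k).map v) := ⟨by
    rw [Category.assoc, Iso.inv_hom_id_assoc, ← Functor.map_comp, ← Functor.map_comp, sq.w]⟩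
  refine ⟨⟨⟨(incl k).preimage ((inclUnitIso k).inv ≫ sq'.lift), hZ.hom_ext _ _,
    (incl k).map_injective ?_⟩⟩⟩
  rw [Functor.map_comp, Functor.map_preimage, Category.assoc, sq'.fac_right,
    Iso.inv_hom_id_assoc]

/-- The inclusion sends cofibrations, trivial cofibrations, fibrations and trivial fibrations of Ch
to those of bicomplexes, and pushout-product lifting is reflected along it. -/
lemma isMonoidalModelCategory_projModel :
    letI := projModel k
    IsMonoidalModelCategory (Ch k) :=
  letI := projModel k
  isMonoidalModelCategory_of_hasLiftingProperty
    (fun f g π hf hg h h' => hasLiftingProperty_pushoutProduct_of_map (incl k) f g π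
      (hasLiftingProperty_pushoutProduct_of_cofGen k _ _ _
        (cofGen_rlp_llp_incl_map k f ((cofibration_iff f).1 hf))
        (cofGen_rlp_llp_incl_map k g ((cofibration_iff g).1 hg))
        (cofGen_rlp_incl_map k π ((cofGen_rlp k).symm.le π
          ⟨(fibration_iff π).1 h, (weakEquivalence_iff π).1 h'⟩))))
    (fun f g π hf hf' hg h => hasLiftingProperty_pushoutProduct_of_map (incl k) f g π
      (hasLiftingProperty_pushoutProduct_of_trivGen k _ _ _
        (trivGen_rlp_llp_incl_map k f
          ((IsGrothendieckAbelian.modelCategory_cofibration_and_weakEquivalence_iff _ _ _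
            (cofGen_le k) (trivGen_le k) (cofGen_rlp k) (trivGen_rlp_llp_le k) f).1 ⟨hf, hf'⟩))
        (cofGen_rlp_llp_incl_map k g ((cofibration_iff g).1 hg))
        (trivGen_rlp_incl_map k π ((fibration_iff π).1 h))))
    ((cofibration_iff _).2 (fun E F π hπ => hasLiftingProperty_unit k initialIsInitial _ π hπ))
    (fun A => ⟨(isZero_tensor_initial k A initialIsInitial).isInitial⟩)

end Ch

/-! ### Conclusion -/

namespace BCh

variable (k : Type u) [CommRing k]

lemma isStrongSymmetricMonoidalQuillenEquivalence_inclAdj :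
    letI := totModel k
    letI := Ch.projModel k
    IsStrongSymmetricMonoidalQuillenEquivalence (inclAdj k) :=
  letI := totModel k
  letI := Ch.projModel k
  { isQuillenEquivalence_inclAdj k with
    source := Ch.isMonoidalModelCategory_projModel k
    target := isMonoidalModelCategory_totModel k
    braided := ⟨inferInstance⟩
    -- The inclusion preserves all quasi-isomorphisms, because Tot of `incl` K is K up to the
    -- quasi-isomorphism `colTot`.
    weakEquivalence_map_unit := fun q _ hq => (weakEquivalence_iff _).2
      ((quasiIso_tot_incl_map_iff q).2 ((weakEquivalence_iff q).1 hq)) }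

end BCh

theorem proposition3p4 (k : Type u) [CommRing k] :
    ∃ (m₁ : ModelCategory (Ch k)) (m₂ : ModelCategory (BCh k)),
      IsProjectiveModelStructure m₁ ∧ IsTotalModelStructure m₂ ∧
      ∃ adj : BCh.incl k ⊣ BCh.column 0,
        (∀ (K : Ch k) (A : BCh k) (f : (BCh.incl k).obj K ⟶ A) (q : ℤ),
          (adj.homEquiv K A f).f q = f.f (0, q)) ∧
        IsStrongSymmetricMonoidalQuillenEquivalence adj :=
  ⟨Ch.projModel k, BCh.totModel k, Ch.isProjectiveModelStructure_projModel k,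
    BCh.isTotalModelStructure_totModel k, BCh.inclAdj k,
    fun K A f q => by
      rw [BCh.inclAdj_homEquiv]
      rfl,
    BCh.isStrongSymmetricMonoidalQuillenEquivalence_inclAdj k⟩
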